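/- **Theorem (Average error estimate).** Let $Q\ge 1$, $\nu_1>0$, $\nu_j\ge 0$ $(2\le j\le Q)$, $1\ge\alpha_1\ge\alpha_2\ge\dots\ge\alpha_Q>0$, $T>0$, and let $Y$ be a solution on $[0,T]$ of $$\sum_{j=1}^Q \nu_j\,{}_CD^{\alpha_j}_{0,t}Y(t)=-Y(t),\quad t\in(0,T],\qquad Y(0)=Y_0,$$ where ${}_CD^{\alpha}_{0,t}$ is the Caputo derivative. Suppose that $Y(t)-Y(0)=\sum_{k\ge1}c_kt^{\sigma_k}$ on $[0,T]$ with real constants $c_k$ and $0<\sigma_1<\sigma_2<\cdots$. Let $m_1,\dots,m_Q\ge 0$ be integers with $\sigma_{m_j}\le 2$ whenever $m_j\ge1$, and put $m=\max_jm_j$. For $\tau=T/n_T$ (with $n_T\ge 1$, $n_T\ge m$) and $t_n=n\tau$ define, for a grid function $u$, $$\mathcal A^{\alpha,n,\ell}u=\frac1{\tau^\alpha}\sum_{k=0}^n g^{(\alpha)}_{n-k}u^k+\frac1{\tau^\alpha}\sum_{k=1}^{\ell}w^{(\alpha)}_{n,k}u^k,$$ where $\omega_k^{(\alpha)}=(-1)^k\binom{\alpha}{k}$,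 $g_0^{(\alpha)}=\frac{2+\alpha}2\omega_0^{(\alpha)}$, $g_k^{(\alpha)}=\frac{2+\alpha}2\omega_k^{(\alpha)}-\frac\alpha2\omega_{k-1}^{(\alpha)}$ $(k\ge1)$, and the starting weights $w^{(\alpha)}_{n,1},\dots,w^{(\alpha)}_{n,\ell}$ (which also depend on $\ell$) are the unique solution of $$\sum_{k=1}^{\ell}w_{n,k}^{(\alpha)}k^{\sigma_r}=\frac{\Gamma(\sigma_r+1)}{\Gamma(\sigma_r+1-\alpha)}n^{\sigma_r-\alpha}-\sum_{k=0}^n g^{(\alpha)}_{n-k}k^{\sigma_r},\qquad 1\le r\le \ell .$$ Let $y^0=Y_0$, let $y^1,\dots,y^m$ be arbitrary real starting values, and let $(y^n)$ satisfy $$\sum_{j=1}^Q\nu_j\,\mathcal A^{\alpha_j,n,m_j}(y-y^0)=-y^n,\qquad m<n\le n_T.$$ Write $e^n=Y(t_n)-y^n$ and $q=\min_{1\le j\le Q}\{\sigma_{m_j+1}-\alpha_j\}$. Then there is a constant $C>0$, independent of $\tau$, $K$ and the numerical solution $(y^n)$, such that for all $1\le K\le n_T$ $$\Big(\tau\sum_{n=1}^K|e^n|^2\Big)^{1/2}\le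 C\tau^{\min\{2,\,q+\frac12\}}+C\max_{1\le r\le m}|e^r|\sum_{j=1}^Q\tau^{\frac12-\alpha_j}K^{\max\{0,\,\sigma_m-\alpha_j-\frac32\}},$$ where for $m=0$ the second term on the right is absent. In particular: (i) if $m_j=0$ for all $j$, then $\big(\tau\sum_{n=1}^K|e^n|^2\big)^{1/2}\le C\tau^{\min\{2,\,\sigma_1-\alpha_1+\frac12\}}$ for $1\le K\le n_T$; (ii) if $m_j=m$ for all $j$ and $\max_{1\le r\le m}|e^r|\le C_0\tau^{\sigma_{m+1}}$, then $\big(\tau\sum_{n=1}^K|e^n|^2\big)^{1/2}\le C\tau^{\min\{2,\,\sigma_{m+1}-\alpha_1+\frac12\}}$ for $1\le K\le n_T$, where $C$ may also depend on $C_0$. -/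

import Mathlib

open Set MeasureTheory

noncomputable section

namespace MultiTermFODE

/-! ### Caputo derivative and the initial value problem -/

/-- The Caputo derivative of order `β > 0` with base point `0`, with `n - 1 < β ≤ n`:
`1 / Γ(n - β) * ∫_0^t (t - s)^(n - β - 1) U^(n)(s) ds` for `β < n`, and `U^(n)(t)` for `β = n`.
The derivatives are taken within `[0, t]`, so only the values of `U` on `[0, t]` matter. -/
def caputoDeriv (β : ℝ) (U : ℝ → ℝ) (t : ℝ) : ℝ :=
  if β = (⌈β⌉₊ : ℝ) then iteratedDerivWithin ⌈β⌉₊ U (Icc 0 t) t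
  else 1 / Real.Gamma ((⌈β⌉₊ : ℝ) - β) *
    ∫ s in (0 : ℝ)..t, (t - s) ^ ((⌈β⌉₊ : ℝ) - β - 1) * iteratedDerivWithin ⌈β⌉₊ U (Icc 0 t) s

/-- `Y` solves `∑ j, ν j * (Caputo derivative of order α j of Y)(t) = f (t, Y t)` on `(0, T]`,
`Y 0 = Y₀`, for orders `α j ∈ (0, 1]`. The fields `diff` and `integrable` say that the
derivatives in the equation exist. -/
structure IsSolution {Q : ℕ} (ν α : Fin Q → ℝ) (f : ℝ → ℝ → ℝ) (T Y₀ : ℝ) (Y : ℝ → ℝ) :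
    Prop where
  initial : Y 0 = Y₀
  cont : ContinuousOn Y (Icc 0 T)
  diff : DifferentiableOn ℝ Y (Ioc 0 T)
  integrable : ∀ j, α j < 1 → ∀ t ∈ Ioc 0 T,
    IntervalIntegrable (fun s => (t - s) ^ (-α j) * deriv Y s) volume 0 t
  eqn : ∀ t ∈ Ioc 0 T, ∑ j, ν j * caputoDeriv (α j) Y t = f t (Y t)

/-! ### The second-order weighted shifted Grünwald-Letnikov formula, shifts `(0, -1)` -/

/-- `ω_k^(α) = (-1)^k * binom(α, k)`. -/
def glWeight (α : ℝ) (k : ℕ) : ℝ := (-1) ^ k * Ring.choose α k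

/-- `g_0 = (2 + α)/2 * ω_0` and `g_k = (2 + α)/2 * ω_k - α/2 * ω_{k-1}` for `k ≥ 1`. -/
def wsglWeight (α : ℝ) : ℕ → ℝ
  | 0 => (2 + α) / 2 * glWeight α 0
  | k + 1 => (2 + α) / 2 * glWeight α (k + 1) - α / 2 * glWeight α k

/-- The exponential Vandermonde matrix with entries `k ^ σ_r`, `1 ≤ r, k ≤ m`
(rows `r`, columns `k`; the indices `1, …, m` are represented by `Fin m`). -/
def expVandermonde (σ : ℕ → ℝ) (m : ℕ) : Matrix (Fin m) (Fin m) ℝ :=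
  fun r k => ((k : ℝ) + 1) ^ σ (r + 1)

/-- The right-hand side of the linear system for the starting weights at the `n`-th node,
`Γ(σ_r + 1) / Γ(σ_r + 1 - α) * n ^ (σ_r - α) - ∑_{k=0}^n g_{n-k} k ^ σ_r`, `1 ≤ r ≤ m`. -/
def startingRhs (α : ℝ) (σ : ℕ → ℝ) (m n : ℕ) : Fin m → ℝ := fun r =>
  Real.Gamma (σ (r + 1) + 1) / Real.Gamma (σ (r + 1) + 1 - α) * (n : ℝ) ^ (σ (r + 1) - α)
    - ∑ k ∈ Finset.range (n + 1), wsglWeight α (n - k) * (k : ℝ) ^ σ (r + 1)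

/-- The starting weights `w_{n,1}, …, w_{n,m}`: the solution of the exponential Vandermonde
system (see `startingWeight_unique` below). -/
def startingWeight (α : ℝ) (σ : ℕ → ℝ) (m n : ℕ) : Fin m → ℝ :=
  (expVandermonde σ m)⁻¹.mulVec (startingRhs α σ m n)

/-- The WSGL operator with `m` correction terms, applied to the grid function `u` at the
`n`-th node of the grid of step size `τ`. -/
def wsglCorrected (α : ℝ) (σ : ℕ → ℝ) (m : ℕ) (τ : ℝ) (u : ℕ → ℝ) (n : ℕ) : ℝ :=
  1 / τ ^ α * (∑ k ∈ Finset.range (n + 1), wsglWeight α (n - k) * u k)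
    + 1 / τ ^ α * ∑ k : Fin m, startingWeight α σ m n k * u (k + 1)

/-- The total number of starting values, `max_j m_j`. -/
def numStart {Q : ℕ} (m : Fin Q → ℕ) : ℕ := Finset.univ.sup m

/-- `y` satisfies the fully discrete scheme with step size `T / N` on `[0, T]`, after the
starting values `y 1, …, y (max_j m_j)`, which are arbitrary (in particular, they may solve the
scheme's equations with `1 ≤ n ≤ max_j m_j`). -/
structure IsDiscreteSolution {Q : ℕ} (ν α : Fin Q → ℝ) (σ : ℕ → ℝ) (m : Fin Q → ℕ)
    (f : ℝ → ℝ → ℝ) (T Y₀ : ℝ) (N : ℕ) (y : ℕ → ℝ) : Prop where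
  initial : y 0 = Y₀
  scheme : ∀ n, numStart m < n → n ≤ N →
    ∑ j, ν j * wsglCorrected (α j) σ (m j) (T / N) (fun k => y k - y 0) n
      = f (n * (T / N)) (y n)

/-! ### The quantities in the error estimate -/

/-- `e^n = Y(t_n) - y^n`, `t_n = n τ`. -/
def nodalError (Y : ℝ → ℝ) (τ : ℝ) (y : ℕ → ℝ) (n : ℕ) : ℝ := Y (n * τ) - y n

/-- `max_{1 ≤ r ≤ M} |e^r|`, which is `0` for `M = 0`. -/
def maxStartError (Y : ℝ → ℝ) (τ : ℝ) (y : ℕ → ℝ) (M : ℕ) : ℝ :=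
  ⨆ r : Fin M, |nodalError Y τ y (r + 1)|

/-- `(τ ∑_{n=1}^K |e^n|²)^(1/2)`. -/
def averageError (Y : ℝ → ℝ) (τ : ℝ) (y : ℕ → ℝ) (K : ℕ) : ℝ :=
  (τ * ∑ n ∈ Finset.Icc 1 K, |nodalError Y τ y n| ^ 2) ^ (1 / 2 : ℝ)

/-! ### The starting weights are well defined -/

theorem genPoly_zero : ∀ (n : ℕ) (b a z : Fin n → ℝ), Function.Injective b → StrictMono z →
    (∀ i, 0 < z i) → (∀ i, ∑ r, a r * z i ^ b r = 0) → ∀ r, a r = 0 := by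
  intro n
  induction n with
  | zero => intro b a z _ _ _ _ r; exact r.elim0
  | succ n ih =>
    intro b a z hb hz hpos hzero
    let F : ℝ → ℝ := fun x => ∑ r, a r * x ^ (b r - b 0)
    let F' : ℝ → ℝ := fun x => ∑ r, a r * ((b r - b 0) * x ^ (b r - b 0 - 1))
    have hF : ∀ x, 0 < x → HasDerivAt F (F' x) x := by
      intro x hx
      refine HasDerivAt.fun_sum fun r _ => ?_
      exact (Real.hasDerivAt_rpow_const (Or.inl hx.ne')).const_mul (a r)
    have hFz : ∀ i, F (z i) = 0 := by
      intro i
      have h1 : F (z i) = (∑ r, a r * z i ^ b r) * z i ^ (-b 0) := by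
        simp only [F, Finset.sum_mul]
        refine Finset.sum_congr rfl fun r _ => ?_
        rw [sub_eq_add_neg, Real.rpow_add (hpos i), mul_assoc]
      rw [h1, hzero, zero_mul]
    have hroll : ∀ i : Fin n, ∃ x ∈ Ioo (z i.castSucc) (z i.succ), F' x = 0 := by
      intro i
      have hlt : z i.castSucc < z i.succ := hz (Fin.castSucc_lt_succ)
      refine exists_hasDerivAt_eq_zero hlt ?_ ((hFz _).trans (hFz _).symm) ?_
      · intro x hx
        exact (hF x ((hpos _).trans_le hx.1)).continuousAt.continuousWithinAt
      · intro x hx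
        exact hF x ((hpos _).trans hx.1)
    choose x hx hx0 using hroll
    have key := ih (fun r => b r.succ - b 0 - 1) (fun r => a r.succ * (b r.succ - b 0)) x
      (by
        intro r s hrs
        have h : b r.succ = b s.succ := by simpa using hrs
        exact Fin.succ_injective _ (hb h))
      (by
        intro i j hij
        have h1 := (hx i).2
        have h2 := (hx j).1
        have h3 : z i.succ ≤ z j.castSucc := hz.monotone (by
          rw [Fin.le_iff_val_le_val]; simpa using hij)
        linarith)
      (fun i => (hpos _).trans (hx i).1)
      (by
        intro i
        have h := hx0 i
        simp only [F', Fin.sum_univ_succ, sub_self, zero_mul, mul_zero, zero_add] at h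
        rw [← h]
        exact Finset.sum_congr rfl fun r _ => by ring)
    have hsucc : ∀ r : Fin n, a r.succ = 0 := by
      intro r
      rcases mul_eq_zero.1 (key r) with h | h
      · exact h
      · exact absurd (hb (sub_eq_zero.1 h)) (Fin.succ_ne_zero r)
    have h0 := hzero 0
    rw [Fin.sum_univ_succ] at h0
    simp only [hsucc, zero_mul, Finset.sum_const_zero, add_zero] at h0
    have ha0 : a 0 = 0 := by
      rcases mul_eq_zero.1 h0 with h | h
      · exact h
      · exact absurd h (Real.rpow_pos_of_pos (hpos 0) _).ne'
    intro r
    exact Fin.cases ha0 hsucc r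

theorem expVandermonde_det_ne_zero {σ : ℕ → ℝ} (hσ : StrictMonoOn σ (Ici 1)) (m : ℕ) :
    (expVandermonde σ m).det ≠ 0 := by
  intro hdet
  obtain ⟨v, hv0, hv⟩ := Matrix.exists_vecMul_eq_zero_iff.2 hdet
  apply hv0
  funext r
  refine genPoly_zero m (fun r => σ (r + 1)) v (fun k => (k : ℝ) + 1) ?_ ?_ ?_ ?_ r
  · intro r s hrs
    have h : (r : ℕ) + 1 = (s : ℕ) + 1 := hσ.injOn (by simp) (by simp) hrs
    exact Fin.ext (by simpa using h)
  · intro i j hij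
    have : (i : ℝ) < (j : ℝ) := by exact_mod_cast hij
    simpa using this
  · intro i; positivity
  · intro i
    simpa [Matrix.vecMul, dotProduct, expVandermonde] using congrFun hv i

/-- The starting weights are the unique solution of their linear system. -/
theorem startingWeight_unique {σ : ℕ → ℝ} (hσ : StrictMonoOn σ (Ici 1)) (α : ℝ) (m n : ℕ)
    (w : Fin m → ℝ) :
    (∀ r : Fin m, ∑ k : Fin m, w k * ((k : ℝ) + 1) ^ σ (r + 1) = startingRhs α σ m n r)
      ↔ w = startingWeight α σ m n := by
  have hunit : IsUnit (expVandermonde σ m).det :=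
    isUnit_iff_ne_zero.2 (expVandermonde_det_ne_zero hσ m)
  have h1 : (∀ r : Fin m, ∑ k : Fin m, w k * ((k : ℝ) + 1) ^ σ (r + 1) = startingRhs α σ m n r)
      ↔ (expVandermonde σ m).mulVec w = startingRhs α σ m n := by
    rw [funext_iff]
    refine forall_congr' fun r => ?_
    simp [Matrix.mulVec, dotProduct, expVandermonde, mul_comm]
  rw [h1, startingWeight]
  constructor
  · intro h
    rw [← h, Matrix.mulVec_mulVec, Matrix.nonsing_inv_mul _ hunit, Matrix.one_mulVec]
  · intro h
    rw [h, Matrix.mulVec_mulVec, Matrix.mul_nonsing_inv _ hunit, Matrix.one_mulVec]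

end MultiTermFODE

end

/-! The proof is an energy argument in `ℓ²` for the error equation, with residuals measured by a
bound `B n^(-1/2)`.

Stability. Let `A_n = ∑_{k ≤ n} g_k`. The quadratic form of the convolution dominates `1/2 ∑
A_{max(n,2)} u_n²` (`wsgl_form_coercive`): the weights `g_k` with `k ≥ 3` are nonpositive, and the
first three are handled by the G-stability inequality of BDF2. For `α < 1` one has `A_n ≥ c n^(-α)`,
and Young's inequality against a residual `B n^(-1/2)` leaves `B² τ^α ∑ n^(α-1)`, which is of size
`B² (Kτ)^α`. Hence `∑ e_n² ≤ C B²` (`stability`). If all active orders equal one, the scheme is BDF2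
and a telescoping energy takes over.

Consistency. The truncation error is written with Peano kernels. Their node values have closed forms
in `Γ(n+1-α)/Γ(n+1)`, and the second-order asymptotics of this ratio yields the decay `x^(-α-1)` and
`x^(-α)` of the first and second kernel. On the unit grid a function whose derivatives of order `i ≤
3` are `O(x^(σ-i))` then has error `O(n^(σ-α-2) + n^(-1/2))` (`exists_truncation_bound`); rescaling
brings in `τ`.

Regularity. Convergence of the expansion on `[0, T]` alone does not bound its derivatives up to `T`.
Comparing coefficients in the equation gives a backward-shift recursion for `c_k Γ(σ_k + 1)`, so
these numbers grow at most geometrically, and division by `Γ` makes the series converge for all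
times (`IsSolution.genSummable`).

Assembly. The corrected formula is exact on the first `m_j` powers, so the residual is at most `C
τ^min(3/2, q) n^(-1/2)`; the factor `τ^(1/2)` of the average norm turns this into `τ^min(2, q +
1/2)`. The starting errors are moved into the residual, where the decay of the weights bounds them.
-/

noncomputable section
namespace MultiTermFODE

/-! ### Grünwald-Letnikov weights and their partial sums -/

/-- The partial sums of the Grünwald-Letnikov weights. -/
def glPartialSum (α : ℝ) (n : ℕ) : ℝ := ∑ k ∈ Finset.range (n + 1), glWeight α k

/-- The partial sums of the WSGL weights. -/
def wsglPartialSum (α : ℝ) (n : ℕ) : ℝ := ∑ k ∈ Finset.range (n + 1), wsglWeight α k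

@[simp] theorem glWeight_zero (α : ℝ) : glWeight α 0 = 1 := by
  simp [glWeight]

theorem glWeight_succ (α : ℝ) (k : ℕ) :
    glWeight α (k + 1) = glWeight α k * ((k - α) / (k + 1)) := by
  have h := Ring.choose_smul_choose α (Nat.le_succ k)
  simp only [Nat.succ_eq_add_one, Nat.choose_succ_self_right, nsmul_eq_mul,
    Nat.add_sub_cancel_left, Ring.choose_one_right] at h
  push_cast at h
  have hk : (k : ℝ) + 1 ≠ 0 := by positivity
  have h' : Ring.choose α (k + 1) = Ring.choose α k * (α - k) / (k + 1) := by
    rw [eq_div_iff hk, ← h]; ring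
  rw [glWeight, glWeight, h', pow_succ]
  ring

@[simp] theorem glPartialSum_zero (α : ℝ) : glPartialSum α 0 = 1 := by
  simp [glPartialSum]

theorem glPartialSum_succ_eq_add (α : ℝ) (n : ℕ) :
    glPartialSum α (n + 1) = glPartialSum α n + glWeight α (n + 1) :=
  Finset.sum_range_succ _ _

/-- The partial sums are themselves signed binomial coefficients, of `α - 1`, so each weight is a
multiple of the preceding partial sum. -/
theorem glWeight_succ_eq (α : ℝ) (n : ℕ) :
    glWeight α (n + 1) = -(α * glPartialSum α n / (n + 1)) := by
  induction n with
  | zero => rw [glWeight_succ]; simp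
  | succ n ih =>
    rw [glWeight_succ, glPartialSum_succ_eq_add, ih]
    push_cast
    field_simp
    ring

theorem glPartialSum_succ (α : ℝ) (n : ℕ) :
    glPartialSum α (n + 1) = glPartialSum α n * (1 - α / (n + 1)) := by
  rw [glPartialSum_succ_eq_add, glWeight_succ_eq]
  ring

/-- Since `g_k = ω_k + (α/2)(ω_k - ω_{k-1})`, the second part telescopes. -/
theorem wsglPartialSum_eq (α : ℝ) (n : ℕ) :
    wsglPartialSum α n = glPartialSum α n + α / 2 * glWeight α n := by
  induction n with
  | zero => simp [wsglPartialSum, wsglWeight]; ring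
  | succ n ih =>
    rw [wsglPartialSum, Finset.sum_range_succ, ← wsglPartialSum, ih, glPartialSum_succ_eq_add,
      wsglWeight]
    ring

theorem glPartialSum_nonneg {α : ℝ} (hα : α ≤ 1) (n : ℕ) : 0 ≤ glPartialSum α n := by
  induction n with
  | zero => simp
  | succ n ih =>
    rw [glPartialSum_succ]
    refine mul_nonneg ih ?_
    have : α / (n + 1) ≤ 1 := by
      rw [div_le_one (by positivity)]
      have : (0 : ℝ) ≤ n := by positivity
      linarith
    linarith

/-- Bernoulli's inequality for the concave power `α` shows that the partial sum times `(n+1)^α` does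
not increase. -/
theorem glPartialSum_le {α : ℝ} (h0 : 0 < α) (hα : α ≤ 1) (n : ℕ) :
    glPartialSum α n ≤ ((n : ℝ) + 1) ^ (-α) := by
  induction n with
  | zero => simp
  | succ n ih =>
    rw [glPartialSum_succ]
    push_cast
    have hn : (0 : ℝ) < (n : ℝ) + 1 := by positivity
    have h1 : 0 ≤ 1 - α / ((n : ℝ) + 1) := by
      have : α / ((n : ℝ) + 1) ≤ 1 := by
        rw [div_le_one hn]
        have : (0 : ℝ) ≤ n := by positivity
        linarith
      linarith
    have h2 : (1 + 1 / ((n : ℝ) + 1)) ^ α ≤ 1 + α * (1 / ((n : ℝ) + 1)) :=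
      rpow_one_add_le_one_add_mul_self (by have : 0 ≤ 1 / ((n : ℝ) + 1) := by positivity
                                           linarith) h0.le hα
    have h3 : (1 - α / ((n : ℝ) + 1)) * (1 + 1 / ((n : ℝ) + 1)) ^ α ≤ 1 := by
      refine (mul_le_mul_of_nonneg_left h2 h1).trans ?_
      have : (1 - α / ((n : ℝ) + 1)) * (1 + α * (1 / ((n : ℝ) + 1)))
        = 1 - (α / ((n : ℝ) + 1)) ^ 2 := by ring
      rw [this]
      have := sq_nonneg (α / ((n : ℝ) + 1))
      linarith
    have h4 : (n : ℝ) + 1 + 1 = ((n : ℝ) + 1) * (1 + 1 / ((n : ℝ) + 1)) := by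
      field_simp
    have h5 : (0 : ℝ) < 1 + 1 / ((n : ℝ) + 1) := by positivity
    rw [h4, Real.mul_rpow hn.le h5.le]
    refine mul_le_mul ih ?_ h1 (by positivity)
    rw [Real.rpow_neg h5.le, ← one_div, le_div_iff₀ (by positivity)]
    exact h3

/-- Bernoulli again, in the opposite direction, starting from the value `1 - α` at index one. The
bound degenerates at `α = 1`, where all later partial sums vanish. -/
theorem le_glPartialSum {α : ℝ} (h0 : 0 < α) (hα : α ≤ 1) (n : ℕ) :
    (1 - α) * ((n : ℝ) + 1) ^ (-α) ≤ glPartialSum α (n + 1) := by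
  induction n with
  | zero => simp [glPartialSum_succ]
  | succ n ih =>
    rw [glPartialSum_succ]
    push_cast
    have hn : (0 : ℝ) < (n : ℝ) + 1 := by positivity
    have hn2 : (0 : ℝ) < (n : ℝ) + 1 + 1 := by positivity
    have h2 : (1 + -(1 / ((n : ℝ) + 1 + 1))) ^ α ≤ 1 + α * (-(1 / ((n : ℝ) + 1 + 1))) := by
      refine rpow_one_add_le_one_add_mul_self ?_ h0.le hα
      have : 1 / ((n : ℝ) + 1 + 1) ≤ 1 := by
        rw [div_le_one hn2]; linarith
      linarith
    have h3 : 1 + -(1 / ((n : ℝ) + 1 + 1)) = ((n : ℝ) + 1) / ((n : ℝ) + 1 + 1) := by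
      field_simp; ring
    have h4 : ((n : ℝ) + 1 + 1) ^ (-α)
        = ((n : ℝ) + 1) ^ (-α) * (((n : ℝ) + 1) / ((n : ℝ) + 1 + 1)) ^ α := by
      rw [Real.div_rpow hn.le hn2.le, Real.rpow_neg hn.le, Real.rpow_neg hn2.le]
      field_simp
    have h5 : 1 - α / ((n : ℝ) + 1 + 1) = 1 + α * (-(1 / ((n : ℝ) + 1 + 1))) := by ring
    rw [h4, h5, ← mul_assoc]
    rw [h3] at h2
    have hα1 : 0 ≤ 1 - α := by linarith
    exact mul_le_mul ih h2 (by positivity) ((by positivity : (0 : ℝ) ≤ _).trans ih)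

/-- Index one has to be excluded: `A_1 = 1 - α - α²/2` is negative for `α` near one. -/
theorem wsglPartialSum_ge {α : ℝ} (h0 : 0 < α) (hα : α ≤ 1) {n : ℕ} (hn : 2 ≤ n) :
    (1 - α) / 4 * (n : ℝ) ^ (-α) ≤ wsglPartialSum α n := by
  obtain ⟨k, rfl⟩ := Nat.exists_eq_add_of_le hn
  rw [show 2 + k = (k + 1) + 1 by ring, wsglPartialSum_eq, glWeight_succ_eq]
  have h1 := le_glPartialSum h0 hα (k + 1)
  have h2 := glPartialSum_succ α (k + 1)
  have h3 := glPartialSum_nonneg hα (k + 1)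
  push_cast at h1 h2 ⊢
  have hk : (0 : ℝ) ≤ k := by positivity
  set W := glPartialSum α (k + 1)
  -- The second-order correction costs at most three quarters of the partial sum, because `3/4 (n -
  -- α) ≥ α²/2` for `n ≥ 2`.
  have h4 : W * (1 - α / ((k : ℝ) + 1 + 1)) + α / 2 * -(α * W / ((k : ℝ) + 1 + 1)) ≥
      1 / 4 * (W * (1 - α / ((k : ℝ) + 1 + 1))) := by
    have h5 : W * (1 - α / ((k : ℝ) + 1 + 1)) + α / 2 * -(α * W / ((k : ℝ) + 1 + 1))
        - 1 / 4 * (W * (1 - α / ((k : ℝ) + 1 + 1)))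
        = W * ((3 / 4 * ((k : ℝ) + 1 + 1 - α) - α ^ 2 / 2) / ((k : ℝ) + 1 + 1)) := by
      field_simp
      ring
    have : 0 ≤ W * ((3 / 4 * ((k : ℝ) + 1 + 1 - α) - α ^ 2 / 2) / ((k : ℝ) + 1 + 1)) := by
      refine mul_nonneg h3 (div_nonneg ?_ (by positivity))
      nlinarith
    linarith
  rw [h2]
  rw [h2] at h1
  linarith

theorem wsglPartialSum_nonneg {α : ℝ} (h0 : 0 < α) (hα : α ≤ 1) {n : ℕ} (hn : 2 ≤ n) :
    0 ≤ wsglPartialSum α n := by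
  refine le_trans ?_ (wsglPartialSum_ge h0 hα hn)
  have : 0 ≤ 1 - α := by linarith
  positivity

/-- The sign is decided by `k - 1 - α(3+α)/2`, which is nonnegative from `k = 3` on. The weight
`g_2` has no fixed sign for `α` in `(0, 1]`. -/
theorem wsglWeight_nonpos {α : ℝ} (h0 : 0 < α) (hα : α ≤ 1) {k : ℕ} (hk : 3 ≤ k) :
    wsglWeight α k ≤ 0 := by
  obtain ⟨n, rfl⟩ := Nat.exists_eq_add_of_le hk
  rw [show 3 + n = (n + 1 + 1) + 1 by ring, wsglWeight, glWeight_succ, glWeight_succ_eq α (n + 1)]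
  have h3 := glPartialSum_nonneg hα (n + 1)
  have hn : (0 : ℝ) ≤ n := by positivity
  push_cast
  set W := glPartialSum α (n + 1)
  have h5 : (2 + α) / 2 * (-(α * W / ((n : ℝ) + 1 + 1)) * (((n : ℝ) + 2 - α) / ((n : ℝ) + 2 + 1)))
      - α / 2 * -(α * W / ((n : ℝ) + 1 + 1))
      = -(α * W / ((n : ℝ) + 1 + 1) * (((2 + α) / 2 * ((n : ℝ) + 2 - α) - α / 2 * (n + 3)) / ((n : ℝ) + 3))) := by
    field_simp
    ring
  rw [h5, neg_nonpos]
  refine mul_nonneg (by positivity) (div_nonneg ?_ (by positivity))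
  nlinarith

theorem abs_glWeight_succ_le {α : ℝ} (h0 : 0 < α) (hα : α ≤ 1) (k : ℕ) :
    |glWeight α (k + 1)| ≤ ((k : ℝ) + 1) ^ (-α - 1) := by
  have h1 := glPartialSum_nonneg hα k
  have h2 := glPartialSum_le h0 hα k
  have hk : (0 : ℝ) < (k : ℝ) + 1 := by positivity
  rw [glWeight_succ_eq, abs_neg, abs_of_nonneg (by positivity), Real.rpow_sub_one hk.ne']
  gcongr
  nlinarith

/-- The exponent `-1/2` is deliberately crude: it is the weight in which `stability` measures
residuals, whatever the order. -/
theorem abs_wsglWeight_le {α : ℝ} (h0 : 0 < α) (hα : α ≤ 1) {k : ℕ} (hk : 1 ≤ k) :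
    |wsglWeight α k| ≤ 4 * (k : ℝ) ^ (-(1 / 2) : ℝ) := by
  have h (n : ℕ) : |glWeight α (n + 1)| ≤ ((n : ℝ) + 1) ^ (-(1 / 2) : ℝ) :=
    (abs_glWeight_succ_le h0 hα n).trans
      (Real.rpow_le_rpow_of_exponent_le (by have : (0 : ℝ) ≤ n := by positivity
                                            linarith) (by linarith))
  have h' (n : ℕ) : |glWeight α n| ≤ 2 * ((n : ℝ) + 1) ^ (-(1 / 2) : ℝ) := by
    rcases n with _ | n
    · simp
    · refine (h n).trans ?_
      push_cast
      have hn : (0 : ℝ) < (n : ℝ) + 1 := by positivity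
      have h4 : ((n : ℝ) + 1) ^ (-(1 / 2) : ℝ)
          = (2 : ℝ) ^ (1 / 2 : ℝ) * (2 * ((n : ℝ) + 1)) ^ (-(1 / 2) : ℝ) := by
        rw [Real.mul_rpow (by norm_num) hn.le, ← mul_assoc, ← Real.rpow_add (by norm_num)]
        norm_num
      rw [h4]
      refine mul_le_mul ?_ ?_ (by positivity) (by norm_num)
      · calc (2 : ℝ) ^ (1 / 2 : ℝ) ≤ 2 ^ (1 : ℝ) :=
              Real.rpow_le_rpow_of_exponent_le (by norm_num) (by norm_num)
          _ = 2 := by norm_num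
      · refine Real.rpow_le_rpow_of_nonpos (by positivity) (by linarith) (by norm_num)
  obtain ⟨n, rfl⟩ := Nat.exists_eq_add_of_le' hk
  rw [wsglWeight]
  have h1 := h n
  have h2 := h' n
  push_cast
  have hp : 0 ≤ ((n : ℝ) + 1) ^ (-(1 / 2) : ℝ) := by positivity
  set p := ((n : ℝ) + 1) ^ (-(1 / 2) : ℝ)
  calc |(2 + α) / 2 * glWeight α (n + 1) - α / 2 * glWeight α n|
      ≤ |(2 + α) / 2 * glWeight α (n + 1)| + |α / 2 * glWeight α n| := abs_sub _ _
    _ = (2 + α) / 2 * |glWeight α (n + 1)| + α / 2 * |glWeight α n| := by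
        rw [abs_mul, abs_mul, abs_of_pos (show 0 < (2 + α) / 2 by positivity),
          abs_of_pos (show 0 < α / 2 by positivity)]
    _ ≤ (2 + α) / 2 * p + α / 2 * (2 * p) := by gcongr
    _ ≤ 4 * p := by nlinarith

/-! ### Coercivity of the WSGL quadratic form -/

/-- The autocorrelations of a finite sequence. -/
def autocorr (u : ℕ → ℝ) (N k : ℕ) : ℝ := ∑ n ∈ Finset.Ico k N, u n * u (n - k)

theorem sum_mul_convolution_eq (g u : ℕ → ℝ) (N : ℕ) :
    ∑ n ∈ Finset.range N, u n * ∑ k ∈ Finset.range (n + 1), g (n - k) * u k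
      = ∑ k ∈ Finset.range N, g k * autocorr u N k := by
  have h (n : ℕ) : ∑ k ∈ Finset.range (n + 1), g (n - k) * u k
      = ∑ k ∈ Finset.range (n + 1), g k * u (n - k) := by
    rw [← Finset.sum_range_reflect]
    refine Finset.sum_congr rfl fun k hk => ?_
    have hk' := Finset.mem_range.1 hk
    rw [show n + 1 - 1 - k = n - k by omega, show n - (n - k) = k by omega]
  simp only [h, autocorr, Finset.mul_sum]
  rw [Finset.sum_comm' (t' := Finset.range N) (s' := fun k => Finset.Ico k N)]
  · refine Finset.sum_congr rfl fun k _ => Finset.sum_congr rfl fun n _ => by ring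
  · intro n k
    simp only [Finset.mem_range, Finset.mem_Ico]
    omega

theorem autocorr_zero (u : ℕ → ℝ) (N : ℕ) :
    autocorr u N 0 = ∑ n ∈ Finset.range N, u n ^ 2 := by
  rw [autocorr, ← Finset.range_eq_Ico]
  simp [sq]

theorem two_mul_autocorr_le (u : ℕ → ℝ) (N k : ℕ) :
    2 * autocorr u N k
      ≤ ∑ n ∈ Finset.Ico k N, u n ^ 2 + ∑ n ∈ Finset.range (N - k), u n ^ 2 := by
  have h : ∑ n ∈ Finset.range (N - k), u n ^ 2 = ∑ n ∈ Finset.Ico k N, u (n - k) ^ 2 := by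
    rw [Finset.sum_Ico_eq_sum_range]
    refine Finset.sum_congr rfl fun n _ => by simp
  rw [h, autocorr, Finset.mul_sum, ← Finset.sum_add_distrib]
  refine Finset.sum_le_sum fun n _ => ?_
  nlinarith [sq_nonneg (u n - u (n - k))]

theorem autocorr_le (u : ℕ → ℝ) (N k : ℕ) : autocorr u N k ≤ autocorr u N 0 := by
  have h := two_mul_autocorr_le u N k
  have h1 : ∑ n ∈ Finset.Ico k N, u n ^ 2 ≤ ∑ n ∈ Finset.range N, u n ^ 2 := by
    refine Finset.sum_le_sum_of_subset_of_nonneg ?_ fun _ _ _ => sq_nonneg _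
    intro n; simp
  have h2 : ∑ n ∈ Finset.range (N - k), u n ^ 2 ≤ ∑ n ∈ Finset.range N, u n ^ 2 := by
    refine Finset.sum_le_sum_of_subset_of_nonneg ?_ fun _ _ _ => sq_nonneg _
    intro n; simp; omega
  rw [autocorr_zero]
  linarith

/-- The right-hand side is twice the BDF2 form of `u`. It is a telescoping energy, whose last value
is on the left, plus squares of second differences. -/
theorem autocorr_second_difference (u : ℕ → ℝ) (hu : u 0 = 0) (N : ℕ) (hN : 2 ≤ N) :
    (u (N - 2) - 2 * u (N - 1)) ^ 2 / 2 + u (N - 1) ^ 2 / 2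
      ≤ 3 * autocorr u N 0 - 4 * autocorr u N 1 + autocorr u N 2 := by
  induction N, hN using Nat.le_induction with
  | base =>
    simp [autocorr, Finset.sum_range_succ, hu]
    nlinarith [sq_nonneg (u 1)]
  | succ N hN ih =>
    obtain ⟨k, rfl⟩ := Nat.exists_eq_add_of_le' hN
    have h (i : ℕ) (hi : i ≤ k + 2) :
        autocorr u (k + 2 + 1) i = autocorr u (k + 2) i + u (k + 2) * u (k + 2 - i) := by
      rw [autocorr, Finset.sum_Ico_succ_top hi, autocorr]
    rw [h 0 (by omega), h 1 (by omega), h 2 (by omega)]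
    simp only [Nat.add_sub_cancel, show k + 2 + 1 - 2 = k + 1 by omega,
      show k + 2 - 1 = k + 1 by omega, Nat.sub_zero] at ih ⊢
    nlinarith [sq_nonneg (u (k + 2) - 2 * u (k + 1) + u k)]

theorem wsglWeight_one (α : ℝ) : wsglWeight α 1 = -(α * (3 + α) / 2) := by
  rw [wsglWeight, glWeight_succ_eq]; simp; ring

theorem wsglWeight_two (α : ℝ) : wsglWeight α 2 = α / 4 * (α ^ 2 + 3 * α - 2) := by
  rw [wsglWeight, glWeight_succ, glWeight_succ_eq]; simp; ring

theorem wsglPartialSum_two (α : ℝ) :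
    wsglPartialSum α 2 = wsglWeight α 0 + wsglWeight α 1 + wsglWeight α 2 := by
  simp [wsglPartialSum, Finset.sum_range_succ]

theorem wsglPartialSum_eq_add_sum_Ico (α : ℝ) {n : ℕ} (hn : 2 ≤ n) :
    wsglPartialSum α n = wsglPartialSum α 2 + ∑ k ∈ Finset.Ico 3 (n + 1), wsglWeight α k := by
  rw [wsglPartialSum, wsglPartialSum, Finset.range_eq_Ico, Finset.range_eq_Ico,
    Finset.sum_Ico_consecutive _ (by omega) (by omega)]

/-- The WSGL quadratic form dominates the weights `A_n = ∑_{k ≤ n} g_k`. -/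
theorem wsgl_form_coercive {α : ℝ} (h0 : 0 < α) (hα : α ≤ 1) (u : ℕ → ℝ) (hu : u 0 = 0)
    {N : ℕ} (hN : 3 ≤ N) :
    1 / 2 * ∑ n ∈ Finset.range N, wsglPartialSum α (max n 2) * u n ^ 2
      ≤ ∑ n ∈ Finset.range N, u n * ∑ k ∈ Finset.range (n + 1), wsglWeight α (n - k) * u k := by
  rw [sum_mul_convolution_eq, Finset.range_eq_Ico (a := N),
    ← Finset.sum_Ico_consecutive (fun k => wsglWeight α k * autocorr u N k) (Nat.zero_le 3) hN]
  -- Amounts to `-g_1 (c0 - c1) - g_2 (c0 - c2) ≥ 0`, which is immediate if `g_2 ≤ 0`.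
  have hlow : wsglPartialSum α 2 * autocorr u N 0
      ≤ ∑ k ∈ Finset.Ico 0 3, wsglWeight α k * autocorr u N k := by
    rw [← Finset.range_eq_Ico]
    simp only [Finset.sum_range_succ, Finset.range_zero, Finset.sum_empty, zero_add]
    rw [wsglPartialSum_two, wsglWeight_one, wsglWeight_two]
    have h1 := autocorr_le u N 1
    have h2 := autocorr_le u N 2
    have h3 : 0 ≤ 3 * autocorr u N 0 - 4 * autocorr u N 1 + autocorr u N 2 :=
      le_trans (by positivity) (autocorr_second_difference u hu N (by omega))
    set c0 := autocorr u N 0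
    set c1 := autocorr u N 1
    set c2 := autocorr u N 2
    have h4 : 0 ≤ α * (3 + α) / 2 * (c0 - c1) - α / 4 * (α ^ 2 + 3 * α - 2) * (c0 - c2) := by
      rcases le_total (α ^ 2 + 3 * α - 2) 0 with h | h
      · have e1 : 0 ≤ α * (3 + α) / 2 * (c0 - c1) := mul_nonneg (by positivity) (by linarith)
        have e2 : 0 ≤ α / 4 * (-(α ^ 2 + 3 * α - 2)) * (c0 - c2) :=
          mul_nonneg (mul_nonneg (by positivity) (by linarith)) (by linarith)
        linarith
      -- For `g_2 ≥ 0` the BDF2 inequality gives `c0 - c2 ≤ 4 (c0 - c1)`, and the remaining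
      -- coefficient `-g_1 - 4 g_2` factors as `(α/2)(1-α)(7+2α)`.
      · have e2 : α / 4 * (α ^ 2 + 3 * α - 2) * (c0 - c2)
            ≤ α / 4 * (α ^ 2 + 3 * α - 2) * (4 * (c0 - c1)) :=
          mul_le_mul_of_nonneg_left (by linarith) (mul_nonneg (by positivity) h)
        have e3 : 0 ≤ α / 2 * ((1 - α) * (7 + 2 * α)) * (c0 - c1) :=
          mul_nonneg (mul_nonneg (by positivity)
            (mul_nonneg (by linarith) (by linarith))) (by linarith)
        nlinarith
    linarith
  -- Only one of the two sums of squares is enlarged to the full range. The other is kept, so that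
  -- exchanging the summations puts the partial sum `A_n` in front of `u_n²`.
  have hhigh : ∑ k ∈ Finset.Ico 3 N, wsglWeight α k *
      ((∑ n ∈ Finset.Ico k N, u n ^ 2 + ∑ n ∈ Finset.range N, u n ^ 2) / 2)
      ≤ ∑ k ∈ Finset.Ico 3 N, wsglWeight α k * autocorr u N k := by
    refine Finset.sum_le_sum fun k hk => ?_
    refine mul_le_mul_of_nonpos_left ?_ (wsglWeight_nonpos h0 hα (Finset.mem_Ico.1 hk).1)
    have h2 : ∑ n ∈ Finset.range (N - k), u n ^ 2 ≤ ∑ n ∈ Finset.range N, u n ^ 2 := by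
      refine Finset.sum_le_sum_of_subset_of_nonneg ?_ fun _ _ _ => sq_nonneg _
      intro n; simp; omega
    linarith [two_mul_autocorr_le u N k]
  refine le_trans ?_ (add_le_add hlow hhigh)
  have hsplit : ∑ k ∈ Finset.Ico 3 N, wsglWeight α k *
      ((∑ n ∈ Finset.Ico k N, u n ^ 2 + ∑ n ∈ Finset.range N, u n ^ 2) / 2)
      = 1 / 2 * ∑ k ∈ Finset.Ico 3 N, ∑ n ∈ Finset.Ico k N, wsglWeight α k * u n ^ 2
        + 1 / 2 * ((∑ k ∈ Finset.Ico 3 N, wsglWeight α k) * ∑ n ∈ Finset.range N, u n ^ 2) := by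
    rw [Finset.sum_mul, ← mul_add, ← Finset.sum_add_distrib, Finset.mul_sum]
    refine Finset.sum_congr rfl fun k _ => ?_
    rw [← Finset.mul_sum]
    ring
  have hswap : ∑ k ∈ Finset.Ico 3 N, ∑ n ∈ Finset.Ico k N, wsglWeight α k * u n ^ 2
      = ∑ n ∈ Finset.range N, (∑ k ∈ Finset.Ico 3 (n + 1), wsglWeight α k) * u n ^ 2 := by
    simp only [Finset.sum_mul]
    refine Finset.sum_comm' fun k n => ?_
    simp only [Finset.mem_range, Finset.mem_Ico]
    omega
  -- For `n < 2` no weight with `k ≥ 3` contributes, whence `max n 2`.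
  have hA (n : ℕ) : wsglPartialSum α (max n 2)
      = wsglPartialSum α 2 + ∑ k ∈ Finset.Ico 3 (n + 1), wsglWeight α k := by
    rcases le_total 2 n with h | h
    · rw [max_eq_left h, wsglPartialSum_eq_add_sum_Ico α h]
    · rw [max_eq_right h, Finset.Ico_eq_empty (by omega)]; simp
  -- The leftover after the split is `1/2 A_{N-1} ∑ u_n²`, which may be dropped.
  have hN' : 0 ≤ wsglPartialSum α 2 + ∑ k ∈ Finset.Ico 3 N, wsglWeight α k := by
    have := wsglPartialSum_eq_add_sum_Ico α (n := N - 1) (by omega)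
    rw [show N - 1 + 1 = N by omega] at this
    rw [← this]
    exact wsglPartialSum_nonneg h0 hα (by omega)
  rw [hsplit, hswap, autocorr_zero, ← Finset.range_eq_Ico]
  simp only [hA, add_mul, Finset.sum_add_distrib, ← Finset.mul_sum]
  have hS : 0 ≤ ∑ n ∈ Finset.range N, u n ^ 2 := Finset.sum_nonneg fun _ _ => sq_nonneg _
  nlinarith [mul_nonneg hN' hS]

/-! ### Stability of the multi-term scheme -/

/-- The WSGL convolution without correction terms and without the power of the step size. -/
def wsglConv (α : ℝ) (u : ℕ → ℝ) (n : ℕ) : ℝ :=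
  ∑ k ∈ Finset.range (n + 1), wsglWeight α (n - k) * u k

theorem wsglConv_congr {α : ℝ} {u v : ℕ → ℝ} {n : ℕ} (h : ∀ k ≤ n, u k = v k) :
    wsglConv α u n = wsglConv α v n :=
  Finset.sum_congr rfl fun k hk => by rw [h k (by have := Finset.mem_range.1 hk; omega)]

/-- Cutting `u` off after `K` and applying the form with `N = K + 3` removes the restriction `3 ≤
N`. -/
theorem wsglConv_form_coercive {α : ℝ} (h0 : 0 < α) (hα : α ≤ 1) (u : ℕ → ℝ) (hu : u 0 = 0)
    (K : ℕ) :
    1 / 2 * ∑ n ∈ Finset.range (K + 1), wsglPartialSum α (max n 2) * u n ^ 2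
      ≤ ∑ n ∈ Finset.range (K + 1), u n * wsglConv α u n := by
  let v : ℕ → ℝ := fun n => if n ≤ K then u n else 0
  have hv (n : ℕ) (hn : n ≤ K) : v n = u n := if_pos hn
  have hv' (n : ℕ) (hn : ¬ n ≤ K) : v n = 0 := if_neg hn
  have key := wsgl_form_coercive h0 hα v ((hv 0 (Nat.zero_le K)).trans hu)
    (show 3 ≤ (K + 1) + 2 by omega)
  have hsub : Finset.range (K + 1) ⊆ Finset.range (K + 1 + 2) := by
    intro n; simp; omega
  rw [← Finset.sum_subset hsub, ← Finset.sum_subset hsub] at key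
  · refine le_trans (le_of_eq ?_) (key.trans (le_of_eq ?_))
    · congr 1
      refine Finset.sum_congr rfl fun n hn => ?_
      rw [hv n (by have := Finset.mem_range.1 hn; omega)]
    · refine Finset.sum_congr rfl fun n hn => ?_
      have hn' := Finset.mem_range.1 hn
      rw [hv n (by omega)]
      congr 1
      exact wsglConv_congr fun k hk => hv k (by omega)
  · intro n _ hn
    rw [hv' n (by simpa using hn)]; simp
  · intro n _ hn
    rw [hv' n (by simpa using hn)]; simp

theorem wsglConv_form_nonneg {α : ℝ} (h0 : 0 < α) (hα : α ≤ 1) (u : ℕ → ℝ) (hu : u 0 = 0)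
    (K : ℕ) : 0 ≤ ∑ n ∈ Finset.range (K + 1), u n * wsglConv α u n :=
  le_trans (mul_nonneg (by norm_num) (Finset.sum_nonneg fun _ _ =>
    mul_nonneg (wsglPartialSum_nonneg h0 hα (le_max_right _ _)) (sq_nonneg _)))
    (wsglConv_form_coercive h0 hα u hu K)

theorem sum_rpow_sub_one_le {α : ℝ} (h0 : 0 < α) (hα : α ≤ 1) (K : ℕ) :
    ∑ n ∈ Finset.range K, ((n : ℝ) + 1) ^ (α - 1) ≤ (K : ℝ) ^ α / α := by
  induction K with
  | zero => simp [Real.zero_rpow h0.ne']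
  | succ n ih =>
    rw [Finset.sum_range_succ]
    push_cast
    have hn : (0 : ℝ) < (n : ℝ) + 1 := by positivity
    have h2 : (1 + -(1 / ((n : ℝ) + 1))) ^ α ≤ 1 + α * (-(1 / ((n : ℝ) + 1))) := by
      refine rpow_one_add_le_one_add_mul_self ?_ h0.le hα
      have : 1 / ((n : ℝ) + 1) ≤ 1 := by
        rw [div_le_one hn]; have : (0 : ℝ) ≤ n := by positivity
        linarith
      linarith
    have h3 : 1 + -(1 / ((n : ℝ) + 1)) = (n : ℝ) / ((n : ℝ) + 1) := by
      field_simp; ring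
    rw [h3, Real.div_rpow (by positivity) hn.le, div_le_iff₀ (by positivity)] at h2
    have h4 : ((n : ℝ) + 1) ^ (α - 1) = ((n : ℝ) + 1) ^ α / ((n : ℝ) + 1) :=
      Real.rpow_sub_one hn.ne' α
    have h5 : (n : ℝ) ^ α / α ≤ ((n : ℝ) + 1) ^ α / α - ((n : ℝ) + 1) ^ (α - 1) := by
      rw [h4, div_le_iff₀ h0]
      refine h2.trans (le_of_eq ?_)
      field_simp
      ring
    linarith

/-- Pair the equation with `e`. All orders contribute nonnegatively, so one active order below one
supplies the whole coercivity. -/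
theorem stability_of_order_lt_one {Q : ℕ} {ν α : Fin Q → ℝ} (hν : ∀ j, 0 ≤ ν j)
    (hα0 : ∀ j, 0 < α j) (hα1 : ∀ j, α j ≤ 1) {i : Fin Q} (hνi : 0 < ν i) (hαi : α i < 1)
    {T : ℝ} (hT : 0 < T) :
    ∃ C : ℝ, 0 < C ∧ ∀ (τ : ℝ) (K : ℕ) (e r : ℕ → ℝ) (B : ℝ), 0 < τ → K * τ ≤ T → e 0 = 0 →
      (∀ n, 1 ≤ n → n ≤ K → ∑ j, ν j * (1 / τ ^ α j * wsglConv (α j) e n) + e n = r n) →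
      (∀ n, 1 ≤ n → n ≤ K → |r n| ≤ B * (n : ℝ) ^ (-(1 / 2) : ℝ)) →
      ∑ n ∈ Finset.range (K + 1), e n ^ 2 ≤ C * B ^ 2 := by
  have hαi' : 0 < 1 - α i := by linarith
  have hi0 := hα0 i
  refine ⟨4 * T ^ α i / (α i * ν i * (1 - α i)), by positivity, ?_⟩
  intro τ K e r B hτ hKT he heq hr
  -- The factor `1/16` is `1/2` from the form, `1/4` from the lower bound on the partial sums, and
  -- `1/2` from `max n 2 ≤ 2n`.
  set P : ℝ := ν i * (1 / τ ^ α i) * ((1 - α i) / 16) with hP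
  have hPpos : 0 < P := by positivity
  have hid : ∑ j, ν j * (1 / τ ^ α j) * ∑ n ∈ Finset.range (K + 1), e n * wsglConv (α j) e n
      + ∑ n ∈ Finset.range (K + 1), e n ^ 2 = ∑ n ∈ Finset.range (K + 1), e n * r n := by
    simp only [Finset.mul_sum]
    rw [Finset.sum_comm, ← Finset.sum_add_distrib]
    refine Finset.sum_congr rfl fun n hn => ?_
    rcases Nat.eq_zero_or_pos n with rfl | hpos
    · simp [he]
    · rw [← heq n hpos (by have := Finset.mem_range.1 hn; omega), mul_add, Finset.mul_sum]
      congr 1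
      · exact Finset.sum_congr rfl fun j _ => by ring
      · ring
  have hlow : P * ∑ n ∈ Finset.range (K + 1), (n : ℝ) ^ (-α i) * e n ^ 2 ≤
      ∑ j, ν j * (1 / τ ^ α j) * ∑ n ∈ Finset.range (K + 1), e n * wsglConv (α j) e n := by
    refine le_trans ?_ (Finset.single_le_sum (f := fun j => ν j * (1 / τ ^ α j) *
      ∑ n ∈ Finset.range (K + 1), e n * wsglConv (α j) e n) (fun j _ => ?_) (Finset.mem_univ i))
    · rw [hP, mul_assoc]
      refine mul_le_mul_of_nonneg_left ?_ (by positivity)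
      refine le_trans ?_ (wsglConv_form_coercive hi0 hαi.le e he K)
      rw [Finset.mul_sum, Finset.mul_sum]
      refine Finset.sum_le_sum fun n _ => ?_
      rcases Nat.eq_zero_or_pos n with rfl | hpos
      · simp [he]
      rw [← mul_assoc, ← mul_assoc]
      refine mul_le_mul_of_nonneg_right ?_ (sq_nonneg _)
      have h1 := wsglPartialSum_ge hi0 hαi.le (le_max_right n 2)
      have h2 : 1 / 2 * (n : ℝ) ^ (-α i) ≤ ((max n 2 : ℕ) : ℝ) ^ (-α i) := by
        have hn1 : (1 : ℝ) ≤ n := by exact_mod_cast hpos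
        have h3 : ((max n 2 : ℕ) : ℝ) ≤ 2 * n := by
          push_cast
          exact max_le (by linarith) (by linarith)
        have h4 : (2 * (n : ℝ)) ^ (-α i) ≤ ((max n 2 : ℕ) : ℝ) ^ (-α i) :=
          Real.rpow_le_rpow_of_nonpos (by positivity) h3 (by linarith)
        refine le_trans ?_ h4
        rw [Real.mul_rpow (by norm_num) (by positivity)]
        refine mul_le_mul_of_nonneg_right ?_ (by positivity)
        calc (1 / 2 : ℝ) = 2 ^ (-1 : ℝ) := by rw [Real.rpow_neg_one]; norm_num
          _ ≤ 2 ^ (-α i) := Real.rpow_le_rpow_of_exponent_le (by norm_num) (by linarith)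
      nlinarith
    · exact mul_nonneg (mul_nonneg (hν j) (by positivity))
        (wsglConv_form_nonneg (hα0 j) (hα1 j) e he K)
  -- Young's inequality with weight `P n^(-α)`, so that the quadratic term is absorbed completely by
  -- `hlow`.
  have hyoung : ∑ n ∈ Finset.range (K + 1), e n * r n
      ≤ P * ∑ n ∈ Finset.range (K + 1), (n : ℝ) ^ (-α i) * e n ^ 2
        + B ^ 2 / (4 * P) * ∑ n ∈ Finset.range K, ((n : ℝ) + 1) ^ (α i - 1) := by
    rw [Finset.sum_range_succ', Finset.sum_range_succ' (fun n : ℕ => (n : ℝ) ^ (-α i) * e n ^ 2),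
      he, mul_add, Finset.mul_sum, Finset.mul_sum]
    simp only [zero_mul, add_zero, ne_eq, OfNat.ofNat_ne_zero, not_false_eq_true, zero_pow,
      mul_zero]
    rw [← Finset.sum_add_distrib]
    refine Finset.sum_le_sum fun n hn => ?_
    have hrn := hr (n + 1) (by omega) (by have := Finset.mem_range.1 hn; omega)
    push_cast at hrn ⊢
    have hn0 : (0 : ℝ) < (n : ℝ) + 1 := by positivity
    set s := ((n : ℝ) + 1) ^ (-α i) with hs
    have hspos : 0 < s := by positivity
    have hr2 : r (n + 1) ^ 2 ≤ B ^ 2 * ((n : ℝ) + 1) ^ (-1 : ℝ) := by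
      have := pow_le_pow_left₀ (abs_nonneg _) hrn 2
      rw [sq_abs, mul_pow, ← Real.rpow_natCast (_ ^ _) 2, ← Real.rpow_mul hn0.le] at this
      norm_num at this ⊢
      exact this
    have h6 : ((n : ℝ) + 1) ^ (α i - 1) = ((n : ℝ) + 1) ^ (-1 : ℝ) / s := by
      rw [hs, ← Real.rpow_sub hn0]; congr 1; ring
    rw [h6]
    have h7 : e (n + 1) * r (n + 1)
        ≤ P * (s * e (n + 1) ^ 2) + r (n + 1) ^ 2 / (4 * P * s) := by
      have : 0 ≤ (2 * P * s * e (n + 1) - r (n + 1)) ^ 2 / (4 * P * s) := by positivity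
      have h8 : (2 * P * s * e (n + 1) - r (n + 1)) ^ 2 / (4 * P * s)
          = P * (s * e (n + 1) ^ 2) + r (n + 1) ^ 2 / (4 * P * s) - e (n + 1) * r (n + 1) := by
        field_simp
        ring
      linarith
    have h9 : r (n + 1) ^ 2 / (4 * P * s)
        ≤ B ^ 2 / (4 * P) * (((n : ℝ) + 1) ^ (-1 : ℝ) / s) := by
      rw [div_mul_div_comm]
      gcongr
    linarith
  have hsum := sum_rpow_sub_one_le hi0 hαi.le K
  have h10 : B ^ 2 / (4 * P) * ∑ n ∈ Finset.range K, ((n : ℝ) + 1) ^ (α i - 1)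
      ≤ B ^ 2 / (4 * P) * ((K : ℝ) ^ α i / α i) := by gcongr
  -- `1/P` carries `τ^α`, which combines with `K^α` into `(Kτ)^α ≤ T^α`: this is why `n^(-1/2)` is
  -- the natural weight for residuals.
  have h11 : B ^ 2 / (4 * P) * ((K : ℝ) ^ α i / α i)
      = 4 * (K * τ) ^ α i / (α i * ν i * (1 - α i)) * B ^ 2 := by
    rw [hP, Real.mul_rpow (by positivity) hτ.le]
    field_simp
    ring
  have h12 : 4 * (K * τ) ^ α i / (α i * ν i * (1 - α i)) * B ^ 2
      ≤ 4 * T ^ α i / (α i * ν i * (1 - α i)) * B ^ 2 := by gcongr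
  linarith

/-! ### Order one: BDF2 and its energy -/

theorem glPartialSum_one_succ (n : ℕ) : glPartialSum 1 (n + 1) = 0 := by
  induction n with
  | zero => simp [glPartialSum_succ]
  | succ n ih => rw [glPartialSum_succ, ih, zero_mul]

theorem wsglWeight_one_eq_zero (n : ℕ) : wsglWeight 1 (n + 3) = 0 := by
  rw [show n + 3 = (n + 1 + 1) + 1 by ring, wsglWeight, glWeight_succ_eq, glWeight_succ_eq,
    glPartialSum_one_succ, glPartialSum_one_succ]
  simp

theorem wsglConv_one (u : ℕ → ℝ) (n : ℕ) :
    wsglConv 1 u (n + 2) = 3 / 2 * u (n + 2) - 2 * u (n + 1) + 1 / 2 * u n := by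
  rw [wsglConv, Finset.sum_range_succ, Finset.sum_range_succ, Finset.sum_range_succ,
    Finset.sum_eq_zero]
  · rw [show n + 2 - n = 2 by omega, show n + 2 - (n + 1) = 1 by omega,
      show n + 2 - (n + 2) = 0 by omega, wsglWeight_one, wsglWeight_two, wsglWeight]
    norm_num
    ring
  · intro k hk
    have := Finset.mem_range.1 hk
    rw [show n + 2 - k = (n - 1 - k) + 3 by omega, wsglWeight_one_eq_zero, zero_mul]

/-- The two sides differ by a quarter of the squared second difference. For `n = 0` truncated
subtraction makes `u (n - 1)` equal to `u 0 = 0`, the correct ghost value. -/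
theorem wsglConv_one_energy (u : ℕ → ℝ) (hu : u 0 = 0) (n : ℕ) :
    (u (n + 1) ^ 2 + (2 * u (n + 1) - u n) ^ 2) / 4 - (u n ^ 2 + (2 * u n - u (n - 1)) ^ 2) / 4
      ≤ u (n + 1) * wsglConv 1 u (n + 1) := by
  rcases n with _ | n
  · simp [wsglConv, Finset.sum_range_succ, hu, wsglWeight]
    nlinarith [sq_nonneg (u 1)]
  · rw [wsglConv_one, Nat.add_sub_cancel]
    nlinarith [sq_nonneg (u (n + 2) - 2 * u (n + 1) + u n)]

/-- At `α = 1` the partial sums `A_n` vanish for `n ≥ 2` and coercivity gives nothing. Instead the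
BDF2 energy is summed and bounded through the largest error `X`. -/
theorem stability_of_order_eq_one {s T : ℝ} (hs : 0 < s) (hT : 0 < T) :
    ∃ C : ℝ, 0 < C ∧ ∀ (τ : ℝ) (K : ℕ) (e r : ℕ → ℝ) (B : ℝ), 0 < τ → K * τ ≤ T → e 0 = 0 →
      (∀ n, 1 ≤ n → n ≤ K → s / τ * wsglConv 1 e n + e n = r n) →
      (∀ n, 1 ≤ n → n ≤ K → |r n| ≤ B * (n : ℝ) ^ (-(1 / 2) : ℝ)) →
      ∑ n ∈ Finset.range (K + 1), e n ^ 2 ≤ C * B ^ 2 := by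
  refine ⟨64 * T ^ 2 / s ^ 2, by positivity, ?_⟩
  intro τ K e r B hτ hKT he heq hr
  obtain ⟨p, hp, hmax⟩ := Finset.exists_max_image (Finset.range (K + 1)) (fun n => |e n|)
    ⟨0, by simp⟩
  have hp' := Finset.mem_range.1 hp
  set X := |e p| with hX
  have hX0 : 0 ≤ X := abs_nonneg _
  -- The sign of `B` is forced by the residual bound at `n = 1`, if there is such an index.
  have hB : 0 ≤ B ∨ K = 0 := by
    rcases Nat.eq_zero_or_pos K with h | h
    · exact Or.inr h
    · left
      have := (abs_nonneg _).trans (hr 1 le_rfl h)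
      simpa using this
  rcases hB with hB | rfl
  swap
  · simp [he]; positivity
  have hen : ∀ n, n ≤ K → (e n ^ 2 + (2 * e n - e (n - 1)) ^ 2) / 4
      ≤ τ / s * B * X * ∑ k ∈ Finset.range n, ((k : ℝ) + 1) ^ ((1 / 2 : ℝ) - 1) := by
    intro n
    induction n with
    | zero => simp [he]
    | succ n ih =>
      intro hn
      have h1 := ih (by omega)
      have h2 := wsglConv_one_energy e he n
      have h3 := heq (n + 1) (by omega) hn
      have h4 := hr (n + 1) (by omega) hn
      have h5 : |e (n + 1)| ≤ X := hmax (n + 1) (Finset.mem_range.2 (by omega))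
      have h6 : wsglConv 1 e (n + 1) = τ / s * (r (n + 1) - e (n + 1)) := by
        rw [← h3]; field_simp; ring
      have h7 : e (n + 1) * wsglConv 1 e (n + 1) ≤ τ / s * (e (n + 1) * r (n + 1)) := by
        rw [h6]
        have : 0 ≤ τ / s * e (n + 1) ^ 2 := by positivity
        nlinarith
      have h8 : e (n + 1) * r (n + 1) ≤ X * (B * ((n + 1 : ℕ) : ℝ) ^ (-(1 / 2) : ℝ)) := by
        refine (le_abs_self _).trans ?_
        rw [abs_mul]
        exact mul_le_mul h5 h4 (abs_nonneg _) hX0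
      have h9 : τ / s * (e (n + 1) * r (n + 1))
          ≤ τ / s * (X * (B * ((n + 1 : ℕ) : ℝ) ^ (-(1 / 2) : ℝ))) := by gcongr
      rw [Finset.sum_range_succ, mul_add, Nat.add_sub_cancel]
      have h10 : ((n + 1 : ℕ) : ℝ) ^ (-(1 / 2) : ℝ) = ((n : ℝ) + 1) ^ ((1 / 2 : ℝ) - 1) := by
        push_cast; norm_num
      rw [h10] at h9
      linarith
  have hsum := sum_rpow_sub_one_le (α := 1 / 2) (by norm_num) (by norm_num) K
  -- At the maximising index the energy is at least `X²/4`, and `∑ k^(-1/2) ≤ 2 K^(1/2)`; the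
  -- product is `8`. One factor `X` then cancels.
  have h1 : X ^ 2 ≤ 8 * (τ / s) * B * (K : ℝ) ^ (1 / 2 : ℝ) * X := by
    have h2 := hen p (by omega)
    have h3 : ∑ k ∈ Finset.range p, ((k : ℝ) + 1) ^ ((1 / 2 : ℝ) - 1)
        ≤ (K : ℝ) ^ (1 / 2 : ℝ) / (1 / 2) := by
      refine le_trans ?_ hsum
      refine Finset.sum_le_sum_of_subset_of_nonneg ?_ fun _ _ _ => by positivity
      intro n; simp; omega
    have h4 : τ / s * B * X * ∑ k ∈ Finset.range p, ((k : ℝ) + 1) ^ ((1 / 2 : ℝ) - 1)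
        ≤ τ / s * B * X * ((K : ℝ) ^ (1 / 2 : ℝ) / (1 / 2)) := by gcongr
    have h5 : X ^ 2 = e p ^ 2 := sq_abs _
    nlinarith [sq_nonneg (2 * e p - e (p - 1))]
  have h2 : X ≤ 8 * (τ / s) * B * (K : ℝ) ^ (1 / 2 : ℝ) := by
    rcases hX0.eq_or_lt with h | h
    · rw [← h]; positivity
    · rw [sq] at h1
      exact le_of_mul_le_mul_right h1 h
  have h3 : X ^ 2 ≤ 64 * τ ^ 2 / s ^ 2 * B ^ 2 * K := by
    refine (pow_le_pow_left₀ hX0 h2 2).trans (le_of_eq ?_)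
    have : ((K : ℝ) ^ (1 / 2 : ℝ)) ^ 2 = K := by
      rw [← Real.rpow_natCast, ← Real.rpow_mul (by positivity)]; norm_num
    rw [mul_pow, this]
    field_simp
    ring
  have h4 : ∑ n ∈ Finset.range (K + 1), e n ^ 2 ≤ K * X ^ 2 := by
    rw [Finset.sum_range_succ', he]
    simp only [ne_eq, OfNat.ofNat_ne_zero, not_false_eq_true, zero_pow, add_zero]
    refine (Finset.sum_le_card_nsmul _ _ (X ^ 2) fun n hn => ?_).trans (le_of_eq (by simp))
    rw [← sq_abs]
    exact pow_le_pow_left₀ (abs_nonneg _)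
      (hmax (n + 1) (by have := Finset.mem_range.1 hn; simpa using this)) 2
  calc ∑ n ∈ Finset.range (K + 1), e n ^ 2 ≤ K * X ^ 2 := h4
    _ ≤ K * (64 * τ ^ 2 / s ^ 2 * B ^ 2 * K) := by gcongr
    _ = 64 * (K * τ) ^ 2 / s ^ 2 * B ^ 2 := by ring
    _ ≤ 64 * T ^ 2 / s ^ 2 * B ^ 2 := by gcongr

/-- Residuals bounded by `B n ^ (-1/2)` produce errors bounded by a multiple of `B` in `ℓ²`. -/
theorem stability {Q : ℕ} {ν α : Fin Q → ℝ} (hν : ∀ j, 0 ≤ ν j) (hνpos : ∃ j, 0 < ν j)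
    (hα0 : ∀ j, 0 < α j) (hα1 : ∀ j, α j ≤ 1) {T : ℝ} (hT : 0 < T) :
    ∃ C : ℝ, 0 < C ∧ ∀ (τ : ℝ) (K : ℕ) (e r : ℕ → ℝ) (B : ℝ), 0 < τ → K * τ ≤ T → e 0 = 0 →
      (∀ n, 1 ≤ n → n ≤ K → ∑ j, ν j * (1 / τ ^ α j * wsglConv (α j) e n) + e n = r n) →
      (∀ n, 1 ≤ n → n ≤ K → |r n| ≤ B * (n : ℝ) ^ (-(1 / 2) : ℝ)) →
      ∑ n ∈ Finset.range (K + 1), e n ^ 2 ≤ C * B ^ 2 := by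
  by_cases h : ∃ i, 0 < ν i ∧ α i < 1
  · obtain ⟨i, hi, hi'⟩ := h
    exact stability_of_order_lt_one hν hα0 hα1 hi hi' hT
  -- All active orders are one, so the sum collapses to a single BDF2 operator with coefficient `∑
  -- ν_j`.
  · push Not at h
    have hs : 0 < ∑ j, ν j := by
      obtain ⟨j, hj⟩ := hνpos
      exact Finset.sum_pos' (fun i _ => hν i) ⟨j, Finset.mem_univ j, hj⟩
    obtain ⟨C, hC, hmain⟩ := stability_of_order_eq_one hs hT
    refine ⟨C, hC, fun τ K e r B hτ hK he heq hr => hmain τ K e r B hτ hK he ?_ hr⟩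
    intro n hn hnK
    rw [← heq n hn hnK, Finset.sum_div, Finset.sum_mul]
    congr 1
    refine Finset.sum_congr rfl fun j _ => ?_
    rcases (hν j).eq_or_lt with h' | h'
    · rw [← h']; simp
    · have : α j = 1 := le_antisymm (hα1 j) (h j h')
      rw [this, Real.rpow_one]; ring

/-! ### Second-order asymptotics of a ratio of Gamma functions -/

/-- The remainder has derivative `x²/(1+x)`, which lies between `0` and `x²`. -/
theorem abs_log_one_add_sub_le {x : ℝ} (hx : 0 ≤ x) :
    |Real.log (1 + x) - (x - x ^ 2 / 2)| ≤ x ^ 3 / 3 := by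
  have hd (y : ℝ) (hy : 0 ≤ y) :
      HasDerivAt (fun y : ℝ => Real.log (1 + y) - (y - y ^ 2 / 2)) (y ^ 2 / (1 + y)) y := by
    have h1 : (1 + y) ≠ 0 := by positivity
    have h2 := ((((hasDerivAt_id y).const_add 1).log h1).sub
      ((hasDerivAt_id y).sub (((hasDerivAt_id y).pow 2).div_const 2)))
    refine h2.congr_deriv ?_
    simp
    field_simp
    ring
  have hd2 (y : ℝ) : HasDerivAt (fun y : ℝ => y ^ 3 / 3) (y ^ 2) y := by
    have := ((hasDerivAt_id y).pow 3).div_const 3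
    refine this.congr_deriv ?_
    simp
  have hlow : (fun y : ℝ => Real.log (1 + y) - (y - y ^ 2 / 2)) 0
      ≤ (fun y : ℝ => Real.log (1 + y) - (y - y ^ 2 / 2)) x := by
    refine monotoneOn_of_deriv_nonneg (convex_Ici 0)
      (fun y hy => (hd y hy).continuousAt.continuousWithinAt)
      (fun y hy => (hd y (interior_subset hy)).differentiableAt.differentiableWithinAt) ?_
      (by simp) hx hx
    intro y hy
    have hy' : 0 ≤ y := interior_subset hy
    rw [(hd y hy').deriv]; positivity
  have hup : (fun y : ℝ => y ^ 3 / 3 - (Real.log (1 + y) - (y - y ^ 2 / 2))) 0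
      ≤ (fun y : ℝ => y ^ 3 / 3 - (Real.log (1 + y) - (y - y ^ 2 / 2))) x := by
    refine monotoneOn_of_deriv_nonneg (convex_Ici 0)
      (fun y hy => ((hd2 y).sub (hd y hy)).continuousAt.continuousWithinAt)
      (fun y hy =>
        ((hd2 y).sub (hd y (interior_subset hy))).differentiableAt.differentiableWithinAt) ?_
      (by simp) hx hx
    intro y hy
    have hy' : 0 ≤ y := interior_subset hy
    rw [((hd2 y).sub (hd y hy')).deriv, sub_nonneg]
    exact div_le_self (sq_nonneg y) (by linarith)
  simp at hlow hup
  rw [abs_le]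
  constructor
  · have : 0 ≤ x ^ 3 / 3 := by positivity
    linarith
  · linarith

/-- Since `C/n³` is at most the decrement of `2C/n²`, the sequences `y_n + 2C/n²` and `-y_n + 2C/n²`
decrease, and both tend to `0`. -/
theorem abs_le_of_telescope {y : ℕ → ℝ} (hy : Filter.Tendsto y Filter.atTop (nhds 0)) {C : ℝ}
    (hC : 0 ≤ C) (hstep : ∀ n, 1 ≤ n → |y (n + 1) - y n| ≤ C / (n : ℝ) ^ 3) {n : ℕ} (hn : 1 ≤ n) :
    |y n| ≤ 2 * C / (n : ℝ) ^ 2 := by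
  have hbase (k : ℕ) : C / ((k + 1 : ℕ) : ℝ) ^ 3
      ≤ 2 * C / ((k + 1 : ℕ) : ℝ) ^ 2 - 2 * C / ((k + 1 + 1 : ℕ) : ℝ) ^ 2 := by
    push_cast
    set t : ℝ := (k : ℝ) + 1 with ht
    have ht1 : 1 ≤ t := by rw [ht]; have : (0 : ℝ) ≤ k := by positivity
                           linarith
    have h1 : 2 * C / t ^ 2 - 2 * C / (t + 1) ^ 2 - C / t ^ 3
        = C * (3 * t ^ 2 - 1) / (t ^ 3 * (t + 1) ^ 2) := by
      field_simp
      ring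
    have h2 : 0 ≤ C * (3 * t ^ 2 - 1) / (t ^ 3 * (t + 1) ^ 2) := by
      have : 0 ≤ 3 * t ^ 2 - 1 := by nlinarith
      positivity
    linarith
  have hlim : Filter.Tendsto (fun n : ℕ => 2 * C / (n : ℝ) ^ 2) Filter.atTop (nhds 0) := by
    refine Filter.Tendsto.div_atTop tendsto_const_nhds ?_
    exact (Filter.tendsto_pow_atTop two_ne_zero).comp tendsto_natCast_atTop_atTop
  obtain ⟨k, rfl⟩ := Nat.exists_eq_add_of_le' hn
  have hanti (z : ℕ → ℝ) (hz : Filter.Tendsto z Filter.atTop (nhds 0))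
      (hzs : ∀ k, z (k + 1 + 1) - z (k + 1) ≤ C / ((k + 1 : ℕ) : ℝ) ^ 3) :
      - (2 * C / ((k + 1 : ℕ) : ℝ) ^ 2) ≤ z (k + 1) := by
    have ha : Antitone fun k : ℕ => z (k + 1) + 2 * C / ((k + 1 : ℕ) : ℝ) ^ 2 := by
      refine antitone_nat_of_succ_le fun k => ?_
      have := hbase k
      have := hzs k
      linarith
    have hl : Filter.Tendsto (fun k : ℕ => z (k + 1) + 2 * C / ((k + 1 : ℕ) : ℝ) ^ 2)
        Filter.atTop (nhds 0) := by
      have := (hz.add hlim).comp (Filter.tendsto_add_atTop_nat 1)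
      simpa [Function.comp_def] using this
    have := ha.le_of_tendsto hl k
    linarith
  rw [abs_le]
  constructor
  · exact hanti y hy fun k => (le_abs_self _).trans (hstep (k + 1) (by omega))
  · have := hanti (fun n => - y n) (by simpa using hy.neg) fun k => by
      have := (neg_le_abs _).trans (hstep (k + 1) (by omega))
      linarith
    linarith

/-- `Γ(n + 1 - α) / Γ(n + 1)`. -/
def gammaRatio (α : ℝ) (n : ℕ) : ℝ := Real.Gamma ((n : ℝ) + 1 - α) / Real.Gamma ((n : ℝ) + 1)

theorem gammaRatio_pos {α : ℝ} (hα : α ≤ 1) {n : ℕ} (hn : 1 ≤ n) : 0 < gammaRatio α n := by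
  have : (1 : ℝ) ≤ n := by exact_mod_cast hn
  exact div_pos (Real.Gamma_pos_of_pos (by linarith)) (Real.Gamma_pos_of_pos (by linarith))

theorem gammaRatio_one (α : ℝ) : gammaRatio α 1 = Real.Gamma (2 - α) := by
  rw [gammaRatio]
  norm_num [Real.Gamma_two]

theorem gammaRatio_succ {α : ℝ} (hα : α ≤ 1) {n : ℕ} (hn : 1 ≤ n) :
    gammaRatio α (n + 1) = gammaRatio α n * (1 - α / (n + 1)) := by
  have : (1 : ℝ) ≤ n := by exact_mod_cast hn
  have hG := (Real.Gamma_pos_of_pos (show 0 < (n : ℝ) + 1 by linarith)).ne'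
  rw [gammaRatio, gammaRatio]
  push_cast
  rw [show (n : ℝ) + 1 + 1 - α = ((n : ℝ) + 1 - α) + 1 by ring,
    Real.Gamma_add_one (by linarith), Real.Gamma_add_one (by linarith)]
  field_simp

/-- Log-convexity of `Γ`, in the form of the Bohr-Mollerup inequalities, squeezes the quotient. For
`α = 1` it equals one from `n = 1` on. -/
theorem tendsto_gammaRatio {α : ℝ} (h0 : 0 < α) (hα : α ≤ 1) :
    Filter.Tendsto (fun n : ℕ => gammaRatio α n * (n : ℝ) ^ α) Filter.atTop (nhds 1) := by
  have hform {n : ℕ} (hn : 1 ≤ n) : gammaRatio α n * (n : ℝ) ^ α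
      = Real.Gamma ((n : ℝ) + (1 - α)) / Real.Gamma n * (n : ℝ) ^ (α - 1) := by
    have hn' : (0 : ℝ) < n := by exact_mod_cast hn
    have hG := (Real.Gamma_pos_of_pos hn').ne'
    rw [gammaRatio, Real.Gamma_add_one hn'.ne', Real.rpow_sub_one hn'.ne',
      show (n : ℝ) + 1 - α = (n : ℝ) + (1 - α) by ring]
    field_simp
  rcases hα.eq_or_lt with rfl | hlt
  · refine tendsto_const_nhds.congr' ?_
    filter_upwards [Filter.eventually_ge_atTop 1] with n hn
    have hG := (Real.Gamma_pos_of_pos (show (0 : ℝ) < n by exact_mod_cast hn)).ne'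
    rw [hform hn]
    simp [hG]
  have hconv : ConvexOn ℝ (Ioi 0) (Real.log ∘ Real.Gamma) := Real.convexOn_log_Gamma
  have hfeq : ∀ {y : ℝ}, 0 < y →
      (Real.log ∘ Real.Gamma) (y + 1) = (Real.log ∘ Real.Gamma) y + Real.log y := by
    intro y hy
    simp only [Function.comp_apply]
    rw [Real.Gamma_add_one hy.ne', Real.log_mul hy.ne' (Real.Gamma_pos_of_pos hy).ne', add_comm]
  have hlow : Filter.Tendsto (fun n : ℕ => (1 - 1 / (n : ℝ)) ^ (1 - α)) Filter.atTop (nhds 1) := by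
    have h1 : Filter.Tendsto (fun n : ℕ => 1 - 1 / (n : ℝ)) Filter.atTop (nhds 1) := by
      simpa using (tendsto_const_nhds (x := (1 : ℝ))).sub tendsto_one_div_atTop_nhds_zero_nat
    simpa using h1.rpow_const (p := 1 - α) (Or.inl one_ne_zero)
  refine tendsto_of_tendsto_of_tendsto_of_le_of_le' hlow tendsto_const_nhds ?_ ?_
  · filter_upwards [Filter.eventually_ge_atTop 2] with n hn
    have hn' : (2 : ℝ) ≤ n := by exact_mod_cast hn
    have hn0 : (0 : ℝ) < n := by linarith
    have h1 := Real.BohrMollerup.f_add_nat_ge hconv hfeq hn (show 0 < 1 - α by linarith)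
    simp only [Function.comp_apply] at h1
    have hG := Real.Gamma_pos_of_pos hn0
    have hG2 := Real.Gamma_pos_of_pos (show 0 < (n : ℝ) + (1 - α) by linarith)
    have h2 : Real.Gamma n * ((n : ℝ) - 1) ^ (1 - α) ≤ Real.Gamma ((n : ℝ) + (1 - α)) := by
      rw [← Real.log_le_log_iff (by have : (0:ℝ) < n - 1 := by linarith
                                    positivity) hG2,
        Real.log_mul hG.ne' (Real.rpow_pos_of_pos (by linarith) _).ne',
        Real.log_rpow (by linarith)]
      exact h1
    rw [hform (by omega)]
    have h3 : (1 - 1 / (n : ℝ)) ^ (1 - α) = ((n : ℝ) - 1) ^ (1 - α) * (n : ℝ) ^ (α - 1) := by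
      rw [show 1 - 1 / (n : ℝ) = ((n : ℝ) - 1) / n by field_simp,
        Real.div_rpow (by linarith) hn0.le, show α - 1 = -(1 - α) by ring, Real.rpow_neg hn0.le]
      rfl
    rw [h3]
    refine mul_le_mul_of_nonneg_right ?_ (by positivity)
    rw [le_div_iff₀ hG]
    linarith
  · filter_upwards [Filter.eventually_ge_atTop 1] with n hn
    have hn0 : (0 : ℝ) < n := by exact_mod_cast hn
    have h1 := Real.BohrMollerup.f_add_nat_le hconv hfeq (show n ≠ 0 by omega)
      (show 0 < 1 - α by linarith) (by linarith)
    simp only [Function.comp_apply] at h1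
    have hG := Real.Gamma_pos_of_pos hn0
    have hG2 := Real.Gamma_pos_of_pos (show 0 < (n : ℝ) + (1 - α) by linarith)
    have h2 : Real.Gamma ((n : ℝ) + (1 - α)) ≤ Real.Gamma n * (n : ℝ) ^ (1 - α) := by
      rw [← Real.log_le_log_iff hG2 (by positivity),
        Real.log_mul hG.ne' (Real.rpow_pos_of_pos hn0 _).ne', Real.log_rpow hn0]
      exact h1
    rw [hform hn, show α - 1 = -(1 - α) by ring, Real.rpow_neg hn0.le, ← div_eq_mul_inv,
      div_le_one (by positivity), div_le_iff₀ hG]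
    linarith

/-- Second-order asymptotics of `Γ(n + 1 - α) / Γ(n + 1)`. -/
theorem exists_gammaRatio_bound {α : ℝ} (h0 : 0 < α) (hα : α ≤ 1) :
    ∃ C : ℝ, 0 < C ∧ ∀ n : ℕ, 1 ≤ n →
      |gammaRatio α n * (n : ℝ) ^ α * (1 + α * (1 - α) / 2 / n) - 1| ≤ C / (n : ℝ) ^ 2 := by
  -- The value for which the first- and second-order terms of `log x_{n+1} - log x_n` in `1/n`
  -- cancel; `hpoly` is this cancellation.
  set c := α * (1 - α) / 2 with hc
  have hc0 : 0 ≤ c := by have : 0 ≤ 1 - α := by linarith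
                         positivity
  have hc1 : c ≤ 1 := by nlinarith
  let x : ℕ → ℝ := fun n => gammaRatio α n * (n : ℝ) ^ α * (1 + c / n)
  have hxpos (n : ℕ) (hn : 1 ≤ n) : 0 < x n := by
    have := gammaRatio_pos hα hn
    have : (0 : ℝ) < n := by exact_mod_cast hn
    positivity
  have hlim : Filter.Tendsto (fun n => Real.log (x n)) Filter.atTop (nhds 0) := by
    have h1 : Filter.Tendsto (fun n : ℕ => 1 + c / (n : ℝ)) Filter.atTop (nhds 1) := by
      simpa using (tendsto_const_nhds (x := (1 : ℝ))).add
        (tendsto_const_div_atTop_nhds_zero_nat c)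
    have h2 := (tendsto_gammaRatio h0 hα).mul h1
    rw [mul_one] at h2
    simpa using h2.log one_ne_zero
  -- The increment is a combination of four logarithms whose cubic remainders add up to at most
  -- `4/n³`.
  have hstep : ∀ n, 1 ≤ n → |Real.log (x (n + 1)) - Real.log (x n)| ≤ 6 / (n : ℝ) ^ 3 := by
    intro n hn
    have hn0 : (0 : ℝ) < n := by exact_mod_cast hn
    have hn1 : (1 : ℝ) ≤ n := by exact_mod_cast hn
    set y : ℝ := 1 / n with hy
    have hy0 : 0 < y := by positivity
    have hg := gammaRatio_pos hα hn
    have hα1 : 0 < 1 - α / ((n : ℝ) + 1) := by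
      rw [sub_pos, div_lt_one (by positivity)]; linarith
    have hα1' : 0 ≤ 1 - α := by linarith
    have e0 : Real.log (x (n + 1)) - Real.log (x n)
        = Real.log (1 + (1 - α) * y) - (2 - α) * Real.log (1 + y)
          + Real.log (1 + (1 + c) * y) - Real.log (1 + c * y) := by
      have e1 : 1 - α / ((n : ℝ) + 1) = (1 + (1 - α) * y) / (1 + y) := by
        rw [hy]; field_simp; ring
      have e2 : (n : ℝ) + 1 = n * (1 + y) := by rw [hy]; field_simp
      have e3 : 1 + c / ((n : ℝ) + 1) = (1 + (1 + c) * y) / (1 + y) := by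
        rw [hy]; field_simp; ring
      have e4 : 1 + c / (n : ℝ) = 1 + c * y := by rw [hy]; field_simp
      have p1 : 0 < 1 + (1 - α) * y := by positivity
      have p2 : 0 < 1 + y := by positivity
      have p3 : 0 < 1 + (1 + c) * y := by positivity
      have p4 : 0 < 1 + c * y := by positivity
      simp only [x]
      rw [gammaRatio_succ hα hn]
      push_cast
      rw [e3, e1, e4, e2, Real.log_mul (by positivity) (by positivity),
        Real.log_mul (by positivity) (by positivity),
        Real.log_mul (by positivity) (by positivity), Real.log_rpow (by positivity),
        Real.log_mul (by positivity) (by positivity), Real.log_div (by positivity) (by positivity),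
        Real.log_div (by positivity) (by positivity), Real.log_mul (by positivity) (by positivity),
        Real.log_mul (by positivity) (by positivity), Real.log_rpow (by positivity)]
      ring
    have b1 := abs_le.1 (abs_log_one_add_sub_le (show 0 ≤ (1 - α) * y by positivity))
    have b2 := abs_le.1 (abs_log_one_add_sub_le hy0.le)
    have b3 := abs_le.1 (abs_log_one_add_sub_le (show 0 ≤ (1 + c) * y by positivity))
    have b4 := abs_le.1 (abs_log_one_add_sub_le (show 0 ≤ c * y by positivity))
    have hy3 : 0 ≤ y ^ 3 := by positivity
    have c1 : ((1 - α) * y) ^ 3 / 3 ≤ y ^ 3 / 3 := by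
      rw [mul_pow]
      have : (1 - α) ^ 3 ≤ 1 := pow_le_one₀ hα1' (by linarith)
      nlinarith
    have c3 : ((1 + c) * y) ^ 3 / 3 ≤ 8 * y ^ 3 / 3 := by
      rw [mul_pow]
      have : (1 + c) ^ 3 ≤ 2 ^ 3 := pow_le_pow_left₀ (by positivity) (by linarith) 3
      nlinarith
    have c4 : (c * y) ^ 3 / 3 ≤ y ^ 3 / 3 := by
      rw [mul_pow]
      have : c ^ 3 ≤ 1 := pow_le_one₀ hc0 hc1
      nlinarith
    have hpoly : ((1 - α) * y - ((1 - α) * y) ^ 2 / 2) - (2 - α) * (y - y ^ 2 / 2)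
        + ((1 + c) * y - ((1 + c) * y) ^ 2 / 2) - (c * y - (c * y) ^ 2 / 2) = 0 := by
      rw [hc]; ring
    have d2 : |(2 - α) * (Real.log (1 + y) - (y - y ^ 2 / 2))| ≤ 2 * (y ^ 3 / 3) := by
      rw [abs_mul, abs_of_nonneg (show 0 ≤ 2 - α by linarith)]
      exact mul_le_mul (by linarith) (abs_log_one_add_sub_le hy0.le) (abs_nonneg _) (by norm_num)
    have d2' := abs_le.1 d2
    have hfin : 6 / (n : ℝ) ^ 3 = 6 * y ^ 3 := by rw [hy]; field_simp
    rw [e0, hfin, abs_le]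
    constructor <;> linarith
  -- Telescoping gives `|log x_n| ≤ 12/n²`, in particular at most `12`, and exponentiating costs a
  -- factor `exp 12`.
  refine ⟨12 * Real.exp 12, by positivity, fun n hn => ?_⟩
  have hb := abs_le_of_telescope hlim (by norm_num) hstep hn
  have hn1 : (1 : ℝ) ≤ n := by exact_mod_cast hn
  have hb12 : |Real.log (x n)| ≤ 12 := hb.trans (by
    rw [div_le_iff₀ (by positivity)]; nlinarith)
  have hx : x n = Real.exp (Real.log (x n)) := (Real.exp_log (hxpos n hn)).symm
  have hexp (z : ℝ) (hz : |z| ≤ 12) : |Real.exp z - 1| ≤ |z| * Real.exp 12 := by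
    rw [abs_le]
    have hz' := abs_le.1 hz
    have e1 : (1 : ℝ) ≤ Real.exp 12 := Real.one_le_exp (by norm_num)
    constructor
    · have h1 := Real.add_one_le_exp z
      have h2 := neg_abs_le z
      have h3 := abs_nonneg z
      nlinarith
    · have h1 := Real.add_one_le_exp (-z)
      have h2 : Real.exp z - 1 ≤ z * Real.exp z := by
        have := mul_le_mul_of_nonneg_left h1 (Real.exp_pos z).le
        rw [← Real.exp_add] at this
        simp at this
        linarith
      refine h2.trans ?_
      refine mul_le_mul (le_abs_self z) (Real.exp_le_exp.2 hz'.2) (Real.exp_pos z).le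
        (abs_nonneg z)
  change |x n - 1| ≤ _
  rw [hx]
  refine (hexp _ hb12).trans ?_
  calc |Real.log (x n)| * Real.exp 12 ≤ 2 * 6 / (n : ℝ) ^ 2 * Real.exp 12 := by gcongr
    _ = 12 * Real.exp 12 / (n : ℝ) ^ 2 := by ring

/-! ### Peano kernels of the WSGL formula -/

/-- The first Peano kernel: the error of the formula on `t ↦ max t 0`, with cutoff `n`. -/
def peanoOne (α : ℝ) (n : ℕ) (x : ℝ) : ℝ :=
  ∑ k ∈ Finset.range (n + 1), wsglWeight α k * max (x - k) 0 - x ^ (1 - α) / Real.Gamma (2 - α)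

/-- The second Peano kernel: the error of the formula on `t ↦ (max t 0)² / 2`, with cutoff `n`. -/
def peanoTwo (α : ℝ) (n : ℕ) (x : ℝ) : ℝ :=
  ∑ k ∈ Finset.range (n + 1), wsglWeight α k * (max (x - k) 0 ^ 2 / 2)
    - x ^ (2 - α) / ((2 - α) * Real.Gamma (2 - α))

theorem hasDerivAt_max_sq (x : ℝ) :
    HasDerivAt (fun y : ℝ => max y 0 ^ 2 / 2) (max x 0) x := by
  have hne : ∀ y ≠ (0 : ℝ), HasDerivAt (fun y : ℝ => max y 0 ^ 2 / 2) (max y 0) y := by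
    intro y hy
    rcases lt_or_gt_of_ne hy with h | h
    · rw [max_eq_right h.le]
      refine (hasDerivAt_const y (0 : ℝ)).congr_of_eventuallyEq ?_
      filter_upwards [eventually_lt_nhds h] with z hz
      rw [max_eq_right hz.le]; simp
    · rw [max_eq_left h.le]
      have h1 : HasDerivAt (fun y : ℝ => y ^ 2 / 2) y y := by
        refine (((hasDerivAt_id y).pow 2).div_const 2).congr_deriv ?_
        simp
      refine h1.congr_of_eventuallyEq ?_
      filter_upwards [eventually_gt_nhds h] with z hz
      rw [max_eq_left hz.le]
  rcases eq_or_ne x 0 with rfl | hx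
  · exact hasDerivAt_of_hasDerivAt_of_ne (g := fun y => max y 0) hne (by fun_prop) (by fun_prop)
  · exact hne x hx

theorem hasDerivAt_peanoTwo {α : ℝ} (hα : α ≤ 1) (n : ℕ) {x : ℝ} (hx : 0 < x) :
    HasDerivAt (peanoTwo α n) (peanoOne α n x) x := by
  have h1 : HasDerivAt
      (fun y : ℝ => ∑ k ∈ Finset.range (n + 1), wsglWeight α k * (max (y - k) 0 ^ 2 / 2))
      (∑ k ∈ Finset.range (n + 1), wsglWeight α k * max (x - k) 0) x := by
    refine HasDerivAt.fun_sum fun k _ => HasDerivAt.const_mul _ ?_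
    have := (hasDerivAt_max_sq (x - k)).comp x ((hasDerivAt_id x).sub_const (k : ℝ))
    simpa [Function.comp_def] using this
  have h2 := (Real.hasDerivAt_rpow_const (p := 2 - α) (Or.inl hx.ne')).div_const
    ((2 - α) * Real.Gamma (2 - α))
  refine (h1.sub h2).congr_deriv ?_
  have h3 : 2 - α ≠ 0 := by linarith
  have hG := (Real.Gamma_pos_of_pos (show 0 < 2 - α by linarith)).ne'
  rw [peanoOne, show 2 - α - 1 = 1 - α by ring]
  field_simp

theorem continuous_peanoTwo {α : ℝ} (hα : α ≤ 1) (n : ℕ) : Continuous (peanoTwo α n) := by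
  unfold peanoTwo
  have : Continuous fun x : ℝ => x ^ (2 - α) := Real.continuous_rpow_const (by linarith)
  fun_prop

theorem peanoTwo_zero {α : ℝ} (hα : α ≤ 1) (n : ℕ) : peanoTwo α n 0 = 0 := by
  rw [peanoTwo, Real.zero_rpow (by linarith), Finset.sum_eq_zero]
  · simp
  · intro k _
    rw [max_eq_right (by simp)]; simp

/-! ### Closed forms of the kernels at the nodes -/

theorem sum_range_ite_le {n p : ℕ} (hp : p ≤ n) (w : ℕ → ℝ) :
    ∑ k ∈ Finset.range (n + 1), (if k ≤ p then w k else 0) = ∑ k ∈ Finset.range (p + 1), w k := by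
  rw [← Finset.sum_filter]
  refine Finset.sum_congr ?_ fun _ _ => rfl
  ext k
  simp only [Finset.mem_filter, Finset.mem_range]
  omega

theorem max_sub_eq {p k : ℕ} {x : ℝ} (h1 : p ≤ x) (h2 : x ≤ p + 1) :
    max (x - k) 0 = max ((p : ℝ) - k) 0 + if k ≤ p then x - p else 0 := by
  split_ifs with h
  · have : (k : ℝ) ≤ p := by exact_mod_cast h
    rw [max_eq_left (by linarith), max_eq_left (by linarith)]; ring
  · have : (p : ℝ) + 1 ≤ k := by exact_mod_cast (by omega : p + 1 ≤ k)
    rw [max_eq_right (by linarith), max_eq_right (by linarith)]; ring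

theorem peanoSum_one_add {α : ℝ} {n p : ℕ} (hp : p ≤ n) {x : ℝ} (h1 : p ≤ x) (h2 : x ≤ p + 1) :
    ∑ k ∈ Finset.range (n + 1), wsglWeight α k * max (x - k) 0
      = ∑ k ∈ Finset.range (n + 1), wsglWeight α k * max ((p : ℝ) - k) 0
        + (x - p) * wsglPartialSum α p := by
  rw [wsglPartialSum, ← sum_range_ite_le hp, Finset.mul_sum,
    ← Finset.sum_add_distrib]
  refine Finset.sum_congr rfl fun k _ => ?_
  rw [max_sub_eq h1 h2]
  split_ifs <;> ring

theorem peanoSum_two_succ {α : ℝ} {n p : ℕ} (hp : p ≤ n) :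
    ∑ k ∈ Finset.range (n + 1), wsglWeight α k * (max (((p + 1 : ℕ) : ℝ) - k) 0 ^ 2 / 2)
      = ∑ k ∈ Finset.range (n + 1), wsglWeight α k * (max ((p : ℝ) - k) 0 ^ 2 / 2)
        + ∑ k ∈ Finset.range (n + 1), wsglWeight α k * max ((p : ℝ) - k) 0
        + 1 / 2 * wsglPartialSum α p := by
  rw [wsglPartialSum, ← sum_range_ite_le hp, Finset.mul_sum,
    ← Finset.sum_add_distrib, ← Finset.sum_add_distrib]
  refine Finset.sum_congr rfl fun k _ => ?_
  rw [max_sub_eq (p := p) (x := ((p + 1 : ℕ) : ℝ)) (by push_cast; linarith) (by push_cast; linarith)]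
  push_cast
  split_ifs with h
  · ring
  · have : (p : ℝ) + 1 ≤ k := by exact_mod_cast (by omega : p + 1 ≤ k)
    rw [max_eq_right (by linarith)]; ring

/-- Both sides obey the same one-step recursion. Writing `(1-α)/Γ(2-α)` for `1/Γ(1-α)` keeps `α = 1`
inside the general case. -/
theorem glPartialSum_eq_gammaRatio {α : ℝ} (hα : α ≤ 1) {p : ℕ} (hp : 1 ≤ p) :
    glPartialSum α p = (1 - α) * gammaRatio α p / Real.Gamma (2 - α) := by
  have hG := (Real.Gamma_pos_of_pos (show 0 < 2 - α by linarith)).ne'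
  induction p, hp using Nat.le_induction with
  | base => rw [gammaRatio_one, glPartialSum_succ]; field_simp; simp
  | succ p hp ih =>
    rw [glPartialSum_succ, ih, gammaRatio_succ hα hp]
    ring

/-- On each cell the sum is linear with slope `A_p`, so its node values are sums of the `A_p`, which
the recursion of the Gamma ratio closes up. -/
theorem peanoSum_one_natCast {α : ℝ} (hα : α ≤ 1) {n : ℕ} : ∀ p : ℕ, p + 1 ≤ n →
    ∑ k ∈ Finset.range (n + 1), wsglWeight α k * max (((p + 1 : ℕ) : ℝ) - k) 0
      = ((p + 1 : ℕ) : ℝ) * gammaRatio α (p + 1) / Real.Gamma (2 - α)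
        + α / 2 * glPartialSum α p := by
  have hG := (Real.Gamma_pos_of_pos (show 0 < 2 - α by linarith)).ne'
  intro p
  induction p with
  | zero =>
    intro _
    rw [peanoSum_one_add (p := 0) (by omega) (by simp) (by simp), gammaRatio_one,
      Finset.sum_eq_zero]
    · simp [wsglPartialSum_eq]
      field_simp
    · intro k _
      rw [max_eq_right (by simp), mul_zero]
  | succ p ih =>
    intro hp
    rw [peanoSum_one_add (p := p + 1) (by omega) (by push_cast; linarith) (by push_cast; linarith),
      ih (by omega), wsglPartialSum_eq, glWeight_succ_eq,
      gammaRatio_succ hα (show 1 ≤ p + 1 by omega)]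
    have h1 := glPartialSum_eq_gammaRatio hα (show 1 ≤ p + 1 by omega)
    have h2 := glPartialSum_succ α p
    have h3 : α * glPartialSum α p / ((p : ℝ) + 1) = glPartialSum α p - glPartialSum α (p + 1) := by
      rw [h2]; ring
    rw [h3, h1]
    push_cast
    field_simp
    ring

/-- One more summation. The constant `α(1-α)/2` added to the node is the one occurring in
`exists_gammaRatio_bound`. -/
theorem peanoSum_two_natCast {α : ℝ} (hα : α ≤ 1) {n : ℕ} : ∀ p : ℕ, p + 1 ≤ n →
    ∑ k ∈ Finset.range (n + 1), wsglWeight α k * (max (((p + 1 : ℕ) : ℝ) - k) 0 ^ 2 / 2)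
      = ((p + 1 : ℕ) : ℝ) * gammaRatio α (p + 1) * (((p + 1 : ℕ) : ℝ) + α * (1 - α) / 2)
          / ((2 - α) * Real.Gamma (2 - α)) - α / 4 * glPartialSum α p := by
  have hG := (Real.Gamma_pos_of_pos (show 0 < 2 - α by linarith)).ne'
  have h2α : 2 - α ≠ 0 := by linarith
  intro p
  induction p with
  | zero =>
    intro _
    rw [peanoSum_two_succ (by omega), gammaRatio_one, Finset.sum_eq_zero, Finset.sum_eq_zero]
    · simp [wsglPartialSum_eq]
      field_simp
      ring
    · intro k _
      rw [max_eq_right (by simp), mul_zero]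
    · intro k _
      rw [max_eq_right (by simp)]; simp
  | succ p ih =>
    intro hp
    rw [peanoSum_two_succ (by omega), ih (by omega), peanoSum_one_natCast hα p (by omega),
      wsglPartialSum_eq, glWeight_succ_eq,
      gammaRatio_succ hα (show 1 ≤ p + 1 by omega)]
    have h1 := glPartialSum_eq_gammaRatio hα (show 1 ≤ p + 1 by omega)
    have h2 := glPartialSum_succ α p
    have h3 : α * glPartialSum α p / ((p : ℝ) + 1) = glPartialSum α p - glPartialSum α (p + 1) := by
      rw [h2]; ring
    rw [h3, h1]
    push_cast
    field_simp
    ring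

/-! ### Decay of the Peano kernels -/

theorem rpow_neg_sub_le {α : ℝ} (h0 : 0 < α) (hα : α ≤ 1) {p y : ℝ} (hp : 0 < p)
    (h1 : p ≤ y) (h2 : y ≤ p + 1) : |p ^ (-α) - y ^ (-α)| ≤ p ^ (-α - 1) := by
  have hy : 0 < y := by linarith
  rw [abs_of_nonneg (sub_nonneg.2 (Real.rpow_le_rpow_of_nonpos hp h1 (by linarith)))]
  have h3 : (p + 1) ^ (-α) ≤ y ^ (-α) := Real.rpow_le_rpow_of_nonpos hy h2 (by linarith)
  have hq : 0 < 1 + 1 / p := by positivity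
  have h4 : (1 + 1 / p) ^ α ≤ 1 + α * (1 / p) :=
    rpow_one_add_le_one_add_mul_self (by have : 0 ≤ 1 / p := by positivity
                                         linarith) h0.le hα
  have h5 : 1 - 1 / p ≤ (1 + 1 / p) ^ (-α) := by
    rw [Real.rpow_neg hq.le, ← one_div, le_div_iff₀ (by positivity)]
    rcases le_total (1 - 1 / p) 0 with h | h
    · have : (1 - 1 / p) * (1 + 1 / p) ^ α ≤ 0 := mul_nonpos_of_nonpos_of_nonneg h (by positivity)
      linarith
    · have h6 := mul_le_mul_of_nonneg_left h4 h
      have h7 : 0 ≤ 1 / p := by positivity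
      nlinarith [sq_nonneg (1 / p)]
  have h6 : (p + 1) ^ (-α) = p ^ (-α) * (1 + 1 / p) ^ (-α) := by
    rw [← Real.mul_rpow hp.le hq.le]; congr 1; field_simp
  have h7 : p ^ (-α - 1) = p ^ (-α) * (1 / p) := by rw [Real.rpow_sub_one hp.ne']; ring
  have h8 : 0 ≤ p ^ (-α) := by positivity
  nlinarith

/-- The zeroth Peano kernel: the error of the formula on a Heaviside function. -/
theorem exists_peanoZero_bound {α : ℝ} (h0 : 0 < α) (hα : α ≤ 1) :
    ∃ C : ℝ, 0 < C ∧ ∀ (p : ℕ) (y : ℝ), 1 ≤ p → (p : ℝ) ≤ y → y ≤ p + 1 →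
      |wsglPartialSum α p - (1 - α) * y ^ (-α) / Real.Gamma (2 - α)|
        ≤ C * (p : ℝ) ^ (-α - 1) := by
  obtain ⟨C, hC, hx⟩ := exists_gammaRatio_bound h0 hα
  have hG := Real.Gamma_pos_of_pos (show 0 < 2 - α by linarith)
  have hα1 : 0 ≤ 1 - α := by linarith
  refine ⟨(C + 2) / Real.Gamma (2 - α) + 1, by positivity, ?_⟩
  intro p y hp h1 h2
  have hp1 : (1 : ℝ) ≤ p := by exact_mod_cast hp
  have hp0 : (0 : ℝ) < p := by linarith
  have hxp := hx p hp
  set c := α * (1 - α) / 2 with hc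
  have hc0 : 0 ≤ c := by positivity
  have hc1 : c ≤ 1 := by nlinarith
  set H := gammaRatio α p
  set s := (p : ℝ) ^ (-α) with hs
  have hs0 : 0 < s := by positivity
  have hsα : (p : ℝ) ^ α * s = 1 := by rw [hs, ← Real.rpow_add hp0]; simp
  have hs1 : (p : ℝ) ^ (-α - 1) = s / p := Real.rpow_sub_one hp0.ne' _
  have hw : |glWeight α p| ≤ s / p := by
    obtain ⟨q, rfl⟩ := Nat.exists_eq_add_of_le' hp
    have := abs_glWeight_succ_le h0 hα q
    rw [← hs1]; push_cast at this ⊢; exact this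
  -- Only the leading order of the Gamma ratio is needed here; the term `c/p` goes into the error.
  have hH : |H - s| ≤ (C + 1) * (s / p) := by
    have e1 : H - s = s * ((H * (p : ℝ) ^ α * (1 + c / p) - 1) - c / p) / (1 + c / p) := by
      rw [eq_div_iff (by positivity)]
      linear_combination (-(H * (1 + c / p))) * hsα
    have hb : |(H * (p : ℝ) ^ α * (1 + c / p) - 1) - c / p| ≤ (C + 1) / p := by
      refine (abs_sub _ _).trans ?_
      have e2 : C / (p : ℝ) ^ 2 ≤ C / p := by
        gcongr
        nlinarith
      have e3 : |c / (p : ℝ)| ≤ 1 / p := by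
        rw [abs_of_nonneg (by positivity)]; gcongr
      rw [add_div]
      linarith
    rw [e1, abs_div, abs_mul, abs_of_pos hs0, abs_of_pos (show 0 < 1 + c / (p : ℝ) by positivity)]
    refine (div_le_self (by positivity) (by have : 0 ≤ c / (p : ℝ) := by positivity
                                            linarith)).trans ?_
    refine (mul_le_mul_of_nonneg_left hb hs0.le).trans (le_of_eq (by ring))
  have hy := rpow_neg_sub_le h0 hα hp0 h1 h2
  rw [hs1] at hy ⊢
  rw [wsglPartialSum_eq, glPartialSum_eq_gammaRatio hα hp]
  have e4 : (1 - α) * H / Real.Gamma (2 - α) + α / 2 * glWeight α p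
      - (1 - α) * y ^ (-α) / Real.Gamma (2 - α)
      = (1 - α) / Real.Gamma (2 - α) * ((H - s) + (s - y ^ (-α))) + α / 2 * glWeight α p := by
    ring
  rw [e4]
  refine (abs_add_le _ _).trans ?_
  rw [abs_mul, abs_mul, abs_of_nonneg (show 0 ≤ (1 - α) / Real.Gamma (2 - α) by positivity),
    abs_of_pos (show 0 < α / 2 by positivity)]
  have e5 : |(H - s) + (s - y ^ (-α))| ≤ (C + 2) * (s / p) := by
    refine (abs_add_le _ _).trans ?_
    linarith
  have e6 : (1 - α) / Real.Gamma (2 - α) ≤ 1 / Real.Gamma (2 - α) := by gcongr; linarith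
  calc (1 - α) / Real.Gamma (2 - α) * |(H - s) + (s - y ^ (-α))| + α / 2 * |glWeight α p|
      ≤ 1 / Real.Gamma (2 - α) * ((C + 2) * (s / p)) + 1 * (s / p) := by
        gcongr
        linarith
    _ = ((C + 2) / Real.Gamma (2 - α) + 1) * (s / p) := by ring

/-- The main term of `t H` cancels `t^(1-α)`, and the next one, of relative size `c/t`, is cancelled
by the shift term `(α/2) W`. This is the second-order property of the formula; a relative error
`O(1/t²)` remains. -/
theorem exists_peanoOne_natCast_bound {α : ℝ} (h0 : 0 < α) (hα : α ≤ 1) :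
    ∃ C : ℝ, 0 < C ∧ ∀ n p : ℕ, 1 ≤ p → p ≤ n → |peanoOne α n p| ≤ C * (p : ℝ) ^ (-α - 1) := by
  obtain ⟨C, hC, hx⟩ := exists_gammaRatio_bound h0 hα
  have hG := Real.Gamma_pos_of_pos (show 0 < 2 - α by linarith)
  have hα1 : 0 ≤ 1 - α := by linarith
  set G := Real.Gamma (2 - α) with hGdef
  refine ⟨(2 * C + 2 * G) / G, by positivity, ?_⟩
  intro n p hp hpn
  obtain ⟨q, rfl⟩ := Nat.exists_eq_add_of_le' hp
  have hxp := hx (q + 1) hp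
  rw [peanoOne, peanoSum_one_natCast hα q hpn, ← hGdef]
  have hW := glPartialSum_le h0 hα q
  have hW0 := glPartialSum_nonneg hα q
  have hWs := glPartialSum_succ α q
  rw [glPartialSum_eq_gammaRatio hα hp, ← hGdef] at hWs
  have ht0 : ((q : ℝ) + 1) = ((q + 1 : ℕ) : ℝ) := by push_cast; ring
  rw [ht0] at hW hWs
  have ht1 : (1 : ℝ) ≤ ((q + 1 : ℕ) : ℝ) := by exact_mod_cast hp
  set t : ℝ := ((q + 1 : ℕ) : ℝ)
  have ht : 0 < t := by linarith
  set c := α * (1 - α) / 2 with hc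
  have hc0 : 0 ≤ c := by positivity
  have hc1 : c ≤ 1 := by nlinarith
  set H := gammaRatio α (q + 1)
  set W := glPartialSum α q
  set s := t ^ (-α) with hs
  have hs0 : 0 < s := by positivity
  have hsα : t ^ α * s = 1 := by rw [hs, ← Real.rpow_add ht]; simp
  have hs1 : t ^ (-α - 1) = s / t := Real.rpow_sub_one ht.ne' _
  have hs2 : t ^ (1 - α) = s * t := by
    rw [show 1 - α = -α + 1 by ring, Real.rpow_add_one ht.ne']
  set X := H * t ^ α * (1 + c / t) - 1 with hX
  have hX' : H * (t + c) = s * t * (X + 1) := by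
    have : s * t * (X + 1) = (t ^ α * s) * (H * (t + c)) := by rw [hX]; field_simp; ring
    rw [this, hsα, one_mul]
  -- Trades the partial sum for the Gamma ratio, so that `(α/2)(1-α) = c` appears and the
  -- cancellation in `key` becomes visible.
  have hGW : G * W = (1 - α) * H + α * G * W / t := by
    have : (1 - α) * H = G * (W * (1 - α / t)) := by rw [← hWs]; field_simp
    rw [this]; ring
  have key : (t * H / G + α / 2 * W - t ^ (1 - α) / G) * ((t + c) * G)
      = s * t ^ 2 * X + α / 2 * ((1 - α) * (s * t * X) + α * G * W * (t + c) / t) := by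
    rw [hs2]
    have e1 : (t * H / G + α / 2 * W - s * t / G) * ((t + c) * G)
        = t * (H * (t + c)) + α / 2 * (G * W) * (t + c) - s * t * (t + c) := by
      field_simp
    rw [e1, hGW]
    have e2 : t * (H * (t + c)) + α / 2 * ((1 - α) * H + α * G * W / t) * (t + c) - s * t * (t + c)
       = t * (H * (t + c)) + α / 2 * ((1 - α) * (H * (t + c)) + α * G * W * (t + c) / t)
        - s * t * (t + c) := by ring
    rw [e2, hX', hc]
    ring
  have hXs : |s * t ^ 2 * X| ≤ C * s := by
    rw [abs_mul, abs_of_pos (show 0 < s * t ^ 2 by positivity)]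
    refine (mul_le_mul_of_nonneg_left hxp (by positivity)).trans (le_of_eq ?_)
    field_simp
  have hXs' : |s * t * X| ≤ C * s := by
    refine le_trans ?_ hXs
    rw [abs_mul, abs_mul (s * t ^ 2), abs_of_pos (show 0 < s * t ^ 2 by positivity),
      abs_of_pos (show 0 < s * t by positivity)]
    gcongr
    nlinarith
  have hlast : |α * G * W * (t + c) / t| ≤ 2 * G * s := by
    rw [abs_of_nonneg (by positivity), div_le_iff₀ ht]
    calc α * G * W * (t + c) ≤ 1 * G * s * (t + t) := by gcongr; linarith
      _ = 2 * G * s * t := by ring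
  have hbound : |(t * H / G + α / 2 * W - t ^ (1 - α) / G) * ((t + c) * G)|
      ≤ (2 * C + 2 * G) * s := by
    rw [key]
    have b1 : |(1 - α) * (s * t * X)| ≤ C * s := by
      rw [abs_mul, abs_of_nonneg hα1]
      exact (mul_le_of_le_one_left (abs_nonneg _) (by linarith)).trans hXs'
    have b2 : |α / 2 * ((1 - α) * (s * t * X) + α * G * W * (t + c) / t)|
        ≤ C * s + 2 * G * s := by
      rw [abs_mul, abs_of_pos (show 0 < α / 2 by positivity)]
      refine (mul_le_of_le_one_left (abs_nonneg _) (by linarith)).trans ?_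
      exact (abs_add_le _ _).trans (add_le_add b1 hlast)
    refine (abs_add_le _ _).trans ?_
    linarith
  rw [abs_mul, abs_of_pos (show 0 < (t + c) * G by positivity)] at hbound
  rw [hs1]
  have hfin : |t * H / G + α / 2 * W - t ^ (1 - α) / G| * (t * G) ≤ (2 * C + 2 * G) * s := by
    refine le_trans ?_ hbound
    gcongr
    linarith
  rw [div_mul_div_comm, le_div_iff₀ (by positivity)]
  linarith

/-- The closed form contains exactly the factor `t + c` of the Gamma asymptotics, so only the
remainder `X` and a multiple of `W`, itself `O(p^(-α))`, survive. -/
theorem exists_peanoTwo_natCast_bound {α : ℝ} (h0 : 0 < α) (hα : α ≤ 1) :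
    ∃ C : ℝ, 0 < C ∧ ∀ n p : ℕ, 1 ≤ p → p ≤ n → |peanoTwo α n p| ≤ C * (p : ℝ) ^ (-α) := by
  obtain ⟨C, hC, hx⟩ := exists_gammaRatio_bound h0 hα
  have hG := Real.Gamma_pos_of_pos (show 0 < 2 - α by linarith)
  have h2α : 0 < 2 - α := by linarith
  set G := Real.Gamma (2 - α) with hGdef
  refine ⟨C / ((2 - α) * G) + 1, by positivity, ?_⟩
  intro n p hp hpn
  obtain ⟨q, rfl⟩ := Nat.exists_eq_add_of_le' hp
  have hxp := hx (q + 1) hp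
  rw [peanoTwo, peanoSum_two_natCast hα q hpn, ← hGdef]
  have hW := glPartialSum_le h0 hα q
  have hW0 := glPartialSum_nonneg hα q
  have ht0 : ((q : ℝ) + 1) = ((q + 1 : ℕ) : ℝ) := by push_cast; ring
  rw [ht0] at hW
  have ht1 : (1 : ℝ) ≤ ((q + 1 : ℕ) : ℝ) := by exact_mod_cast hp
  set t : ℝ := ((q + 1 : ℕ) : ℝ)
  have ht : 0 < t := by linarith
  set c := α * (1 - α) / 2 with hc
  set H := gammaRatio α (q + 1)
  set W := glPartialSum α q
  set s := t ^ (-α) with hs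
  have hs0 : 0 < s := by positivity
  have hsα : t ^ α * s = 1 := by rw [hs, ← Real.rpow_add ht]; simp
  have hs2 : t ^ (2 - α) = s * t ^ 2 := by
    rw [show 2 - α = -α + (2 : ℕ) by push_cast; ring, Real.rpow_add_natCast ht.ne']
  set X := H * t ^ α * (1 + c / t) - 1 with hX
  have hX' : t * H * (t + c) = s * t ^ 2 * (X + 1) := by
    have : s * t ^ 2 * (X + 1) = (t ^ α * s) * (t * H * (t + c)) := by
      rw [hX]; field_simp; ring
    rw [this, hsα, one_mul]
  have hXs : |s * t ^ 2 * X| ≤ C * s := by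
    rw [abs_mul, abs_of_pos (show 0 < s * t ^ 2 by positivity)]
    refine (mul_le_mul_of_nonneg_left hxp (by positivity)).trans (le_of_eq ?_)
    field_simp
  have e : t * H * (t + c) / ((2 - α) * G) - α / 4 * W - t ^ (2 - α) / ((2 - α) * G)
      = s * t ^ 2 * X / ((2 - α) * G) - α / 4 * W := by
    rw [hX', hs2]; ring
  rw [e]
  refine (abs_sub _ _).trans ?_
  rw [abs_div, abs_of_pos (show 0 < (2 - α) * G by positivity),
    abs_of_nonneg (show 0 ≤ α / 4 * W by positivity)]
  calc |s * t ^ 2 * X| / ((2 - α) * G) + α / 4 * W ≤ C * s / ((2 - α) * G) + 1 * s := by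
        gcongr
        linarith
    _ = (C / ((2 - α) * G) + 1) * s := by ring

/-- From the node `⌊x⌋` to `x`, the kernel changes at the rate given by the zeroth kernel. -/
theorem exists_peanoOne_bound {α : ℝ} (h0 : 0 < α) (hα : α ≤ 1) :
    ∃ C : ℝ, 0 < C ∧ ∀ (n : ℕ) (x : ℝ), 0 ≤ x → x ≤ n →
      |peanoOne α n x| ≤ C * (1 + x) ^ (-α - 1) := by
  obtain ⟨C₀, hC₀, hK0⟩ := exists_peanoZero_bound h0 hα
  obtain ⟨C₁, hC₁, hK1⟩ := exists_peanoOne_natCast_bound h0 hα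
  have hG := Real.Gamma_pos_of_pos (show 0 < 2 - α by linarith)
  set G := Real.Gamma (2 - α) with hGdef
  refine ⟨9 * (C₀ + C₁) + 4 * (2 + 1 / G), by positivity, ?_⟩
  intro n x hx hxn
  have h1x : 0 < 1 + x := by linarith
  set p := ⌊x⌋₊ with hp
  have hp1 : (p : ℝ) ≤ x := Nat.floor_le hx
  have hp2 : x ≤ p + 1 := (Nat.lt_floor_add_one x).le
  have hpn : p ≤ n := by
    have : (p : ℝ) ≤ n := hp1.trans hxn
    exact_mod_cast this
  have hE : 0 ≤ (1 + x) ^ (-α - 1) := by positivity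
  rcases Nat.eq_zero_or_pos p with hp0 | hp0
  · rw [hp0] at hp1 hp2
    have hx1 : x ≤ 1 := by simpa using hp2
    have hval : peanoOne α n x = x * (1 + α / 2) - x ^ (1 - α) / G := by
      rw [peanoOne, peanoSum_one_add (p := 0) (by omega) hp1 hp2, Finset.sum_eq_zero,
        wsglPartialSum_eq]
      · simp [hGdef]
      · intro k _
        rw [max_eq_right (by simp), mul_zero]
    have h1 : |peanoOne α n x| ≤ 2 + 1 / G := by
      rw [hval]
      refine (abs_sub _ _).trans ?_
      rw [abs_of_nonneg (by positivity), abs_of_nonneg (by positivity)]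
      have : x ^ (1 - α) ≤ 1 := Real.rpow_le_one hx hx1 (by linarith)
      gcongr
      nlinarith
    have h2 : 1 / 4 ≤ (1 + x) ^ (-α - 1) := by
      calc (1 / 4 : ℝ) = 2 ^ (-2 : ℝ) := by
            rw [Real.rpow_neg (by norm_num)]; norm_num
        _ ≤ 2 ^ (-α - 1) := Real.rpow_le_rpow_of_exponent_le (by norm_num) (by linarith)
        _ ≤ (1 + x) ^ (-α - 1) :=
            Real.rpow_le_rpow_of_nonpos h1x (by linarith) (by linarith)
    have h3 : 0 < 2 + 1 / G := by positivity
    have h4 : 0 < 9 * (C₀ + C₁) := by positivity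
    nlinarith
  · have hp1' : (1 : ℝ) ≤ p := by exact_mod_cast hp0
    have hpp : (0 : ℝ) < p := by linarith
    have hdiff : |peanoOne α n x - peanoOne α n p| ≤ C₀ * (p : ℝ) ^ (-α - 1) := by
      rcases hp1.eq_or_lt with h | h
      · rw [← h, sub_self, abs_zero]; positivity
      -- The sum is exactly linear on the cell, so the mean value theorem is applied to the power
      -- alone.
      obtain ⟨ξ, hξ, hξe⟩ := exists_hasDerivAt_eq_slope (fun y : ℝ => y ^ (1 - α))
        (fun y => (1 - α) * y ^ (-α)) h
        (continuousOn_id.rpow_const fun y hy => Or.inl (by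
          have := hy.1; simp only [id_eq]; linarith))
        (fun y hy => by
          have := Real.hasDerivAt_rpow_const (x := y) (p := 1 - α)
            (Or.inl (by have := hy.1; linarith))
          rwa [show 1 - α - 1 = -α by ring] at this)
      have hxp : 0 < x - p := by linarith
      rw [eq_div_iff hxp.ne'] at hξe
      have e1 : peanoOne α n x - peanoOne α n p
          = (x - p) * (wsglPartialSum α p - (1 - α) * ξ ^ (-α) / G) := by
        rw [peanoOne, peanoOne, peanoSum_one_add hpn hp1 hp2]
        linear_combination (1 / G) * hξe
      rw [e1, abs_mul, abs_of_pos hxp]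
      have e2 := hK0 p ξ hp0 hξ.1.le (hξ.2.le.trans hp2)
      exact (mul_le_of_le_one_left (abs_nonneg _) (by linarith)).trans e2
    have hint := hK1 n p hp0 hpn
    -- `1 + x ≤ 3p` and `α + 1 ≤ 2` give `3² = 9`.
    have h9 : (p : ℝ) ^ (-α - 1) ≤ 9 * (1 + x) ^ (-α - 1) := by
      have e1 : (3 * (p : ℝ)) ^ (-α - 1) ≤ (1 + x) ^ (-α - 1) :=
        Real.rpow_le_rpow_of_nonpos h1x (by linarith) (by linarith)
      rw [Real.mul_rpow (by norm_num) hpp.le] at e1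
      have e2 : (1 / 9 : ℝ) ≤ 3 ^ (-α - 1) := by
        calc (1 / 9 : ℝ) = 3 ^ (-2 : ℝ) := by
              rw [Real.rpow_neg (by norm_num)]; norm_num
          _ ≤ 3 ^ (-α - 1) := Real.rpow_le_rpow_of_exponent_le (by norm_num) (by linarith)
      have e3 : 0 < (p : ℝ) ^ (-α - 1) := by positivity
      nlinarith
    have htot : |peanoOne α n x| ≤ (C₀ + C₁) * (p : ℝ) ^ (-α - 1) := by
      have := abs_add_le (peanoOne α n x - peanoOne α n p) (peanoOne α n p)
      rw [sub_add_cancel] at this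
      linarith
    have h10 : 0 < 4 * (2 + 1 / G) := by positivity
    calc |peanoOne α n x| ≤ (C₀ + C₁) * (p : ℝ) ^ (-α - 1) := htot
      _ ≤ (C₀ + C₁) * (9 * (1 + x) ^ (-α - 1)) := by gcongr
      _ ≤ (9 * (C₀ + C₁) + 4 * (2 + 1 / G)) * (1 + x) ^ (-α - 1) := by nlinarith

theorem exists_peanoTwo_bound {α : ℝ} (h0 : 0 < α) (hα : α ≤ 1) :
    ∃ C : ℝ, 0 < C ∧ ∀ (n : ℕ) (x : ℝ), 0 ≤ x → x ≤ n →
      |peanoTwo α n x| ≤ C * (1 + x) ^ (-α) := by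
  obtain ⟨C₁, hC₁, hK1⟩ := exists_peanoOne_bound h0 hα
  obtain ⟨C₂, hC₂, hK2⟩ := exists_peanoTwo_natCast_bound h0 hα
  refine ⟨2 * C₁ + 3 * C₂, by positivity, ?_⟩
  intro n x hx hxn
  have h1x : 0 < 1 + x := by linarith
  set p := ⌊x⌋₊ with hp
  have hp1 : (p : ℝ) ≤ x := Nat.floor_le hx
  have hp2 : x ≤ p + 1 := (Nat.lt_floor_add_one x).le
  have hp0 : (0 : ℝ) ≤ p := by positivity
  have hpn : p ≤ n := by
    have : (p : ℝ) ≤ n := hp1.trans hxn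
    exact_mod_cast this
  have hscale {a q : ℝ} (ha : 1 ≤ a) (hq : 0 < q) (hxq : 1 + x ≤ a * q) :
      q ^ (-α) ≤ a * (1 + x) ^ (-α) := by
    have e1 : (a * q) ^ (-α) ≤ (1 + x) ^ (-α) :=
      Real.rpow_le_rpow_of_nonpos h1x hxq (by linarith)
    rw [Real.mul_rpow (by linarith) hq.le] at e1
    have ha0 : 0 < a := by linarith
    have e2 : a⁻¹ ≤ a ^ (-α) := by
      rw [← Real.rpow_neg_one]
      exact Real.rpow_le_rpow_of_exponent_le ha (by linarith)
    have e3 : 0 < q ^ (-α) := by positivity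
    have e4 : a⁻¹ * q ^ (-α) ≤ (1 + x) ^ (-α) :=
      (mul_le_mul_of_nonneg_right e2 e3.le).trans e1
    rwa [inv_mul_le_iff₀ ha0] at e4
  have hdiff : |peanoTwo α n x - peanoTwo α n p| ≤ 2 * C₁ * (1 + x) ^ (-α) := by
    rcases hp1.eq_or_lt with h | h
    · rw [← h, sub_self, abs_zero]; positivity
    obtain ⟨ξ, hξ, hξe⟩ := exists_hasDerivAt_eq_slope (peanoTwo α n) (peanoOne α n) h
      (continuous_peanoTwo hα n).continuousOn
      (fun y hy => hasDerivAt_peanoTwo hα n (by have := hy.1; linarith))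
    have hxp : 0 < x - p := by linarith
    rw [eq_div_iff hxp.ne'] at hξe
    have hξ0 : 0 ≤ ξ := hp0.trans hξ.1.le
    rw [← hξe, abs_mul, abs_of_pos hxp]
    refine (mul_le_of_le_one_right (abs_nonneg _) (by linarith)).trans ?_
    refine (hK1 n ξ hξ0 (hξ.2.le.trans hxn)).trans ?_
    have e1 : (1 + ξ) ^ (-α - 1) ≤ (1 + ξ) ^ (-α) :=
      Real.rpow_le_rpow_of_exponent_le (by linarith) (by linarith)
    have e2 := hscale (a := 2) (q := 1 + ξ) (by norm_num) (by linarith)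
      (by have := hξ.1; linarith)
    calc C₁ * (1 + ξ) ^ (-α - 1) ≤ C₁ * (2 * (1 + x) ^ (-α)) := by
          gcongr; exact e1.trans e2
      _ = 2 * C₁ * (1 + x) ^ (-α) := by ring
  have hint : |peanoTwo α n p| ≤ 3 * C₂ * (1 + x) ^ (-α) := by
    rcases Nat.eq_zero_or_pos p with h | h
    · rw [h, Nat.cast_zero, peanoTwo_zero hα, abs_zero]; positivity
    · have hp1' : (1 : ℝ) ≤ p := by exact_mod_cast h
      refine (hK2 n p h hpn).trans ?_
      have := hscale (a := 3) (q := p) (by norm_num) (by linarith) (by linarith)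
      calc C₂ * (p : ℝ) ^ (-α) ≤ C₂ * (3 * (1 + x) ^ (-α)) := by gcongr
        _ = 3 * C₂ * (1 + x) ^ (-α) := by ring
  have := abs_add_le (peanoTwo α n x - peanoTwo α n p) (peanoTwo α n p)
  rw [sub_add_cancel] at this
  linarith

/-- BDF2 is exact on quadratics once its whole three-point stencil lies to the right of the kink. -/
theorem peanoTwo_one_eq_zero {n : ℕ} {x : ℝ} (hx : 2 ≤ x) (hxn : x ≤ n) : peanoTwo 1 n x = 0 := by
  have hn : 2 ≤ n := by
    have : (2 : ℝ) ≤ n := hx.trans hxn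
    exact_mod_cast this
  obtain ⟨k, rfl⟩ := Nat.exists_eq_add_of_le' hn
  rw [peanoTwo, show k + 2 + 1 = 3 + k by ring, Finset.sum_range_add, Finset.sum_eq_zero (s := Finset.range k)]
  · simp only [Finset.sum_range_succ, Finset.sum_range_zero, wsglWeight_one, wsglWeight_two]
    rw [wsglWeight]
    push_cast
    rw [max_eq_left (by linarith), max_eq_left (by linarith), max_eq_left (by linarith)]
    norm_num
    ring
  · intro i _
    rw [add_comm 3 i, wsglWeight_one_eq_zero, zero_mul]

/-- For `α < 1` the pointwise bound is integrated. At `α = 1` that would cost a logarithm, which the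
vanishing beyond `2` prevents. -/
theorem exists_integral_abs_peanoTwo_le {α : ℝ} (h0 : 0 < α) (hα : α ≤ 1) :
    ∃ C : ℝ, 0 < C ∧ ∀ (n : ℕ) (X : ℝ), 1 ≤ X → X ≤ n →
      ∫ x in (0 : ℝ)..X, |peanoTwo α n x| ≤ C * X ^ (1 - α) := by
  obtain ⟨C, hC, hK⟩ := exists_peanoTwo_bound h0 hα
  rcases hα.eq_or_lt with rfl | hlt
  · refine ⟨2 * C, by positivity, fun n X hX hXn => ?_⟩
    have hcont := (continuous_peanoTwo hα n).abs
    have hbound (x : ℝ) (h1 : 0 ≤ x) (h2 : x ≤ n) : |peanoTwo 1 n x| ≤ C := by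
      refine (hK n x h1 h2).trans (mul_le_of_le_one_right hC.le ?_)
      exact Real.rpow_le_one_of_one_le_of_nonpos (by linarith) (by norm_num)
    rw [sub_self, Real.rpow_zero, mul_one]
    rcases le_total X 2 with h | h
    · calc ∫ x in (0 : ℝ)..X, |peanoTwo 1 n x| ≤ ∫ x in (0 : ℝ)..X, C := by
            refine intervalIntegral.integral_mono_on (by linarith)
              (hcont.intervalIntegrable _ _) intervalIntegrable_const fun x hx => ?_
            exact hbound x hx.1 (hx.2.trans hXn)
        _ = X * C := by simp
        _ ≤ 2 * C := by gcongr
    · rw [← intervalIntegral.integral_add_adjacent_intervals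
        (hcont.intervalIntegrable 0 2) (hcont.intervalIntegrable 2 X)]
      have e2 : ∫ x in (2 : ℝ)..X, |peanoTwo 1 n x| = 0 := by
        rw [intervalIntegral.integral_congr (g := fun _ => 0)]
        · simp
        · intro x hx
          rw [uIcc_of_le h] at hx
          simp only [peanoTwo_one_eq_zero hx.1 (hx.2.trans hXn), abs_zero]
      rw [e2, add_zero]
      calc ∫ x in (0 : ℝ)..2, |peanoTwo 1 n x| ≤ ∫ x in (0 : ℝ)..2, C := by
            refine intervalIntegral.integral_mono_on (by norm_num)
              (hcont.intervalIntegrable _ _) intervalIntegrable_const fun x hx => ?_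
            exact hbound x hx.1 (hx.2.trans (h.trans hXn))
        _ = 2 * C := by simp
  · have hα1 : 0 < 1 - α := by linarith
    refine ⟨C / (1 - α), by positivity, fun n X hX hXn => ?_⟩
    calc ∫ x in (0 : ℝ)..X, |peanoTwo α n x| ≤ ∫ x in (0 : ℝ)..X, C * x ^ (-α) := by
          refine intervalIntegral.integral_mono_on_of_le_Ioo (by linarith)
            ((continuous_peanoTwo hα n).abs.intervalIntegrable _ _)
            ((intervalIntegral.intervalIntegrable_rpow' (by linarith)).const_mul C)
            fun x hx => ?_
          refine (hK n x hx.1.le (hx.2.le.trans hXn)).trans ?_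
          refine mul_le_mul_of_nonneg_left ?_ hC.le
          exact Real.rpow_le_rpow_of_nonpos hx.1 (by linarith) (by linarith)
      _ = C / (1 - α) * X ^ (1 - α) := by
          rw [intervalIntegral.integral_const_mul, integral_rpow (Or.inl (by linarith)),
            Real.zero_rpow (by linarith), show -α + 1 = 1 - α by ring]
          ring

theorem intervalIntegrable_peanoOne {α : ℝ} (hα : α ≤ 1) (n : ℕ) (a b : ℝ) :
    IntervalIntegrable (peanoOne α n) volume a b := by
  unfold peanoOne
  refine IntervalIntegrable.sub (Continuous.intervalIntegrable (by fun_prop) _ _) ?_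
  exact (intervalIntegral.intervalIntegrable_rpow' (by linarith)).div_const _

/-! ### The Caputo operator in terms of the first derivative -/

/-- The Caputo derivative of order `α ∈ (0, 1]` of a function with derivative `f'`. -/
def caputoOf (α : ℝ) (f' : ℝ → ℝ) (t : ℝ) : ℝ :=
  if α = 1 then f' t else 1 / Real.Gamma (1 - α) * ∫ s in (0 : ℝ)..t, (t - s) ^ (-α) * f' s

theorem intervalIntegrable_sub_rpow {r : ℝ} (hr : -1 < r) (t a b : ℝ) :
    IntervalIntegrable (fun s => (t - s) ^ r) volume a b := by
  have := (intervalIntegral.intervalIntegrable_rpow' (a := t - a) (b := t - b) hr).comp_sub_left t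
  simpa using this

theorem intervalIntegrable_kernel_rpow {α σ t : ℝ} (hα : α < 1) (hσ : 0 < σ) (ht : 0 < t) :
    IntervalIntegrable (fun s => (t - s) ^ (-α) * s ^ (σ - 1)) volume 0 t := by
  refine IntervalIntegrable.trans (b := t / 2) ?_ ?_
  · refine (intervalIntegral.intervalIntegrable_rpow' (by linarith)).continuousOn_mul ?_
    refine ContinuousOn.rpow_const (by fun_prop) fun s hs => Or.inl ?_
    rw [uIcc_of_le (by linarith)] at hs
    have := hs.2
    linarith
  · refine (intervalIntegrable_sub_rpow (by linarith) t _ _).mul_continuousOn ?_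
    refine ContinuousOn.rpow_const (by fun_prop) fun s hs => Or.inl ?_
    rw [uIcc_of_le (by linarith)] at hs
    have := hs.1
    linarith

/-- A scaled beta integral, taken from its complex form. -/
theorem integral_kernel_rpow {α σ t : ℝ} (hα : α < 1) (hσ : 0 < σ) (ht : 0 < t) :
    ∫ s in (0 : ℝ)..t, (t - s) ^ (-α) * s ^ (σ - 1)
      = Real.Gamma σ * Real.Gamma (1 - α) / Real.Gamma (σ + 1 - α) * t ^ (σ - α) := by
  have h := Complex.betaIntegral_scaled (σ : ℂ) ((1 - α : ℝ) : ℂ) ht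
  have hb := ProbabilityTheory.beta_eq_betaIntegralReal σ (1 - α) hσ (by linarith)
  have hcongr : ∫ x in (0 : ℝ)..t, (x : ℂ) ^ ((σ : ℂ) - 1) * ((t : ℂ) - x) ^ (((1 - α : ℝ) : ℂ) - 1)
      = ((∫ s in (0 : ℝ)..t, (t - s) ^ (-α) * s ^ (σ - 1) : ℝ) : ℂ) := by
    rw [← intervalIntegral.integral_ofReal]
    refine intervalIntegral.integral_congr fun s hs => ?_
    rw [uIcc_of_le ht.le] at hs
    rw [Complex.ofReal_mul, Complex.ofReal_cpow (by linarith [hs.2]), Complex.ofReal_cpow hs.1]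
    push_cast
    rw [mul_comm]
    congr 2
    ring
  rw [hcongr] at h
  have h2 : (t : ℂ) ^ ((σ : ℂ) + ((1 - α : ℝ) : ℂ) - 1) = ((t ^ (σ - α) : ℝ) : ℂ) := by
    rw [Complex.ofReal_cpow ht.le]; congr 1; push_cast; ring
  rw [h2] at h
  have h3 := congrArg Complex.re h
  rw [Complex.ofReal_re, Complex.re_ofReal_mul, ← hb, ProbabilityTheory.beta] at h3
  rw [h3, show σ + (1 - α) = σ + 1 - α by ring]
  ring

theorem intervalIntegrable_kernel_mul {α σ t M : ℝ} (hα : α < 1) (hσ : 0 < σ) (ht : 0 < t)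
    {f' : ℝ → ℝ} (hf : ContinuousOn f' (Ioc 0 t)) (hM : ∀ s ∈ Ioc 0 t, |f' s| ≤ M * s ^ (σ - 1)) :
    IntervalIntegrable (fun s => (t - s) ^ (-α) * f' s) volume 0 t := by
  refine ((intervalIntegrable_kernel_rpow hα hσ ht).const_mul M).mono_fun' ?_ ?_
  · rw [uIoc_of_le ht.le]
    refine AEStronglyMeasurable.mul ?_ (hf.aestronglyMeasurable measurableSet_Ioc)
    have := (intervalIntegrable_sub_rpow (r := -α) (by linarith) t 0 t).1
    exact this.aestronglyMeasurable
  · rw [uIoc_of_le ht.le]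
    filter_upwards [ae_restrict_mem measurableSet_Ioc] with s hs
    have h1 : 0 ≤ (t - s) ^ (-α) := Real.rpow_nonneg (by linarith [hs.2]) _
    rw [Real.norm_eq_abs, abs_mul, abs_of_nonneg h1]
    have := hM s hs
    nlinarith

theorem caputoOf_rpow {α σ t : ℝ} (hα : α ≤ 1) (hσ : 0 < σ) (ht : 0 < t) :
    caputoOf α (fun s => σ * s ^ (σ - 1)) t
      = Real.Gamma (σ + 1) / Real.Gamma (σ + 1 - α) * t ^ (σ - α) := by
  have hG := (Real.Gamma_pos_of_pos hσ).ne'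
  rcases hα.eq_or_lt with rfl | hlt
  · rw [caputoOf, if_pos rfl, Real.Gamma_add_one hσ.ne', show σ + 1 - 1 = σ by ring]
    field_simp
  · have hG1 := (Real.Gamma_pos_of_pos (show 0 < 1 - α by linarith)).ne'
    rw [caputoOf, if_neg hlt.ne]
    have : ∀ s, (t - s) ^ (-α) * (σ * s ^ (σ - 1)) = σ * ((t - s) ^ (-α) * s ^ (σ - 1)) :=
      fun s => by ring
    simp only [this]
    rw [intervalIntegral.integral_const_mul, integral_kernel_rpow hlt hσ ht,
      Real.Gamma_add_one hσ.ne']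
    field_simp

/-! ### Peano representation of the truncation error -/

/-- The base point is `1`, since the derivatives may blow up at `0`. The positive part lets every
node share the interval `[1, n]`. -/
theorem taylor_natCast {f f₁ f₂ f₃ : ℝ → ℝ} (h₁ : ∀ x, 0 < x → HasDerivAt f (f₁ x) x)
    (h₂ : ∀ x, 0 < x → HasDerivAt f₁ (f₂ x) x) (h₃ : ∀ x, 0 < x → HasDerivAt f₂ (f₃ x) x)
    {n k : ℕ} (hk : 1 ≤ k) (hkn : k ≤ n) :
    f k = f 1 + f₁ 1 * max ((k : ℝ) - 1) 0 + ∫ s in (1 : ℝ)..n, f₂ s * max ((k : ℝ) - s) 0 := by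
  have hk1 : (1 : ℝ) ≤ k := by exact_mod_cast hk
  have hkn' : (k : ℝ) ≤ n := by exact_mod_cast hkn
  have hcont : ContinuousOn f₂ (Ioi 0) := fun x hx => (h₃ x hx).continuousAt.continuousWithinAt
  have hint (a b : ℝ) (ha : 1 ≤ a) (hb : 1 ≤ b) :
      IntervalIntegrable (fun s => f₂ s * max ((k : ℝ) - s) 0) volume a b := by
    refine ContinuousOn.intervalIntegrable ?_
    refine ContinuousOn.mul (hcont.mono fun x hx => ?_) (by fun_prop)
    have := hx.1
    have h : 1 ≤ min a b := le_min ha hb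
    simp only [mem_Ioi]
    linarith
  rw [← intervalIntegral.integral_add_adjacent_intervals (hint 1 k le_rfl hk1)
    (hint k n hk1 (hk1.trans hkn'))]
  have e2 : ∫ s in (k : ℝ)..n, f₂ s * max ((k : ℝ) - s) 0 = 0 := by
    rw [intervalIntegral.integral_congr (g := fun _ => 0)]
    · simp
    · intro s hs
      rw [uIcc_of_le hkn'] at hs
      simp only
      rw [max_eq_right (by linarith [hs.1]), mul_zero]
  have e1 : ∫ s in (1 : ℝ)..k, f₂ s * max ((k : ℝ) - s) 0
      = ((k - k) * f₁ k + f k) - ((k - 1) * f₁ 1 + f 1) := by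
    refine intervalIntegral.integral_eq_sub_of_hasDerivAt
      (f := fun s => ((k : ℝ) - s) * f₁ s + f s) (fun s hs => ?_) (hint 1 k le_rfl hk1)
    rw [uIcc_of_le hk1] at hs
    have hs0 : 0 < s := by linarith [hs.1]
    rw [max_eq_left (by linarith [hs.2])]
    refine ((((hasDerivAt_id s).const_sub (k : ℝ)).mul (h₂ s hs0)).add (h₁ s hs0)).congr_deriv ?_
    simp only [id_eq]
    ring
  rw [e1, e2, max_eq_left (by linarith)]
  ring

/-- The node `0` lies outside the Taylor formula but contributes nothing because `f 0 = 0`; dropping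
it leaves the partial sum at `n - 1`. -/
theorem wsglConv_eq_peano {α : ℝ} {f f₁ f₂ f₃ : ℝ → ℝ} (hf0 : f 0 = 0)
    (h₁ : ∀ x, 0 < x → HasDerivAt f (f₁ x) x)
    (h₂ : ∀ x, 0 < x → HasDerivAt f₁ (f₂ x) x) (h₃ : ∀ x, 0 < x → HasDerivAt f₂ (f₃ x) x)
    {n : ℕ} (hn : 1 ≤ n) :
    wsglConv α (fun k => f k) n = f 1 * wsglPartialSum α (n - 1)
      + f₁ 1 * ∑ k ∈ Finset.range (n + 1), wsglWeight α k * max ((n - 1 : ℝ) - k) 0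
      + ∫ s in (1 : ℝ)..n, f₂ s *
          ∑ k ∈ Finset.range (n + 1), wsglWeight α k * max ((n - s : ℝ) - k) 0 := by
  have hn1 : (1 : ℝ) ≤ n := by exact_mod_cast hn
  have hcont : ContinuousOn f₂ (Ioi 0) := fun x hx => (h₃ x hx).continuousAt.continuousWithinAt
  have hint (k : ℕ) :
      IntervalIntegrable (fun s => f₂ s * max ((n - s : ℝ) - k) 0) volume 1 n := by
    refine ContinuousOn.intervalIntegrable ?_
    refine ContinuousOn.mul (hcont.mono fun x hx => ?_) (by fun_prop)
    rw [uIcc_of_le hn1] at hx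
    have := hx.1
    simp only [mem_Ioi]
    linarith
  have hterm (k : ℕ) (hk : k ≤ n) : f ((n - k : ℕ) : ℝ) = (if k ≤ n - 1 then f 1 else 0)
      + f₁ 1 * max ((n - 1 : ℝ) - k) 0 + ∫ s in (1 : ℝ)..n, f₂ s * max ((n - s : ℝ) - k) 0 := by
    rcases hk.eq_or_lt with rfl | hlt
    · rw [if_neg (by omega), Nat.sub_self, Nat.cast_zero, hf0, max_eq_right (by linarith),
        intervalIntegral.integral_congr (g := fun _ => 0)]
      · simp
      · intro s hs
        rw [uIcc_of_le hn1] at hs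
        simp only
        rw [max_eq_right (by linarith [hs.1]), mul_zero]
    · rw [if_pos (by omega), taylor_natCast h₁ h₂ h₃ (n := n) (by omega) (by omega),
        Nat.cast_sub hk]
      have e1 : (n : ℝ) - k - 1 = n - 1 - k := by ring
      have e2 (s : ℝ) : (n : ℝ) - k - s = n - s - k := by ring
      simp only [e1, e2]
  have hrefl : wsglConv α (fun k => f k) n
      = ∑ k ∈ Finset.range (n + 1), wsglWeight α k * f ((n - k : ℕ) : ℝ) := by
    rw [wsglConv, ← Finset.sum_range_reflect]
    refine Finset.sum_congr rfl fun k hk => ?_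
    have hk' := Finset.mem_range.1 hk
    rw [show n + 1 - 1 - k = n - k by omega, show n - (n - k) = k by omega]
  have hsumint : ∫ s in (1 : ℝ)..n, f₂ s *
        ∑ k ∈ Finset.range (n + 1), wsglWeight α k * max ((n - s : ℝ) - k) 0
      = ∑ k ∈ Finset.range (n + 1),
        wsglWeight α k * ∫ s in (1 : ℝ)..n, f₂ s * max ((n - s : ℝ) - k) 0 := by
    simp_rw [← intervalIntegral.integral_const_mul]
    rw [← intervalIntegral.integral_finsetSum fun k _ => (hint k).const_mul _]
    refine intervalIntegral.integral_congr fun s _ => ?_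
    simp only [Finset.mul_sum]
    exact Finset.sum_congr rfl fun k _ => by ring
  rw [hrefl, hsumint, wsglPartialSum,
    ← sum_range_ite_le (n := n) (p := n - 1) (by omega), Finset.mul_sum, Finset.mul_sum,
    ← Finset.sum_add_distrib, ← Finset.sum_add_distrib]
  refine Finset.sum_congr rfl fun k hk => ?_
  rw [hterm k (by have := Finset.mem_range.1 hk; omega)]
  split_ifs <;> ring

/-- Integration by parts on `[1, n]` only: on `[0, 1]` the second derivative need not be integrable.
Again `(1-α)/Γ(2-α)` includes `α = 1`. -/
theorem caputoOf_eq_peano {α σ M : ℝ} (hα : α ≤ 1) (hσ : 0 < σ) {f₁ f₂ f₃ : ℝ → ℝ}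
    (h₂ : ∀ x, 0 < x → HasDerivAt f₁ (f₂ x) x) (h₃ : ∀ x, 0 < x → HasDerivAt f₂ (f₃ x) x)
    {n : ℕ} (hn : 1 ≤ n) (hM : ∀ x ∈ Ioc (0 : ℝ) n, |f₁ x| ≤ M * x ^ (σ - 1)) :
    caputoOf α f₁ n
      = (1 - α) / Real.Gamma (2 - α) * (∫ s in (0 : ℝ)..1, (n - s : ℝ) ^ (-α) * f₁ s)
        + f₁ 1 * ((n - 1 : ℝ) ^ (1 - α) / Real.Gamma (2 - α))
        + ∫ s in (1 : ℝ)..n, f₂ s * ((n - s : ℝ) ^ (1 - α) / Real.Gamma (2 - α)) := by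
  have hn1 : (1 : ℝ) ≤ n := by exact_mod_cast hn
  have hc1 : ContinuousOn f₁ (Ioi 0) := fun x hx => (h₂ x hx).continuousAt.continuousWithinAt
  have hc2 : ContinuousOn f₂ (Ioi 0) := fun x hx => (h₃ x hx).continuousAt.continuousWithinAt
  have hsub : uIcc (1 : ℝ) n ⊆ Ioi 0 := by
    intro x hx
    rw [uIcc_of_le hn1] at hx
    simp only [mem_Ioi]
    linarith [hx.1]
  rcases hα.eq_or_lt with rfl | hlt
  · rw [caputoOf, if_pos rfl]
    have e : ∫ s in (1 : ℝ)..n, f₂ s = f₁ n - f₁ 1 :=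
      intervalIntegral.integral_eq_sub_of_hasDerivAt (fun x hx => h₂ x (hsub hx))
        (hc2.mono hsub).intervalIntegrable
    norm_num [e]
  · have hα1 : 0 < 1 - α := by linarith
    have hG1 := (Real.Gamma_pos_of_pos hα1).ne'
    have hG2 : Real.Gamma (2 - α) = (1 - α) * Real.Gamma (1 - α) := by
      rw [← Real.Gamma_add_one hα1.ne']; congr 1; ring
    have hint := intervalIntegrable_kernel_mul hlt hσ (by linarith) (hc1.mono fun x hx => hx.1) hM
    have hint1 : IntervalIntegrable (fun s => (n - s : ℝ) ^ (-α) * f₁ s) volume 0 1 :=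
      hint.mono_set (by
        rw [uIcc_of_le zero_le_one, uIcc_of_le (by linarith)]
        exact Icc_subset_Icc_right hn1)
    have hint2 : IntervalIntegrable (fun s => (n - s : ℝ) ^ (-α) * f₁ s) volume 1 n :=
      hint.mono_set (by
        rw [uIcc_of_le hn1, uIcc_of_le (by linarith)]
        exact Icc_subset_Icc_left zero_le_one)
    have hcr : Continuous fun s : ℝ => (n - s : ℝ) ^ (1 - α) := by
      have := Real.continuous_rpow_const hα1.le
      fun_prop
    have hint3 : IntervalIntegrable (fun s => f₂ s * ((n - s : ℝ) ^ (1 - α) / (1 - α)))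
        volume 1 n :=
      ((hc2.mono hsub).mul (hcr.continuousOn.div_const _)).intervalIntegrable
    have hibp : ∫ s in (1 : ℝ)..n,
        ((n - s : ℝ) ^ (-α) * f₁ s - f₂ s * ((n - s : ℝ) ^ (1 - α) / (1 - α)))
        = -((n - n : ℝ) ^ (1 - α) * f₁ n / (1 - α)) - -((n - 1 : ℝ) ^ (1 - α) * f₁ 1 / (1 - α)) := by
      refine intervalIntegral.integral_eq_sub_of_hasDerivAt_of_le
        (f := fun s : ℝ => -((n - s : ℝ) ^ (1 - α) * f₁ s / (1 - α))) hn1 ?_ ?_ (hint2.sub hint3)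
      · rw [← uIcc_of_le hn1]
        exact ((hcr.continuousOn.mul (hc1.mono hsub)).div_const _).neg
      · intro s hs
        have hns : (n : ℝ) - s ≠ 0 := by have := hs.2; linarith
        have hd := (Real.hasDerivAt_rpow_const (p := 1 - α) (Or.inl hns)).comp s
          ((hasDerivAt_id s).const_sub (n : ℝ))
        have hd2 := ((hd.mul (h₂ s (by linarith [hs.1]))).div_const (1 - α)).neg
        refine hd2.congr_deriv ?_
        simp only [Function.comp_apply]
        rw [show 1 - α - 1 = -α by ring]
        field_simp
        ring
    rw [intervalIntegral.integral_sub hint2 hint3, sub_self, Real.zero_rpow hα1.ne'] at hibp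
    rw [caputoOf, if_neg hlt.ne, ← intervalIntegral.integral_add_adjacent_intervals hint1 hint2]
    have e3 : ∫ s in (1 : ℝ)..n, f₂ s * ((n - s : ℝ) ^ (1 - α) / Real.Gamma (2 - α))
        = 1 / Real.Gamma (1 - α) * ∫ s in (1 : ℝ)..n, f₂ s * ((n - s : ℝ) ^ (1 - α) / (1 - α)) := by
      rw [← intervalIntegral.integral_const_mul]
      refine intervalIntegral.integral_congr fun s _ => ?_
      rw [hG2]
      field_simp
    rw [e3, eq_add_of_sub_eq hibp, hG2]
    field_simp
    ring

theorem wsglConv_sub_caputoOf {α σ M : ℝ} (hα : α ≤ 1) (hσ : 0 < σ) {f f₁ f₂ f₃ : ℝ → ℝ}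
    (hf0 : f 0 = 0) (h₁ : ∀ x, 0 < x → HasDerivAt f (f₁ x) x)
    (h₂ : ∀ x, 0 < x → HasDerivAt f₁ (f₂ x) x) (h₃ : ∀ x, 0 < x → HasDerivAt f₂ (f₃ x) x)
    {n : ℕ} (hn : 1 ≤ n) (hM : ∀ x ∈ Ioc (0 : ℝ) n, |f₁ x| ≤ M * x ^ (σ - 1)) :
    wsglConv α (fun k => f k) n - caputoOf α f₁ n
      = (f 1 * wsglPartialSum α (n - 1)
          - (1 - α) / Real.Gamma (2 - α) * (∫ s in (0 : ℝ)..1, (n - s : ℝ) ^ (-α) * f₁ s))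
        + f₁ 1 * peanoOne α n (n - 1) + ∫ s in (1 : ℝ)..n, f₂ s * peanoOne α n (n - s) := by
  have hn1 : (1 : ℝ) ≤ n := by exact_mod_cast hn
  have hc2 : ContinuousOn f₂ (uIcc (1 : ℝ) n) := by
    intro x hx
    rw [uIcc_of_le hn1] at hx
    exact (h₃ x (by linarith [hx.1])).continuousAt.continuousWithinAt
  have hi1 : IntervalIntegrable (fun s => f₂ s *
      ∑ k ∈ Finset.range (n + 1), wsglWeight α k * max ((n - s : ℝ) - k) 0) volume 1 n :=
    (hc2.mul (by fun_prop)).intervalIntegrable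
  have hi2 : IntervalIntegrable (fun s => f₂ s * ((n - s : ℝ) ^ (1 - α) / Real.Gamma (2 - α)))
      volume 1 n :=
    ((intervalIntegrable_sub_rpow (by linarith) (n : ℝ) 1 n).div_const _).continuousOn_mul hc2
  rw [wsglConv_eq_peano hf0 h₁ h₂ h₃ hn, caputoOf_eq_peano hα hσ h₂ h₃ hn hM]
  simp only [peanoOne, mul_sub]
  rw [intervalIntegral.integral_sub (by simpa only [mul_sub] using hi1) hi2]
  ring

/-! ### Estimates for the pieces of the truncation error -/

theorem abs_intervalIntegral_le {f g : ℝ → ℝ} {a b : ℝ} (hab : a ≤ b)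
    (h : ∀ s ∈ Ioc a b, |f s| ≤ g s) (hg : IntervalIntegrable g volume a b) :
    |∫ s in a..b, f s| ≤ ∫ s in a..b, g s :=
  intervalIntegral.norm_integral_le_of_norm_le (f := f) hab (Filter.Eventually.of_forall h) hg

theorem rpow_le_of_half_le {n s e : ℝ} (hn : 0 < n) (h1 : n / 2 ≤ s) (h2 : s ≤ n) (he : -3 ≤ e) :
    s ^ e ≤ 8 * n ^ e := by
  have hs : 0 < s := by linarith
  have hne : 0 < n ^ e := by positivity
  rcases le_total 0 e with h | h
  · have := Real.rpow_le_rpow hs.le h2 h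
    linarith
  · have h3 : s ^ e ≤ (n / 2) ^ e := Real.rpow_le_rpow_of_nonpos (by linarith) h1 h
    rw [Real.div_rpow hn.le (by norm_num), div_eq_mul_inv, ← Real.rpow_neg (by norm_num)] at h3
    have h4 : (2 : ℝ) ^ (-e) ≤ 2 ^ (3 : ℝ) :=
      Real.rpow_le_rpow_of_exponent_le (by norm_num) (by linarith)
    norm_num at h4
    nlinarith

/-- As `f 1` is the integral of `f₁` over the first cell, the difference is the integral of `f₁ s`
times the zeroth kernel at `n - s`. That kernel bound starts at index one, so `n = 1` is treated
directly. -/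
theorem exists_initial_cell_bound {α σ : ℝ} (h0 : 0 < α) (hα : α ≤ 1) (hσ : 0 < σ) :
    ∃ C : ℝ, 0 < C ∧ ∀ (f f₁ f₂ : ℝ → ℝ) (M : ℝ) (n : ℕ), 0 ≤ M → 1 ≤ n → f 0 = 0 →
      (∀ x, 0 < x → HasDerivAt f (f₁ x) x) → (∀ x, 0 < x → HasDerivAt f₁ (f₂ x) x) →
      (∀ x ∈ Ioc (0 : ℝ) n, |f x| ≤ M * x ^ σ) →
      (∀ x ∈ Ioc (0 : ℝ) n, |f₁ x| ≤ M * x ^ (σ - 1)) →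
      |f 1 * wsglPartialSum α (n - 1)
          - (1 - α) / Real.Gamma (2 - α) * (∫ s in (0 : ℝ)..1, (n - s : ℝ) ^ (-α) * f₁ s)|
        ≤ C * M * (n : ℝ) ^ (-(1 / 2) : ℝ) := by
  obtain ⟨C₀, hC₀, hK0⟩ := exists_peanoZero_bound h0 hα
  have hG := Real.Gamma_pos_of_pos (show 0 < 2 - α by linarith)
  have hα1 : 0 ≤ 1 - α := by linarith
  set G := Real.Gamma (2 - α) with hGdef
  set J := |∫ s in (0 : ℝ)..1, (1 - s) ^ (-α) * s ^ (σ - 1)| with hJ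
  refine ⟨2 + (1 - α) / G * J + 8 * C₀ / σ, by positivity, ?_⟩
  intro f f₁ f₂ M n hM hn hf0 h₁ h₂ hb0 hb1
  have hn1 : (1 : ℝ) ≤ n := by exact_mod_cast hn
  have hn0 : (0 : ℝ) < n := by linarith
  have hc1 : ContinuousOn f₁ (Ioi 0) := fun x hx => (h₂ x hx).continuousAt.continuousWithinAt
  have hp : 0 < (n : ℝ) ^ (-(1 / 2) : ℝ) := by positivity
  rcases hn.eq_or_lt with h | h
  · subst h
    have e1 : |f 1| ≤ M := by simpa using hb0 1 (by simp)
    have e2 : |(1 - α) * ∫ s in (0 : ℝ)..1, (((1 : ℕ) : ℝ) - s) ^ (-α) * f₁ s|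
        ≤ (1 - α) * (M * J) := by
      rcases hα.eq_or_lt with h' | hlt
      · rw [h']; simp
      rw [abs_mul, abs_of_nonneg hα1]
      refine mul_le_mul_of_nonneg_left ?_ hα1
      have hint := (intervalIntegrable_kernel_rpow hlt hσ one_pos).const_mul M
      have := abs_intervalIntegral_le zero_le_one
        (f := fun s => (((1 : ℕ) : ℝ) - s) ^ (-α) * f₁ s) (fun s hs => ?_) hint
      · rw [intervalIntegral.integral_const_mul] at this
        refine this.trans (mul_le_mul_of_nonneg_left (le_abs_self _) hM)
      · have h3 : 0 ≤ (1 - s) ^ (-α) := Real.rpow_nonneg (by linarith [hs.2]) _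
        have h4 := hb1 s (by simpa using hs)
        rw [Nat.cast_one, abs_mul, abs_of_nonneg h3]
        nlinarith
    have e3 : wsglPartialSum α (1 - 1) = 1 + α / 2 := by simp [wsglPartialSum_eq]
    rw [e3]
    refine (abs_sub _ _).trans ?_
    rw [div_mul_eq_mul_div, abs_div, abs_of_pos hG, abs_mul,
      abs_of_pos (show 0 < 1 + α / 2 by positivity)]
    have e4 : |f 1| * (1 + α / 2) ≤ M * 2 := by gcongr; linarith
    have e5 : |(1 - α) * ∫ s in (0 : ℝ)..1, (((1 : ℕ) : ℝ) - s) ^ (-α) * f₁ s| / G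
        ≤ (1 - α) * (M * J) / G := by gcongr
    have e6 : 0 ≤ 8 * C₀ / σ * M := by positivity
    have e7 : (1 - α) * (M * J) / G = (1 - α) / G * J * M := by ring
    rw [Nat.cast_one, Real.one_rpow, mul_one]
    rw [Nat.cast_one] at e5
    linarith
  · have hn2 : (2 : ℝ) ≤ n := by exact_mod_cast h
    have hf1int : IntervalIntegrable f₁ volume 0 1 := by
      refine ((intervalIntegral.intervalIntegrable_rpow' (r := σ - 1)
        (by linarith)).const_mul M).mono_fun' ?_ ?_
      · rw [uIoc_of_le zero_le_one]
        exact (hc1.mono fun x hx => hx.1).aestronglyMeasurable measurableSet_Ioc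
      · rw [uIoc_of_le zero_le_one]
        filter_upwards [ae_restrict_mem measurableSet_Ioc] with s hs
        exact hb1 s ⟨hs.1, hs.2.trans hn1⟩
    -- Continuity at `0` comes from `|f x| ≤ M x^σ`.
    have hfcont : ContinuousOn f (Icc 0 1) := by
      intro x hx
      rcases hx.1.eq_or_lt with h' | h'
      · subst h'
        have ht : Filter.Tendsto (fun x : ℝ => M * x ^ σ) (nhdsWithin 0 (Icc 0 1)) (nhds 0) := by
          have hc : ContinuousAt (fun x : ℝ => M * x ^ σ) 0 :=
            ((Real.continuous_rpow_const hσ.le).const_mul M).continuousAt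
          have h2 := hc.continuousWithinAt (s := Icc 0 1)
          unfold ContinuousWithinAt at h2
          simpa [Real.zero_rpow hσ.ne'] using h2
        unfold ContinuousWithinAt
        rw [hf0]
        refine squeeze_zero_norm' ?_ ht
        filter_upwards [self_mem_nhdsWithin] with y hy
        rcases hy.1.eq_or_lt with h'' | h''
        · rw [← h'', hf0]; simp [Real.zero_rpow hσ.ne']
        · exact hb0 y ⟨h'', hy.2.trans hn1⟩
      · exact (h₁ x h').continuousAt.continuousWithinAt
    have hf1 : f 1 = ∫ s in (0 : ℝ)..1, f₁ s := by
      rw [intervalIntegral.integral_eq_sub_of_hasDerivAt_of_le zero_le_one hfcont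
        (fun x hx => h₁ x hx.1) hf1int, hf0, sub_zero]
    have hkc : ContinuousOn (fun s : ℝ => (n - s : ℝ) ^ (-α)) (uIcc 0 1) := by
      refine ContinuousOn.rpow_const (by fun_prop) fun s hs => Or.inl ?_
      rw [uIcc_of_le zero_le_one] at hs
      have := hs.2
      linarith
    have hki : IntervalIntegrable (fun s => (n - s : ℝ) ^ (-α) * f₁ s) volume 0 1 :=
      hf1int.continuousOn_mul hkc
    rw [hf1, ← intervalIntegral.integral_mul_const, ← intervalIntegral.integral_const_mul,
      ← intervalIntegral.integral_sub (hf1int.mul_const _) (hki.const_mul _)]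
    set D := C₀ * ((n - 1 : ℕ) : ℝ) ^ (-α - 1) with hD
    have hint := (intervalIntegral.intervalIntegrable_rpow' (a := 0) (b := 1) (r := σ - 1)
      (by linarith)).const_mul (D * M)
    refine (abs_intervalIntegral_le zero_le_one (fun s hs => ?_) hint).trans ?_
    · have h3 := hK0 (n - 1) (n - s) (by omega) (by push_cast [Nat.cast_sub hn]; linarith [hs.2])
        (by push_cast [Nat.cast_sub hn]; linarith [hs.1])
      have h4 := hb1 s ⟨hs.1, hs.2.trans hn1⟩
      rw [show f₁ s * wsglPartialSum α (n - 1)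
        - (1 - α) / G * ((n - s : ℝ) ^ (-α) * f₁ s)
        = (wsglPartialSum α (n - 1) - (1 - α) * (n - s : ℝ) ^ (-α) / G) * f₁ s by ring, abs_mul,
        mul_assoc]
      exact mul_le_mul h3 h4 (abs_nonneg _) (by positivity)
    · rw [intervalIntegral.integral_const_mul, integral_rpow (Or.inl (by linarith))]
      have h5 : ((n - 1 : ℕ) : ℝ) ^ (-α - 1) ≤ 8 * (n : ℝ) ^ (-α - 1) := by
        refine rpow_le_of_half_le hn0 ?_ ?_ (by linarith) <;> push_cast [Nat.cast_sub hn] <;>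
          linarith
      have h6 : (n : ℝ) ^ (-α - 1) ≤ (n : ℝ) ^ (-(1 / 2) : ℝ) :=
        Real.rpow_le_rpow_of_exponent_le hn1 (by linarith)
      have h7 : D ≤ 8 * C₀ * (n : ℝ) ^ (-(1 / 2) : ℝ) := by
        rw [hD]
        calc C₀ * ((n - 1 : ℕ) : ℝ) ^ (-α - 1) ≤ C₀ * (8 * (n : ℝ) ^ (-(1 / 2) : ℝ)) := by
              gcongr; linarith
          _ = _ := by ring
      rw [sub_add_cancel, Real.one_rpow, Real.zero_rpow hσ.ne', sub_zero]
      have h8 : 0 ≤ (2 + (1 - α) / G * J) * M * (n : ℝ) ^ (-(1 / 2) : ℝ) := by positivity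
      calc D * M * (1 / σ) ≤ 8 * C₀ * (n : ℝ) ^ (-(1 / 2) : ℝ) * M * (1 / σ) := by gcongr
        _ = 8 * C₀ / σ * M * (n : ℝ) ^ (-(1 / 2) : ℝ) := by ring
        _ ≤ _ := by linarith

/-- Far from the endpoint `n` the first kernel is uniformly `O(n^(-α-1))`. -/
theorem exists_far_bound {α σ : ℝ} (h0 : 0 < α) (hα : α ≤ 1) :
    ∃ C : ℝ, 0 < C ∧ ∀ (f₂ : ℝ → ℝ) (M : ℝ) (n : ℕ), 0 ≤ M → 2 ≤ n →
      (∀ x ∈ Ioc (0 : ℝ) n, |f₂ x| ≤ M * x ^ (σ - 2)) →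
      |∫ s in (1 : ℝ)..(n / 2 : ℝ), f₂ s * peanoOne α n (n - s)|
        ≤ C * M * ((n : ℝ) ^ (σ - α - 2) + (n : ℝ) ^ (-(1 / 2) : ℝ)) := by
  obtain ⟨C, hC, hK⟩ := exists_peanoOne_bound h0 hα
  refine ⟨16 * C, by positivity, ?_⟩
  intro f₂ M n hM hn hb
  have hn2 : (2 : ℝ) ≤ n := by exact_mod_cast hn
  have hn0 : (0 : ℝ) < n := by linarith
  -- Splitting `s^(σ-2) ≤ n^γ s^(-1/2)` leaves an integrable power for every `σ` and avoids a
  -- logarithm at `σ = 1`.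
  set γ : ℝ := max 0 (σ - 3 / 2) with hγ
  set D : ℝ := M * (n : ℝ) ^ γ * (C * (8 * (n : ℝ) ^ (-α - 1))) with hD
  have hD0 : 0 ≤ D := by positivity
  have hint := (intervalIntegral.intervalIntegrable_rpow' (a := 1) (b := (n / 2 : ℝ))
    (r := -(1 / 2)) (by norm_num)).const_mul D
  refine (abs_intervalIntegral_le (by linarith) (fun s hs => ?_) hint).trans ?_
  · have hs1 : 1 < s := hs.1
    have hs2 : s ≤ n / 2 := hs.2
    have e1 := hb s ⟨by linarith, by linarith⟩
    have e2 := hK n (n - s) (by linarith) (by linarith)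
    have e3 : (1 + (n - s : ℝ)) ^ (-α - 1) ≤ 8 * (n : ℝ) ^ (-α - 1) :=
      rpow_le_of_half_le hn0 (by linarith) (by linarith) (by linarith)
    have e4 : s ^ (σ - 2) ≤ (n : ℝ) ^ γ * s ^ (-(1 / 2) : ℝ) := by
      have hs0 : 0 < s := by linarith
      calc s ^ (σ - 2) = s ^ (σ - 3 / 2) * s ^ (-(1 / 2) : ℝ) := by
            rw [← Real.rpow_add hs0]; congr 1; ring
        _ ≤ s ^ γ * s ^ (-(1 / 2) : ℝ) := by
            gcongr
            · exact hs1.le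
            · exact le_max_right _ _
        _ ≤ (n : ℝ) ^ γ * s ^ (-(1 / 2) : ℝ) := by
            have hsn : s ≤ n := by linarith
            have hγ0 : 0 ≤ γ := le_max_left _ _
            exact mul_le_mul_of_nonneg_right (Real.rpow_le_rpow hs0.le hsn hγ0) (by positivity)
    rw [abs_mul]
    calc |f₂ s| * |peanoOne α n (n - s)|
        ≤ (M * ((n : ℝ) ^ γ * s ^ (-(1 / 2) : ℝ))) * (C * (8 * (n : ℝ) ^ (-α - 1))) := by
          refine mul_le_mul (e1.trans ?_) (e2.trans ?_) (abs_nonneg _) ?_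
          · gcongr
          · gcongr
          · have : 0 < s := by linarith
            positivity
      _ = D * s ^ (-(1 / 2) : ℝ) := by rw [hD]; ring
  · rw [intervalIntegral.integral_const_mul, integral_rpow (Or.inl (by norm_num))]
    have e1 : ((n / 2 : ℝ) ^ (-(1 / 2) + 1 : ℝ) - 1 ^ (-(1 / 2) + 1 : ℝ)) / (-(1 / 2) + 1)
        ≤ 2 * (n : ℝ) ^ (1 / 2 : ℝ) := by
      norm_num
      have : (n / 2 : ℝ) ^ (1 / 2 : ℝ) ≤ (n : ℝ) ^ (1 / 2 : ℝ) :=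
        Real.rpow_le_rpow (by positivity) (by linarith) (by norm_num)
      linarith
    have e2 : (n : ℝ) ^ γ * (n : ℝ) ^ (-α - 1) * (n : ℝ) ^ (1 / 2 : ℝ)
        ≤ (n : ℝ) ^ (σ - α - 2) + (n : ℝ) ^ (-(1 / 2) : ℝ) := by
      rw [← Real.rpow_add hn0, ← Real.rpow_add hn0]
      rcases max_cases 0 (σ - 3 / 2) with ⟨h, _⟩ | ⟨h, _⟩
      · have : (n : ℝ) ^ (γ + (-α - 1) + 1 / 2) ≤ (n : ℝ) ^ (-(1 / 2) : ℝ) := by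
          refine Real.rpow_le_rpow_of_exponent_le (by linarith) ?_
          rw [hγ, h]; linarith
        have h2 : 0 < (n : ℝ) ^ (σ - α - 2) := by positivity
        linarith
      · have h1 : γ + (-α - 1) + 1 / 2 = σ - α - 2 := by rw [hγ, h]; ring
        rw [h1]
        have h2 : 0 < (n : ℝ) ^ (-(1 / 2) : ℝ) := by positivity
        linarith
    calc D * (((n / 2 : ℝ) ^ (-(1 / 2) + 1 : ℝ) - 1 ^ (-(1 / 2) + 1 : ℝ)) / (-(1 / 2) + 1))
        ≤ D * (2 * (n : ℝ) ^ (1 / 2 : ℝ)) := by gcongr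
      _ = 16 * C * M * ((n : ℝ) ^ γ * (n : ℝ) ^ (-α - 1) * (n : ℝ) ^ (1 / 2 : ℝ)) := by
          rw [hD]; ring
      _ ≤ _ := by gcongr

/-- Integrability of the first kernel alone would give only `n^(σ-2)`. Passing to the second kernel
by parts gains `n^(-α)`; its boundary term at `s = n` vanishes. -/
theorem exists_near_bound {α σ : ℝ} (h0 : 0 < α) (hα : α ≤ 1) (hσ : 0 < σ) :
    ∃ C : ℝ, 0 < C ∧ ∀ (f₂ f₃ : ℝ → ℝ) (M : ℝ) (n : ℕ), 0 ≤ M → 2 ≤ n →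
      (∀ x, 0 < x → HasDerivAt f₂ (f₃ x) x) → ContinuousOn f₃ (Ioi 0) →
      (∀ x ∈ Ioc (0 : ℝ) n, |f₂ x| ≤ M * x ^ (σ - 2)) →
      (∀ x ∈ Ioc (0 : ℝ) n, |f₃ x| ≤ M * x ^ (σ - 3)) →
      |∫ s in (n / 2 : ℝ)..n, f₂ s * peanoOne α n (n - s)|
        ≤ C * M * (n : ℝ) ^ (σ - α - 2) := by
  obtain ⟨C, hC, hK⟩ := exists_peanoTwo_bound h0 hα
  obtain ⟨C', hC', hI⟩ := exists_integral_abs_peanoTwo_le h0 hα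
  refine ⟨64 * C + 8 * C', by positivity, ?_⟩
  intro f₂ f₃ M n hM hn h₃ hc3 hb2 hb3
  have hn2 : (2 : ℝ) ≤ n := by exact_mod_cast hn
  have hn0 : (0 : ℝ) < n := by linarith
  have hle : (n / 2 : ℝ) ≤ n := by linarith
  have hsub : uIcc (n / 2 : ℝ) n ⊆ Ioi 0 := by
    intro x hx
    rw [uIcc_of_le hle] at hx
    simp only [mem_Ioi]
    linarith [hx.1]
  have hc2 : ContinuousOn f₂ (Ioi 0) := fun x hx => (h₃ x hx).continuousAt.continuousWithinAt
  have hcK : Continuous fun s : ℝ => peanoTwo α n (n - s) :=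
    (continuous_peanoTwo hα n).comp (by fun_prop)
  have hi1 : IntervalIntegrable (fun s => f₂ s * peanoOne α n (n - s)) volume (n / 2 : ℝ) n := by
    have := (intervalIntegrable_peanoOne hα n (n / 2 : ℝ) 0).comp_sub_left (n : ℝ)
    rw [sub_zero, show (n : ℝ) - n / 2 = n / 2 by ring] at this
    exact this.continuousOn_mul (hc2.mono hsub)
  have hi2 : IntervalIntegrable (fun s => f₃ s * peanoTwo α n (n - s)) volume (n / 2 : ℝ) n :=
    ((hc3.mono hsub).mul hcK.continuousOn).intervalIntegrable
  have hibp : ∫ s in (n / 2 : ℝ)..n,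
      (f₂ s * peanoOne α n (n - s) - f₃ s * peanoTwo α n (n - s))
      = -(f₂ n * peanoTwo α n (n - n)) - -(f₂ (n / 2) * peanoTwo α n (n - n / 2)) := by
    refine intervalIntegral.integral_eq_sub_of_hasDerivAt_of_le
      (f := fun s : ℝ => -(f₂ s * peanoTwo α n (n - s))) hle ?_ ?_ (hi1.sub hi2)
    · rw [← uIcc_of_le hle]
      exact ((hc2.mono hsub).mul hcK.continuousOn).neg
    · intro s hs
      have hs0 : 0 < s := by linarith [hs.1]
      have hd := (hasDerivAt_peanoTwo hα n (x := n - s) (by linarith [hs.2])).comp s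
        ((hasDerivAt_id s).const_sub (n : ℝ))
      refine ((h₃ s hs0).mul hd).neg.congr_deriv ?_
      simp only [Function.comp_apply]
      ring
  rw [intervalIntegral.integral_sub hi1 hi2, sub_self, peanoTwo_zero hα,
    show (n : ℝ) - n / 2 = n / 2 by ring] at hibp
  rw [eq_add_of_sub_eq hibp]
  have hpow : (n : ℝ) ^ (σ - 2) * (n : ℝ) ^ (-α) = (n : ℝ) ^ (σ - α - 2) := by
    rw [← Real.rpow_add hn0]; congr 1; ring
  have hpow2 : (n : ℝ) ^ (σ - 3) * (n : ℝ) ^ (1 - α) = (n : ℝ) ^ (σ - α - 2) := by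
    rw [← Real.rpow_add hn0]; congr 1; ring
  have b1 : |f₂ (n / 2) * peanoTwo α n (n / 2)| ≤ 64 * C * M * (n : ℝ) ^ (σ - α - 2) := by
    have e1 := hb2 (n / 2) ⟨by linarith, hle⟩
    have e2 : (n / 2 : ℝ) ^ (σ - 2) ≤ 8 * (n : ℝ) ^ (σ - 2) :=
      rpow_le_of_half_le hn0 le_rfl hle (by linarith)
    have e3 := hK n (n / 2) (by linarith) hle
    have e4 : (1 + n / 2 : ℝ) ^ (-α) ≤ 8 * (n : ℝ) ^ (-α) :=
      rpow_le_of_half_le hn0 (by linarith) (by linarith) (by linarith)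
    rw [abs_mul]
    calc |f₂ (n / 2)| * |peanoTwo α n (n / 2)|
        ≤ (M * (8 * (n : ℝ) ^ (σ - 2))) * (C * (8 * (n : ℝ) ^ (-α))) := by
          refine mul_le_mul (e1.trans ?_) (e3.trans ?_) (abs_nonneg _) (by positivity)
          · gcongr
          · gcongr
      _ = 64 * C * M * ((n : ℝ) ^ (σ - 2) * (n : ℝ) ^ (-α)) := by ring
      _ = _ := by rw [hpow]
  have b2 : |∫ s in (n / 2 : ℝ)..n, f₃ s * peanoTwo α n (n - s)|
      ≤ 8 * C' * M * (n : ℝ) ^ (σ - α - 2) := by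
    have hint : IntervalIntegrable
        (fun s => M * (8 * (n : ℝ) ^ (σ - 3)) * |peanoTwo α n (n - s)|) volume (n / 2 : ℝ) n :=
      Continuous.intervalIntegrable (by fun_prop) _ _
    refine (abs_intervalIntegral_le hle (fun s hs => ?_) hint).trans ?_
    · have hs1 : (n / 2 : ℝ) < s := hs.1
      have e1 := hb3 s ⟨by linarith, hs.2⟩
      have e2 : s ^ (σ - 3) ≤ 8 * (n : ℝ) ^ (σ - 3) :=
        rpow_le_of_half_le hn0 hs1.le hs.2 (by linarith)
      rw [abs_mul]
      refine mul_le_mul_of_nonneg_right (e1.trans ?_) (abs_nonneg _)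
      gcongr
    · rw [intervalIntegral.integral_const_mul,
        intervalIntegral.integral_comp_sub_left (fun x => |peanoTwo α n x|) (n : ℝ), sub_self,
        show (n : ℝ) - n / 2 = n / 2 by ring]
      have e1 := hI n (n / 2) (by linarith) hle
      have e2 : (n / 2 : ℝ) ^ (1 - α) ≤ (n : ℝ) ^ (1 - α) :=
        Real.rpow_le_rpow (by positivity) hle (by linarith)
      calc M * (8 * (n : ℝ) ^ (σ - 3)) * ∫ x in (0 : ℝ)..(n / 2 : ℝ), |peanoTwo α n x|
          ≤ M * (8 * (n : ℝ) ^ (σ - 3)) * (C' * (n : ℝ) ^ (1 - α)) := by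
            gcongr
            exact e1.trans (by gcongr)
        _ = 8 * C' * M * ((n : ℝ) ^ (σ - 3) * (n : ℝ) ^ (1 - α)) := by ring
        _ = _ := by rw [hpow2]
  have b3 : -(f₂ n * 0) - -(f₂ (n / 2) * peanoTwo α n (n / 2))
      = f₂ (n / 2) * peanoTwo α n (n / 2) := by ring
  rw [b3]
  refine (abs_add_le _ _).trans ?_
  calc _ ≤ 64 * C * M * (n : ℝ) ^ (σ - α - 2) + 8 * C' * M * (n : ℝ) ^ (σ - α - 2) :=
        add_le_add b1 b2
    _ = _ := by ring

/-- The truncation error of the WSGL formula on functions with a power-type singularity. -/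
theorem exists_truncation_bound {α σ : ℝ} (h0 : 0 < α) (hα : α ≤ 1) (hσ : 0 < σ) :
    ∃ C : ℝ, 0 < C ∧ ∀ (f f₁ f₂ f₃ : ℝ → ℝ) (M : ℝ) (n : ℕ), 0 ≤ M → 1 ≤ n → f 0 = 0 →
      (∀ x, 0 < x → HasDerivAt f (f₁ x) x) → (∀ x, 0 < x → HasDerivAt f₁ (f₂ x) x) →
      (∀ x, 0 < x → HasDerivAt f₂ (f₃ x) x) → ContinuousOn f₃ (Ioi 0) →
      (∀ x ∈ Ioc (0 : ℝ) n, |f x| ≤ M * x ^ σ) →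
      (∀ x ∈ Ioc (0 : ℝ) n, |f₁ x| ≤ M * x ^ (σ - 1)) →
      (∀ x ∈ Ioc (0 : ℝ) n, |f₂ x| ≤ M * x ^ (σ - 2)) →
      (∀ x ∈ Ioc (0 : ℝ) n, |f₃ x| ≤ M * x ^ (σ - 3)) →
      |wsglConv α (fun k => f k) n - caputoOf α f₁ n|
        ≤ C * M * ((n : ℝ) ^ (σ - α - 2) + (n : ℝ) ^ (-(1 / 2) : ℝ)) := by
  obtain ⟨C₁, hC₁, hB₁⟩ := exists_initial_cell_bound h0 hα hσ
  obtain ⟨C₂, hC₂, hB₂⟩ := exists_peanoOne_bound h0 hα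
  obtain ⟨C₃, hC₃, hB₃⟩ := exists_far_bound (σ := σ) h0 hα
  obtain ⟨C₄, hC₄, hB₄⟩ := exists_near_bound h0 hα hσ
  refine ⟨C₁ + C₂ + C₃ + C₄, by positivity, ?_⟩
  intro f f₁ f₂ f₃ M n hM hn hf0 h₁ h₂ h₃ hc3 hb0 hb1 hb2 hb3
  have hn1 : (1 : ℝ) ≤ n := by exact_mod_cast hn
  have hn0 : (0 : ℝ) < n := by linarith
  set A := (n : ℝ) ^ (σ - α - 2) with hA
  set B := (n : ℝ) ^ (-(1 / 2) : ℝ) with hB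
  have hA0 : 0 < A := by positivity
  have hB0 : 0 < B := by positivity
  rw [wsglConv_sub_caputoOf hα hσ hf0 h₁ h₂ h₃ hn hb1]
  have t1 := hB₁ f f₁ f₂ M n hM hn hf0 h₁ h₂ hb0 hb1
  have t2 : |f₁ 1 * peanoOne α n (n - 1)| ≤ C₂ * M * B := by
    have e1 := hb1 1 ⟨one_pos, hn1⟩
    rw [Real.one_rpow, mul_one] at e1
    have e2 := hB₂ n (n - 1) (by linarith) (by linarith)
    rw [add_sub_cancel] at e2
    have e3 : (n : ℝ) ^ (-α - 1) ≤ B := Real.rpow_le_rpow_of_exponent_le hn1 (by linarith)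
    rw [abs_mul]
    calc |f₁ 1| * |peanoOne α n (n - 1)| ≤ M * (C₂ * B) := by
          refine mul_le_mul e1 (e2.trans ?_) (abs_nonneg _) hM
          gcongr
      _ = _ := by ring
  have t3 : |∫ s in (1 : ℝ)..n, f₂ s * peanoOne α n (n - s)| ≤ (C₃ + C₄) * M * (A + B) := by
    rcases hn.eq_or_lt with h | h
    · rw [← h]
      simp only [Nat.cast_one, intervalIntegral.integral_same, abs_zero]
      positivity
    have hn2 : (2 : ℝ) ≤ n := by exact_mod_cast h
    have hint (a b : ℝ) (ha : 0 < a) (hab : a ≤ b) :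
        IntervalIntegrable (fun s => f₂ s * peanoOne α n (n - s)) volume a b := by
      have := (intervalIntegrable_peanoOne hα n (n - a) (n - b)).comp_sub_left (n : ℝ)
      rw [sub_sub_cancel, sub_sub_cancel] at this
      refine this.continuousOn_mul fun x hx => ?_
      rw [uIcc_of_le hab] at hx
      exact (h₃ x (by linarith [hx.1])).continuousAt.continuousWithinAt
    rw [← intervalIntegral.integral_add_adjacent_intervals (hint 1 (n / 2) one_pos (by linarith))
      (hint (n / 2) n (by linarith) (by linarith))]
    refine (abs_add_le _ _).trans ?_
    have e1 := hB₃ f₂ M n hM h hb2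
    have e2 := hB₄ f₂ f₃ M n hM h h₃ hc3 hb2 hb3
    have e3 : C₄ * M * A ≤ C₄ * M * (A + B) := by gcongr; linarith
    calc _ ≤ C₃ * M * (A + B) + C₄ * M * (A + B) := add_le_add e1 (e2.trans e3)
      _ = _ := by ring
  have e1 : 0 ≤ C₁ * M * A := by positivity
  have e2 : 0 ≤ C₂ * M * A := by positivity
  refine (abs_add_le _ _).trans ((add_le_add (abs_add_le _ _) le_rfl).trans ?_)
  calc _ ≤ C₁ * M * B + C₂ * M * B + (C₃ + C₄) * M * (A + B) := add_le_add (add_le_add t1 t2) t3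
    _ ≤ _ := by linarith

/-! ### Generalized power series -/

/-- The sum of the generalized power series `∑ a k * t ^ p k`. -/
def genSum (a p : ℕ → ℝ) (t : ℝ) : ℝ := ∑' k, a k * t ^ p k

/-- Absolute convergence of `∑ a k * t ^ p k` for `0 < t < S`. -/
def GenSummable (a p : ℕ → ℝ) (S : ℝ) : Prop :=
  ∀ R, 0 < R → R < S → Summable fun k => |a k| * R ^ p k

theorem GenSummable.summable {a p : ℕ → ℝ} {S R : ℝ} (h : GenSummable a p S) (h0 : 0 < R)
    (h1 : R < S) : Summable fun k => a k * R ^ p k := by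
  refine Summable.of_abs ((h R h0 h1).congr fun k => ?_)
  rw [abs_mul, abs_of_pos (Real.rpow_pos_of_pos h0 _)]

/-- Termwise differentiation multiplies coefficients by their exponents; a slightly larger radius
absorbs this factor. Without a lower bound on the exponents it would fail. -/
theorem exists_abs_le_mul_rpow {r : ℝ} (hr : 1 < r) (P : ℝ) :
    ∃ C : ℝ, 0 < C ∧ ∀ p, P ≤ p → |p| ≤ C * r ^ p := by
  have hr0 : 0 < r := by linarith
  have hl : 0 < Real.log r := Real.log_pos hr
  refine ⟨1 / Real.log r + |P| * r ^ |P|, by positivity, fun p hp => ?_⟩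
  have hrp : 0 < r ^ p := by positivity
  have h1 : 0 ≤ 1 / Real.log r * r ^ p := by positivity
  have h2 : 0 ≤ |P| * r ^ |P| * r ^ p := by positivity
  rw [add_mul]
  rcases le_total 0 p with h | h
  · have h3 : Real.log r * p ≤ r ^ p := by
      rw [Real.rpow_def_of_pos hr0]
      have := Real.add_one_le_exp (Real.log r * p)
      linarith
    have h4 : p ≤ 1 / Real.log r * r ^ p := by
      rw [one_div_mul_eq_div, le_div_iff₀ hl]; linarith
    rw [abs_of_nonneg h]
    linarith
  · have h3 : |p| ≤ |P| := by
      rw [abs_of_nonpos h, abs_of_nonpos (hp.trans h)]; linarith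
    have h4 : 1 ≤ r ^ |P| * r ^ p := by
      rw [← Real.rpow_add hr0]
      refine Real.one_le_rpow hr.le ?_
      rw [abs_of_nonpos h] at h3
      linarith
    have h5 : |P| * 1 ≤ |P| * (r ^ |P| * r ^ p) := by gcongr
    linarith

theorem GenSummable.deriv {a p : ℕ → ℝ} {S P : ℝ} (hp : ∀ k, P ≤ p k) (h : GenSummable a p S) :
    GenSummable (fun k => a k * p k) (fun k => p k - 1) S := by
  intro R h0 h1
  obtain ⟨R', hR1, hR2⟩ := exists_between h1
  have hR0 : 0 < R' := h0.trans hR1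
  obtain ⟨C, hC, hCp⟩ := exists_abs_le_mul_rpow ((one_lt_div h0).2 hR1) P
  refine Summable.of_nonneg_of_le (fun k => by positivity) (fun k => ?_)
    ((h R' hR0 hR2).mul_left (C * R⁻¹))
  have h2 := hCp (p k) (hp k)
  rw [Real.div_rpow hR0.le h0.le] at h2
  have h3 : 0 < R ^ p k := by positivity
  rw [abs_mul, Real.rpow_sub_one h0.ne']
  calc |a k| * |p k| * (R ^ p k / R) ≤ |a k| * (C * (R' ^ p k / R ^ p k)) * (R ^ p k / R) := by
        gcongr
    _ = C * R⁻¹ * (|a k| * R' ^ p k) := by field_simp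

theorem GenSummable.hasDerivAt {a p : ℕ → ℝ} {S P t : ℝ} (hp : ∀ k, P ≤ p k)
    (h : GenSummable a p S) (ht : 0 < t) (htS : t < S) :
    HasDerivAt (genSum a p) (genSum (fun k => a k * p k) (fun k => p k - 1) t) t := by
  obtain ⟨R, hR1, hR2⟩ := exists_between htS
  have hd := h.deriv hp
  have hR0 : 0 < R := ht.trans hR1
  -- The exponents `p k - 1` may have either sign, so the majorant uses both ends of the interval.
  have hu : Summable fun k => |a k * p k| * (t / 2) ^ (p k - 1) + |a k * p k| * R ^ (p k - 1) :=
    (hd (t / 2) (by linarith) (by linarith)).add (hd R hR0 hR2)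
  have hg : ∀ k, ∀ y ∈ Ioo (t / 2) R,
      HasDerivAt (fun x => a k * x ^ p k) (a k * p k * y ^ (p k - 1)) y := by
    intro k y hy
    have hy0 : 0 < y := by have := hy.1; linarith
    have := (Real.hasDerivAt_rpow_const (p := p k) (Or.inl hy0.ne')).const_mul (a k)
    rwa [← mul_assoc] at this
  have hb : ∀ k, ∀ y ∈ Ioo (t / 2) R, ‖a k * p k * y ^ (p k - 1)‖
      ≤ |a k * p k| * (t / 2) ^ (p k - 1) + |a k * p k| * R ^ (p k - 1) := by
    intro k y hy
    have hy0 : 0 < y := by have := hy.1; linarith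
    rw [Real.norm_eq_abs, abs_mul (a k * p k), abs_of_pos (Real.rpow_pos_of_pos hy0 _), ← mul_add]
    refine mul_le_mul_of_nonneg_left ?_ (abs_nonneg _)
    rcases le_total 0 (p k - 1) with h' | h'
    · have := Real.rpow_le_rpow hy0.le hy.2.le h'
      have h2 : 0 < (t / 2) ^ (p k - 1) := by positivity
      linarith
    · have := Real.rpow_le_rpow_of_nonpos (by linarith) hy.1.le h'
      have h2 : 0 < R ^ (p k - 1) := by positivity
      linarith
  have htm : t ∈ Ioo (t / 2) R := ⟨by linarith, hR1⟩
  exact hasDerivAt_tsum_of_isPreconnected (g := fun k x => a k * x ^ p k)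
    (g' := fun k x => a k * p k * x ^ (p k - 1)) hu isOpen_Ioo
    isPreconnected_Ioo hg hb htm (h.summable ht htS) htm

theorem GenSummable.continuousOn {a p : ℕ → ℝ} {S P : ℝ} (hp : ∀ k, P ≤ p k)
    (h : GenSummable a p S) : ContinuousOn (genSum a p) (Ioo 0 S) :=
  fun _ ht => (h.hasDerivAt hp ht.1 ht.2).continuousAt.continuousWithinAt

theorem GenSummable.abs_genSum_le {a p : ℕ → ℝ} {S P T t : ℝ} (hp : ∀ k, P ≤ p k)
    (h : GenSummable a p S) (ht : 0 < t) (htT : t ≤ T) (hTS : T < S) :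
    |genSum a p t| ≤ (∑' k, |a k| * T ^ (p k - P)) * t ^ P := by
  have hT : 0 < T := ht.trans_le htT
  have hs : Summable fun k => |a k| * T ^ (p k - P) := by
    refine ((h T hT hTS).mul_right (T ^ (-P))).congr fun k => ?_
    rw [mul_assoc, ← Real.rpow_add hT]; rfl
  have ha : Summable fun k => |a k * t ^ p k| := (h.summable ht (htT.trans_lt hTS)).abs
  have h1 : |∑' k, a k * t ^ p k| ≤ ∑' k, |a k * t ^ p k| :=
    norm_tsum_le_tsum_norm (f := fun k => a k * t ^ p k) ha
  rw [genSum, ← tsum_mul_right]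
  refine h1.trans (ha.tsum_le_tsum (fun k => ?_) (hs.mul_right _))
  rw [abs_mul, abs_of_pos (Real.rpow_pos_of_pos ht _), mul_assoc]
  refine mul_le_mul_of_nonneg_left ?_ (abs_nonneg _)
  have h1 : t ^ p k = t ^ (p k - P) * t ^ P := by rw [← Real.rpow_add ht]; congr 1; ring
  rw [h1]
  refine mul_le_mul_of_nonneg_right ?_ (by positivity)
  exact Real.rpow_le_rpow ht.le htT (sub_nonneg.2 (hp k))

/-- Termwise Caputo differentiation of a generalized power series. -/
theorem GenSummable.hasSum_caputoOf {a p : ℕ → ℝ} {S P t α : ℝ} (hP : 0 < P) (hp : ∀ k, P ≤ p k)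
    (h : GenSummable a p S) (ht : 0 < t) (htS : t < S) (hα : α ≤ 1) :
    HasSum (fun k => a k * (Real.Gamma (p k + 1) / Real.Gamma (p k + 1 - α) * t ^ (p k - α)))
      (caputoOf α (genSum (fun k => a k * p k) fun k => p k - 1) t) := by
  have hd := h.deriv hp
  have hpk (k : ℕ) : 0 < p k := hP.trans_le (hp k)
  rcases hα.eq_or_lt with rfl | hlt
  · rw [caputoOf, if_pos rfl]
    have e : (fun k => a k * (Real.Gamma (p k + 1) / Real.Gamma (p k + 1 - 1) * t ^ (p k - 1)))
        = fun k => a k * p k * t ^ (p k - 1) := by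
      funext k
      have hG := (Real.Gamma_pos_of_pos (hpk k)).ne'
      rw [Real.Gamma_add_one (hpk k).ne', show p k + 1 - 1 = p k by ring]
      field_simp
    rw [e]
    exact (hd.summable ht htS).hasSum
  · rw [caputoOf, if_neg hlt.ne]
    have hG1 := (Real.Gamma_pos_of_pos (show 0 < 1 - α by linarith)).ne'
    let F : ℕ → ℝ → ℝ := fun k s => (t - s) ^ (-α) * (a k * p k * s ^ (p k - 1))
    have hF (k : ℕ) (s : ℝ) : F k s = a k * p k * ((t - s) ^ (-α) * s ^ (p k - 1)) := by
      simp only [F]; ring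
    have hFint (k : ℕ) : IntervalIntegrable (F k) volume 0 t := by
      rw [show F k = fun s => a k * p k * ((t - s) ^ (-α) * s ^ (p k - 1)) from funext (hF k)]
      exact (intervalIntegrable_kernel_rpow hlt (hpk k) ht).const_mul _
    have hFval (k : ℕ) : 1 / Real.Gamma (1 - α) * ∫ s in (0 : ℝ)..t, F k s
        = a k * (Real.Gamma (p k + 1) / Real.Gamma (p k + 1 - α) * t ^ (p k - α)) := by
      simp only [hF]
      rw [intervalIntegral.integral_const_mul, integral_kernel_rpow hlt (hpk k) ht,
        Real.Gamma_add_one (hpk k).ne']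
      field_simp
    set J := ∫ s in (0 : ℝ)..t, (t - s) ^ (-α) * s ^ (P - 1) with hJ
    -- Bounding `s^(p k - P)` by its value at `t` reduces all terms to the single integral `J`.
    have hsum : Summable fun k => ∫ s in Ioc 0 t, ‖F k s‖ := by
      refine Summable.of_nonneg_of_le (fun k => by positivity) (fun k => ?_)
        ((hd t ht htS).mul_right (t ^ (1 - P) * J))
      have e1 : ∀ s ∈ Ioc 0 t, ‖F k s‖
          ≤ |a k * p k| * t ^ (p k - P) * ((t - s) ^ (-α) * s ^ (P - 1)) := by
        intro s hs
        have h0 := hs.1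
        have h1 : 0 ≤ (t - s) ^ (-α) := Real.rpow_nonneg (by linarith [hs.2]) _
        have h2 : s ^ (p k - 1) = s ^ (p k - P) * s ^ (P - 1) := by
          rw [← Real.rpow_add h0]; congr 1; ring
        have h3 : s ^ (p k - P) ≤ t ^ (p k - P) :=
          Real.rpow_le_rpow h0.le hs.2 (sub_nonneg.2 (hp k))
        have h4 : 0 ≤ (t - s) ^ (-α) * s ^ (p k - 1) := mul_nonneg h1 (by positivity)
        rw [hF, Real.norm_eq_abs, abs_mul (a k * p k), abs_of_nonneg h4, mul_assoc, h2,
          mul_left_comm ((t - s) ^ (-α))]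
        refine mul_le_mul_of_nonneg_left ?_ (abs_nonneg _)
        exact mul_le_mul_of_nonneg_right h3 (mul_nonneg h1 (by positivity))
      have e2 : ∫ s in Ioc 0 t, |a k * p k| * t ^ (p k - P) * ((t - s) ^ (-α) * s ^ (P - 1))
          = |a k * p k| * t ^ (p k - 1) * (t ^ (1 - P) * J) := by
        rw [integral_const_mul, hJ, intervalIntegral.integral_of_le ht.le,
          show p k - P = (p k - 1) + (1 - P) by ring, Real.rpow_add ht]
        ring
      rw [← e2]
      refine setIntegral_mono_on ((intervalIntegrable_iff_integrableOn_Ioc_of_le ht.le).1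
        (hFint k)).norm ?_ measurableSet_Ioc e1
      exact ((intervalIntegrable_iff_integrableOn_Ioc_of_le ht.le).1
        (intervalIntegrable_kernel_rpow hlt hP ht)).const_mul _
    have key := (hasSum_integral_of_summable_integral_norm (fun k =>
      (intervalIntegrable_iff_integrableOn_Ioc_of_le ht.le).1 (hFint k)) hsum).mul_left
      (1 / Real.Gamma (1 - α))
    simp only [← intervalIntegral.integral_of_le ht.le, hFval] at key
    have e3 (s : ℝ) : ∑' k, F k s
        = (t - s) ^ (-α) * genSum (fun k => a k * p k) (fun k => p k - 1) s := by
      rw [genSum, ← tsum_mul_left]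
    simp only [e3] at key
    exact key

/-! ### The equation for the coefficients of the solution -/

/-- The derivative within `[0, t]` agrees with the termwise one except possibly at `0`, which the
integral does not see. -/
theorem GenSummable.caputoDeriv_eq {a p : ℕ → ℝ} {S P t α Y₀ : ℝ} {Y : ℝ → ℝ}
    (hp : ∀ k, P ≤ p k) (h : GenSummable a p S) (ht : 0 < t) (htS : t < S) (h0 : 0 < α)
    (hα : α ≤ 1) (hY : ∀ s ∈ Icc 0 t, Y s = Y₀ + genSum a p s) :
    caputoDeriv α Y t = caputoOf α (genSum (fun k => a k * p k) fun k => p k - 1) t := by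
  have hceil : ⌈α⌉₊ = 1 := (Nat.ceil_eq_iff one_ne_zero).2 ⟨by simpa using h0, by simpa using hα⟩
  have hd : ∀ s ∈ Ioc 0 t, iteratedDerivWithin 1 Y (Icc 0 t) s
      = genSum (fun k => a k * p k) (fun k => p k - 1) s := by
    intro s hs
    have hs' : s ∈ Icc 0 t := ⟨hs.1.le, hs.2⟩
    rw [iteratedDerivWithin_one]
    refine HasDerivWithinAt.derivWithin ?_ (uniqueDiffOn_Icc ht s hs')
    have h1 := ((h.hasDerivAt hp hs.1 (hs.2.trans_lt htS)).const_add Y₀).hasDerivWithinAt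
      (s := Icc 0 t)
    exact h1.congr hY (hY s hs')
  rw [caputoDeriv, caputoOf, hceil, Nat.cast_one]
  refine if_congr Iff.rfl (hd t ⟨ht, le_rfl⟩) ?_
  congr 1
  rw [intervalIntegral.integral_of_le ht.le, intervalIntegral.integral_of_le ht.le]
  refine setIntegral_congr_fun measurableSet_Ioc fun s hs => ?_
  rw [hd s hs, show 1 - α - 1 = -α by ring]

/-- A generalized power series with well-founded support that vanishes identically near `0` has
vanishing coefficients. -/
theorem eq_zero_of_hasSum_mul_rpow {A : ℝ → ℝ} {T : ℝ} (hT : 0 < T)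
    (hA : (Function.support A).IsPWO) (h : ∀ t ∈ Ioo 0 T, HasSum (fun ρ => A ρ * t ^ ρ) 0) :
    A = 0 := by
  by_contra hne
  have hns : (Function.support A).Nonempty := Function.support_nonempty_iff.2 hne
  set μ := hA.isWF.min hns with hμ
  have hμA : A μ ≠ 0 := hA.isWF.min_mem hns
  have hmin : ∀ ρ, A ρ ≠ 0 → μ ≤ ρ := fun ρ hρ => hA.isWF.min_le hns hρ
  have h2 : T / 2 ∈ Ioo 0 T := ⟨by linarith, by linarith⟩
  have hpos : ∀ᶠ t : ℝ in nhdsWithin 0 (Ioi 0), t ∈ Ioo 0 (T / 2) :=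
    Ioo_mem_nhdsGT h2.1
  have hshift : ∀ t, 0 < t → ∀ ρ, A ρ * t ^ (ρ - μ) = A ρ * t ^ ρ * t ^ (-μ) := by
    intro t ht ρ
    rw [sub_eq_add_neg, Real.rpow_add ht, mul_assoc]
  -- After division by `t^μ`, with `μ` the least exponent, only the term at `μ` survives as `t → 0`.
  -- Absolute convergence at `T/2` dominates.
  have hlim : Filter.Tendsto (fun t : ℝ => ∑' ρ, A ρ * t ^ (ρ - μ)) (nhdsWithin 0 (Ioi 0))
      (nhds (∑' ρ, if ρ = μ then A μ else 0)) := by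
    refine tendsto_tsum_of_dominated_convergence (bound := fun ρ => |A ρ| * (T / 2) ^ (ρ - μ))
      ?_ (fun ρ => ?_) ?_
    · refine (((h _ h2).summable.abs).mul_right ((T / 2) ^ (-μ))).congr fun ρ => ?_
      rw [abs_mul, abs_of_pos (Real.rpow_pos_of_pos h2.1 _), sub_eq_add_neg, Real.rpow_add h2.1,
        mul_assoc]
    · rcases eq_or_ne (A ρ) 0 with h0 | h0
      · have : (if ρ = μ then A μ else 0) = 0 := by
          rw [if_neg]; rintro rfl; exact hμA h0
        simp only [h0, zero_mul, this]
        exact tendsto_const_nhds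
      rcases (hmin ρ h0).eq_or_lt with h1 | h1
      · simp only [← h1, sub_self, Real.rpow_zero, mul_one, if_true]
        exact tendsto_const_nhds
      · rw [if_neg h1.ne']
        have h3 : 0 < ρ - μ := sub_pos.2 h1
        have h4 : Filter.Tendsto (fun t : ℝ => t ^ (ρ - μ)) (nhds 0) (nhds 0) := by
          have := (Real.continuousAt_rpow_const 0 (ρ - μ) (Or.inr h3.le)).tendsto
          rwa [Real.zero_rpow h3.ne'] at this
        have := (h4.mono_left nhdsWithin_le_nhds).const_mul (A ρ) (f := fun t : ℝ => t ^ (ρ - μ))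
          (x := nhdsWithin 0 (Ioi 0))
        rwa [mul_zero] at this
    · filter_upwards [hpos] with t ht ρ
      rw [Real.norm_eq_abs, abs_mul, abs_of_pos (Real.rpow_pos_of_pos ht.1 _)]
      rcases eq_or_ne (A ρ) 0 with h0 | h0
      · simp [h0]
      · exact mul_le_mul_of_nonneg_left
          (Real.rpow_le_rpow ht.1.le ht.2.le (sub_nonneg.2 (hmin ρ h0))) (abs_nonneg _)
  rw [tsum_ite_eq] at hlim
  have hz : (fun t : ℝ => ∑' ρ, A ρ * t ^ (ρ - μ)) =ᶠ[nhdsWithin 0 (Ioi 0)] fun _ => 0 := by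
    filter_upwards [hpos] with t ht
    simp only [hshift t ht.1, tsum_mul_right]
    rw [(h t ⟨ht.1, by linarith [ht.2]⟩).tsum_eq, zero_mul]
  exact hμA (tendsto_nhds_unique hlim (tendsto_const_nhds.congr' hz.symm))

/-- Shifting the exponents does not increase partial sums over an increasing sequence of
exponents. -/
theorem sum_shift_le {p : ℕ → ℝ} (hp : StrictMono p) {e : ℝ → ℝ} (he : ∀ x, 0 ≤ e x)
    (hsupp : ∀ x, e x ≠ 0 → x ∈ range p) {δ : ℝ} (hδ : 0 ≤ δ) (n : ℕ) :
    ∑ k ∈ Finset.range n, e (p k - δ) ≤ ∑ k ∈ Finset.range n, e (p k) := by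
  classical
  have hinj : Function.Injective fun k => p k - δ := fun i j hij => hp.injective (by
    simpa using hij)
  rw [← Finset.sum_image (f := e) (g := fun k => p k - δ) hinj.injOn,
    ← Finset.sum_image (f := e) (g := p) hp.injective.injOn,
    ← Finset.sum_filter_ne_zero ((Finset.range n).image fun k => p k - δ)]
  refine Finset.sum_le_sum_of_subset_of_nonneg (fun x hx => ?_) fun x _ _ => he x
  obtain ⟨h1, h2⟩ := Finset.mem_filter.1 hx
  obtain ⟨k, hk, rfl⟩ := Finset.mem_image.1 h1
  obtain ⟨i, hi⟩ := hsupp _ h2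
  refine Finset.mem_image.2 ⟨i, ?_, hi⟩
  -- A shifted exponent that is again in the sequence has an index no larger than the original one.
  have h3 : p i ≤ p k := by rw [hi]; linarith
  exact Finset.mem_range.2 ((hp.le_iff_le.1 h3).trans_lt (Finset.mem_range.1 hk))

/-- Geometric growth of sequences controlled by their own backward shifts. -/
theorem exists_summable_mul_rpow_neg {ι : Type*} (I : Finset ι) (w δ : ι → ℝ)
    (hw : ∀ i ∈ I, 0 ≤ w i) (hδ : ∀ i ∈ I, 0 < δ i) {p : ℕ → ℝ} (hp : StrictMono p)
    (hp0 : ∀ k, 0 < p k) {D : ℝ → ℝ} (hD : ∀ x, D x ≠ 0 → x ∈ range p) {b : ℝ} (hb : 0 < b)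
    {g : ℕ → ℝ} (hg0 : ∀ k, 0 ≤ g k) (hg : Summable g)
    (h : ∀ k, b * |D (p k)| ≤ ∑ i ∈ I, w i * |D (p k - δ i)| + g k) :
    ∃ s : ℝ, 0 < s ∧ Summable fun k => |D (p k)| * s ^ (-p k) := by
  have hlim : Filter.Tendsto (fun s : ℝ => ∑ i ∈ I, w i * s ^ (-δ i)) Filter.atTop (nhds 0) := by
    have := tendsto_finsetSum I fun i hi =>
      (tendsto_rpow_neg_atTop (hδ i hi)).const_mul (w i)
    simpa using this
  -- `s` is so large that all shifts together weigh at most `b/2`; half of the left-hand side then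
  -- survives and bounds the partial sums.
  obtain ⟨s, hs1, hs⟩ := ((Filter.eventually_ge_atTop (1 : ℝ)).and
    (hlim.eventually_le_const (half_pos hb))).exists
  have hs0 : 0 < s := by linarith
  refine ⟨s, hs0, ?_⟩
  let e : ℝ → ℝ := fun x => |D x| * s ^ (-x)
  have he : ∀ x, 0 ≤ e x := fun x => by positivity
  have hsupp : ∀ x, e x ≠ 0 → x ∈ range p := fun x hx => hD x fun h0 => hx (by simp [e, h0])
  refine summable_of_sum_range_le (c := 2 / b * ∑' k, g k) (fun k => he _) fun n => ?_
  change ∑ k ∈ Finset.range n, e (p k) ≤ _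
  set S := ∑ k ∈ Finset.range n, e (p k) with hS
  have hS0 : 0 ≤ S := Finset.sum_nonneg fun k _ => he _
  have h1 : ∀ k, b * e (p k) ≤ ∑ i ∈ I, w i * s ^ (-δ i) * e (p k - δ i) + g k := by
    intro k
    have hsk : 0 < s ^ (-p k) := by positivity
    have hsk1 : s ^ (-p k) ≤ 1 :=
      Real.rpow_le_one_of_one_le_of_nonpos hs1 (by linarith [hp0 k])
    calc b * e (p k) = b * |D (p k)| * s ^ (-p k) := by simp only [e]; ring
      _ ≤ (∑ i ∈ I, w i * |D (p k - δ i)| + g k) * s ^ (-p k) := by gcongr; exact h k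
      _ = ∑ i ∈ I, w i * s ^ (-δ i) * e (p k - δ i) + g k * s ^ (-p k) := by
        rw [add_mul, Finset.sum_mul]
        congr 1
        refine Finset.sum_congr rfl fun i _ => ?_
        have : s ^ (-p k) = s ^ (-δ i) * s ^ (-(p k - δ i)) := by
          rw [← Real.rpow_add hs0]; congr 1; ring
        simp only [e]
        rw [this]; ring
      _ ≤ _ := by
        gcongr
        exact mul_le_of_le_one_right (hg0 k) hsk1
  have h2 : b * S ≤ (∑ i ∈ I, w i * s ^ (-δ i)) * S + ∑' k, g k := by
    calc b * S = ∑ k ∈ Finset.range n, b * e (p k) := by rw [hS, Finset.mul_sum]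
      _ ≤ ∑ k ∈ Finset.range n, (∑ i ∈ I, w i * s ^ (-δ i) * e (p k - δ i) + g k) :=
        Finset.sum_le_sum fun k _ => h1 k
      _ = ∑ i ∈ I, w i * s ^ (-δ i) * ∑ k ∈ Finset.range n, e (p k - δ i)
          + ∑ k ∈ Finset.range n, g k := by
        rw [Finset.sum_add_distrib, Finset.sum_comm]
        simp only [Finset.mul_sum]
      _ ≤ ∑ i ∈ I, w i * s ^ (-δ i) * S + ∑' k, g k := by
        refine add_le_add (Finset.sum_le_sum fun i hi => ?_)
          (hg.sum_le_tsum _ fun k _ => hg0 k)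
        exact mul_le_mul_of_nonneg_left (sum_shift_le hp he hsupp (hδ i hi).le n)
          (mul_nonneg (hw i hi) (by positivity))
      _ = _ := by rw [Finset.sum_mul]
  have h3 : (∑ i ∈ I, w i * s ^ (-δ i)) * S ≤ b / 2 * S := by gcongr
  rw [div_mul_eq_mul_div, le_div_iff₀ hb]
  linarith

/-- Restrict the Gamma integral to `x > X` and bound `x^r` below by `X^r` there. Thus division by
`Γ` beats any geometric growth. -/
theorem rpow_le_exp_mul_Gamma {X r : ℝ} (hX : 0 < X) (hr : 0 ≤ r) :
    X ^ r ≤ Real.exp X * Real.Gamma (r + 1) := by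
  have hr1 : 0 < r + 1 := by linarith
  have hint := Real.GammaIntegral_convergent hr1
  have h1 : ∫ x in Ioi X, X ^ r * Real.exp (-x) ≤ Real.Gamma (r + 1) := by
    rw [Real.Gamma_eq_integral hr1]
    calc ∫ x in Ioi X, X ^ r * Real.exp (-x)
        ≤ ∫ x in Ioi X, Real.exp (-x) * x ^ (r + 1 - 1) := by
          refine setIntegral_mono_on ?_ (hint.mono_set (Ioi_subset_Ioi hX.le)) measurableSet_Ioi ?_
          · exact (integrableOn_exp_neg_Ioi X).const_mul _
          · intro x hx
            rw [add_sub_cancel_right, mul_comm]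
            gcongr
            exact hx.le
      _ ≤ _ := by
          refine setIntegral_mono_set hint ?_ (Ioi_subset_Ioi hX.le).eventuallyLE
          refine (ae_restrict_iff' measurableSet_Ioi).2 (Filter.Eventually.of_forall fun x hx => ?_)
          exact mul_nonneg (Real.exp_pos _).le (Real.rpow_nonneg (le_of_lt hx) _)
  rw [integral_const_mul, integral_exp_neg_Ioi] at h1
  calc X ^ r = Real.exp X * (X ^ r * Real.exp (-X)) := by
        rw [mul_left_comm, ← Real.exp_add, add_neg_cancel, Real.exp_zero, mul_one]
    _ ≤ _ := by gcongr

/-- Indexing by the real exponent, with coefficients extended by zero, lets series of different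
orders `β` be added term by term. -/
theorem hasSum_extend {d p : ℕ → ℝ} (hp : Function.Injective p) {β t v : ℝ}
    (h : HasSum (fun k => d k / Real.Gamma (p k + 1 - β) * t ^ (p k - β)) v) :
    HasSum (fun ρ => Function.extend p d 0 (ρ + β) / Real.Gamma (ρ + 1) * t ^ ρ) v := by
  have hinj : Function.Injective fun k => p k - β := fun i j hij => hp (by simpa using hij)
  have e : ((fun ρ => Function.extend p d 0 (ρ + β) / Real.Gamma (ρ + 1) * t ^ ρ) ∘
      fun k => p k - β) = fun k => d k / Real.Gamma (p k + 1 - β) * t ^ (p k - β) := by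
    funext k
    simp only [Function.comp]
    rw [sub_add_cancel, hp.extend_apply, sub_add_eq_add_sub]
  refine (hinj.hasSum_iff fun x hx => ?_).1 (e ▸ h)
  rw [Function.extend_apply' _ _ _ fun ⟨k, hk⟩ => hx ⟨k, by simp [hk]⟩]
  simp

/-- The relation between the coefficients of a solution, obtained by comparing the generalized
power series of both sides of the equation. -/
theorem IsSolution.coeff_relation {Q : ℕ} {ν α : Fin Q → ℝ} (hα0 : ∀ j, 0 < α j)
    (hα1 : ∀ j, α j ≤ 1) {T Y₀ : ℝ} (hT : 0 < T) {Y : ℝ → ℝ}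
    (hY : IsSolution ν α (fun _ y => -y) T Y₀ Y) {a p : ℕ → ℝ} (hp : StrictMono p)
    (hp0 : 0 < p 0) (hexp : ∀ t ∈ Icc 0 T, HasSum (fun k => a k * t ^ p k) (Y t - Y 0))
    {ρ : ℝ} (hρ : -1 < ρ) :
    ∑ j, ν j * Function.extend p (fun k => a k * Real.Gamma (p k + 1)) 0 (ρ + α j)
      + Function.extend p (fun k => a k * Real.Gamma (p k + 1)) 0 ρ
      + (if ρ = 0 then Y₀ else 0) = 0 := by
  set D := Function.extend p (fun k => a k * Real.Gamma (p k + 1)) 0 with hD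
  have hpk (k : ℕ) : p 0 ≤ p k := hp.monotone k.zero_le
  have hpk0 (k : ℕ) : 0 < p k := hp0.trans_le (hpk k)
  have hgen : GenSummable a p T := by
    intro R h0 h1
    refine ((hexp R ⟨h0.le, h1.le⟩).summable.abs).congr fun k => ?_
    rw [abs_mul, abs_of_pos (Real.rpow_pos_of_pos h0 _)]
  have hval : ∀ t ∈ Icc 0 T, Y t = Y₀ + genSum a p t := by
    intro t ht
    have := (hexp t ht).tsum_eq
    rw [hY.initial] at this
    rw [genSum, this]; ring
  let A : ℝ → ℝ := fun ρ => (∑ j, ν j * D (ρ + α j) + D ρ + (if ρ = 0 then Y₀ else 0))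
    / Real.Gamma (ρ + 1)
  have hsum : ∀ t ∈ Ioo 0 T, HasSum (fun ρ => A ρ * t ^ ρ) 0 := by
    intro t ht
    have h1 (j : Fin Q) : HasSum (fun ρ => ν j * (D (ρ + α j) / Real.Gamma (ρ + 1) * t ^ ρ))
        (ν j * caputoDeriv (α j) Y t) := by
      rw [hgen.caputoDeriv_eq hpk ht.1 ht.2 (hα0 j) (hα1 j) fun s hs =>
        hval s ⟨hs.1, hs.2.trans ht.2.le⟩]
      refine HasSum.mul_left _ (hasSum_extend hp.injective ?_)
      have := hgen.hasSum_caputoOf hp0 hpk ht.1 ht.2 (hα1 j)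
      have e : (fun k => a k * Real.Gamma (p k + 1) / Real.Gamma (p k + 1 - α j)
          * t ^ (p k - α j)) = fun k => a k * (Real.Gamma (p k + 1)
            / Real.Gamma (p k + 1 - α j) * t ^ (p k - α j)) := by
        funext k; ring
      rw [e]; exact this
    have h2 : HasSum (fun ρ => D ρ / Real.Gamma (ρ + 1) * t ^ ρ) (Y t - Y 0) := by
      have e : (fun k => a k * Real.Gamma (p k + 1) / Real.Gamma (p k + 1 - 0) * t ^ (p k - 0))
          = fun k => a k * t ^ p k := by
        funext k
        have := (Real.Gamma_pos_of_pos (show 0 < p k + 1 by linarith [hpk0 k])).ne'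
        rw [sub_zero, sub_zero]; field_simp
      have := hasSum_extend (d := fun k => a k * Real.Gamma (p k + 1)) (β := 0) (t := t)
        hp.injective (v := Y t - Y 0) (by rw [e]; exact hexp t ⟨ht.1.le, ht.2.le⟩)
      simpa only [add_zero] using this
    have h3 : HasSum (fun ρ : ℝ => if ρ = 0 then Y₀ else 0) Y₀ := hasSum_ite_eq 0 Y₀
    have h4 := ((hasSum_sum fun j (_ : j ∈ Finset.univ) => h1 j).add h2).add h3
    rw [hY.eqn t ⟨ht.1, ht.2.le⟩, hY.initial, show -Y t + (Y t - Y₀) + Y₀ = 0 by ring] at h4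
    have e : (fun ρ => A ρ * t ^ ρ) = fun ρ =>
        ∑ j, ν j * (D (ρ + α j) / Real.Gamma (ρ + 1) * t ^ ρ)
          + D ρ / Real.Gamma (ρ + 1) * t ^ ρ + if ρ = 0 then Y₀ else 0 := by
      funext ρ
      have h5 : (if ρ = 0 then Y₀ else 0) / Real.Gamma (ρ + 1) * t ^ ρ
          = if ρ = 0 then Y₀ else 0 := by
        split_ifs with h
        · simp [h]
        · simp
      rw [← h5]
      simp only [A, add_div, add_mul, Finset.sum_div, Finset.sum_mul]
      congr 2
      exact Finset.sum_congr rfl fun j _ => by ring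
    rw [e]; exact h4
  have hrange : (range p).IsPWO := by
    rw [← image_univ]
    exact (isPWO_of_wellQuasiOrderedLE univ).image_of_monotone hp.monotone
  have hDr : ∀ x, D x ≠ 0 → x ∈ range p := by
    intro x hx
    by_contra h
    exact hx (Function.extend_apply' _ _ _ h)
  -- The exponents lie in finitely many shifts of an increasing sequence together with `0`, which
  -- suffices for a least exponent.
  have hPWO : (Function.support A).IsPWO := by
    refine IsPWO.mono (t := ((⋃ j ∈ Finset.univ, (fun x => x - α j) '' range p) ∪ range p) ∪ {0})
      (((Finset.isPWO_bUnion _).2 fun j _ => hrange.image_of_monotone fun x y h => by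
        simpa using h).union hrange |>.union (isPWO_singleton _)) ?_
    intro ρ hρ
    by_contra hn
    simp only [mem_union, not_or, mem_iUnion, not_exists, mem_singleton_iff] at hn
    obtain ⟨⟨n1, n2⟩, n3⟩ := hn
    refine hρ ?_
    have z1 (j : Fin Q) : D (ρ + α j) = 0 := by
      by_contra h
      exact n1 j (Finset.mem_univ j) ⟨ρ + α j, hDr _ h, by simp⟩
    have z2 : D ρ = 0 := by
      by_contra h
      exact n2 (hDr _ h)
    simp [A, z1, z2, n3]
  have hA : A ρ = 0 := congrFun (eq_zero_of_hasSum_mul_rpow hT hPWO hsum) ρ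
  have hG : Real.Gamma (ρ + 1) ≠ 0 := (Real.Gamma_pos_of_pos (by linarith)).ne'
  exact (div_eq_zero_iff.1 hA).resolve_right hG

/-- The expansion of a solution converges for all positive times. -/
theorem IsSolution.genSummable {Q : ℕ} [NeZero Q] {ν α : Fin Q → ℝ} (hν₁ : 0 < ν 0)
    (hν : ∀ j, 0 ≤ ν j) (hα0 : ∀ j, 0 < α j) (hα_anti : Antitone α) (hα1 : α 0 ≤ 1)
    {T Y₀ : ℝ} (hT : 0 < T) {Y : ℝ → ℝ}
    (hY : IsSolution ν α (fun _ y => -y) T Y₀ Y) {a p : ℕ → ℝ} (hp : StrictMono p)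
    (hp0 : 0 < p 0) (hexp : ∀ t ∈ Icc 0 T, HasSum (fun k => a k * t ^ p k) (Y t - Y 0)) (S : ℝ) :
    GenSummable a p S := by
  classical
  have hle (j : Fin Q) : α j ≤ α 0 := hα_anti (Fin.zero_le j)
  have hpk (k : ℕ) : 0 < p k := hp0.trans_le (hp.monotone k.zero_le)
  set D := Function.extend p (fun k => a k * Real.Gamma (p k + 1)) 0 with hD
  have hDr : ∀ x, D x ≠ 0 → x ∈ range p := by
    intro x hx
    by_contra h
    exact hx (Function.extend_apply' _ _ _ h)
  -- At `ρ = p k - α 0` the top-order terms combine to `b D(p k)`. The lower orders shift back by `α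
  -- 0 - α j`, and `none` stands for the term `-Y`, with shift `α 0`.
  let J := Finset.univ.filter fun j => α j < α 0
  let b := ∑ j ∈ Finset.univ.filter (fun j => ¬ α j < α 0), ν j
  have hb : 0 < b := hν₁.trans_le
    (Finset.single_le_sum (f := ν) (fun j _ => hν j) (by simp))
  obtain ⟨s, hs0, hs⟩ := exists_summable_mul_rpow_neg (Finset.insertNone J)
    (fun i => i.elim 1 ν) (fun i => i.elim (α 0) fun j => α 0 - α j)
    (by
      intro i _
      cases i with
      | none => exact zero_le_one
      | some j => exact hν j)
    (by
      intro i hi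
      cases i with
      | none => exact hα0 0
      | some j => simpa [J] using hi)
    hp hpk hDr hb (g := fun k => if p k = α 0 then |Y₀| else 0)
    (fun k => by split_ifs <;> positivity)
    (summable_of_hasFiniteSupport <| (Set.Subsingleton.finite fun i hi j hj => by
        have h1 : p i = α 0 := by by_contra h; exact hi (if_neg h)
        have h2 : p j = α 0 := by by_contra h; exact hj (if_neg h)
        exact hp.injective (h1.trans h2.symm)))
    (by
      intro k
      have h1 := hY.coeff_relation hα0 (fun j => (hle j).trans hα1) hT hp hp0 hexp
        (ρ := p k - α 0) (by linarith [hpk k])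
      rw [← hD, ← Finset.sum_filter_add_sum_filter_not Finset.univ (fun j => α j < α 0)] at h1
      have h2 : ∑ j ∈ Finset.univ.filter (fun j => ¬ α j < α 0), ν j * D (p k - α 0 + α j)
          = b * D (p k) := by
        rw [Finset.sum_mul]
        refine Finset.sum_congr rfl fun j hj => ?_
        have : α j = α 0 := le_antisymm (hle j) (not_lt.1 (Finset.mem_filter.1 hj).2)
        rw [this, sub_add_cancel]
      rw [h2] at h1
      have h3 : b * D (p k) = -(∑ j ∈ J, ν j * D (p k - (α 0 - α j)) + D (p k - α 0)
          + if p k = α 0 then Y₀ else 0) := by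
        have e1 : (if p k - α 0 = 0 then Y₀ else 0) = if p k = α 0 then Y₀ else 0 := by
          simp only [sub_eq_zero]
        have e2 : ∑ j ∈ J, ν j * D (p k - (α 0 - α j)) = ∑ j ∈ J, ν j * D (p k - α 0 + α j) :=
          Finset.sum_congr rfl fun j _ => by rw [sub_add]
        rw [e1] at h1
        rw [e2]
        linarith
      rw [← abs_of_pos hb, ← abs_mul, h3, abs_neg, Finset.sum_insertNone]
      have h4 : |∑ j ∈ J, ν j * D (p k - (α 0 - α j))|
          ≤ ∑ j ∈ J, ν j * |D (p k - (α 0 - α j))| := by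
        refine (Finset.abs_sum_le_sum_abs _ _).trans_eq (Finset.sum_congr rfl fun j _ => ?_)
        rw [abs_mul, abs_of_nonneg (hν j)]
      have h5 : |if p k = α 0 then Y₀ else 0| = if p k = α 0 then |Y₀| else 0 := by
        split_ifs <;> simp
      refine (abs_add_three _ _ _).trans ?_
      rw [h5]
      simp only [Option.elim_none, Option.elim_some, one_mul]
      linarith)
  intro R hR _
  refine Summable.of_nonneg_of_le (fun k => by positivity) (fun k => ?_)
    (hs.mul_left (Real.exp (R * s)))
  have h1 := rpow_le_exp_mul_Gamma (mul_pos hR hs0) (hpk k).le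
  have hG := Real.Gamma_pos_of_pos (show 0 < p k + 1 by linarith [hpk k])
  have h2 : D (p k) = a k * Real.Gamma (p k + 1) := hp.injective.extend_apply _ _ _
  rw [h2, abs_mul, abs_of_pos hG]
  -- The power of `R s` is paid for by the Gamma factor, for any radius `R`.
  have h3 : R ^ p k = (R * s) ^ p k * s ^ (-p k) := by
    rw [Real.mul_rpow hR.le hs0.le, mul_assoc, ← Real.rpow_add hs0, add_neg_cancel,
      Real.rpow_zero, mul_one]
  rw [h3]
  calc |a k| * ((R * s) ^ p k * s ^ (-p k))
      ≤ |a k| * (Real.exp (R * s) * Real.Gamma (p k + 1) * s ^ (-p k)) := by gcongr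
    _ = _ := by ring

/-! ### Consistency of the corrected scheme -/

/-- Reduces step size `τ` to the unit grid of the Peano analysis. -/
theorem caputoOf_comp_mul {α τ t : ℝ} (f : ℝ → ℝ) (hτ : 0 < τ) (ht : 0 ≤ t) :
    caputoOf α (fun s => τ * f (τ * s)) t = τ ^ α * caputoOf α f (τ * t) := by
  by_cases hα : α = 1
  · simp [caputoOf, hα]
  rw [caputoOf, caputoOf, if_neg hα, if_neg hα, mul_left_comm]
  congr 1
  have h := intervalIntegral.integral_comp_mul_left
    (fun y => (τ * t - y) ^ (-α) * f y) hτ.ne' (a := 0) (b := t)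
  rw [mul_zero, smul_eq_mul, eq_inv_mul_iff_mul_eq₀ hτ.ne'] at h
  rw [← h, ← mul_assoc, ← intervalIntegral.integral_const_mul,
    intervalIntegral.integral_of_le ht, intervalIntegral.integral_of_le ht]
  refine setIntegral_congr_fun measurableSet_Ioc fun s hs => ?_
  rw [← mul_sub, Real.mul_rpow hτ.le (sub_nonneg.2 hs.2), Real.rpow_neg hτ.le]
  field_simp

theorem genSum_zero {a p : ℕ → ℝ} (hp : ∀ k, 0 < p k) : genSum a p 0 = 0 := by
  simp [genSum, Real.zero_rpow (hp _).ne']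

/-- Truncation error of the uncorrected formula for generalized power series. -/
theorem exists_genSum_truncation_bound {α P T : ℝ} (h0 : 0 < α) (hα : α ≤ 1) (hP : 0 < P)
    (hT : 0 < T) {a p : ℕ → ℝ} (hp : ∀ k, P ≤ p k) (h : ∀ S, GenSummable a p S) :
    ∃ C : ℝ, 0 < C ∧ ∀ (τ : ℝ) (n : ℕ), 0 < τ → 1 ≤ n → n * τ ≤ T →
      |1 / τ ^ α * wsglConv α (fun k => genSum a p (k * τ)) n
          - caputoOf α (genSum (fun k => a k * p k) fun k => p k - 1) (n * τ)|
        ≤ C * τ ^ (P - α) * ((n : ℝ) ^ (P - α - 2) + (n : ℝ) ^ (-(1 / 2) : ℝ)) := by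
  obtain ⟨C, hC, hB⟩ := exists_truncation_bound h0 hα hP
  have hp1 : ∀ k, P - 1 ≤ p k - 1 := fun k => by linarith [hp k]
  have hp2 : ∀ k, P - 2 ≤ p k - 1 - 1 := fun k => by linarith [hp k]
  have hp3 : ∀ k, P - 3 ≤ p k - 1 - 1 - 1 := fun k => by linarith [hp k]
  set a₁ := fun k => a k * p k with ha1
  set a₂ := fun k => a₁ k * (p k - 1) with ha2
  set a₃ := fun k => a₂ k * (p k - 1 - 1) with ha3
  set p₁ := fun k => p k - 1 with hpd1
  set p₂ := fun k => p k - 1 - 1 with hpd2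
  set p₃ := fun k => p k - 1 - 1 - 1 with hpd3
  have g1 (S : ℝ) : GenSummable a₁ p₁ S := (h S).deriv hp
  have g2 (S : ℝ) : GenSummable a₂ p₂ S := (g1 S).deriv hp1
  have g3 (S : ℝ) : GenSummable a₃ p₃ S := (g2 S).deriv hp2
  have hTS : T < T + 1 := by linarith
  set B₀ := ∑' k, |a k| * T ^ (p k - P) with hB0
  set B₁ := ∑' k, |a₁ k| * T ^ (p₁ k - (P - 1)) with hB1
  set B₂ := ∑' k, |a₂ k| * T ^ (p₂ k - (P - 2)) with hB2
  set B₃ := ∑' k, |a₃ k| * T ^ (p₃ k - (P - 3)) with hB3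
  have b0 : 0 ≤ B₀ := tsum_nonneg fun k => by positivity
  have b1 : 0 ≤ B₁ := tsum_nonneg fun k => by positivity
  have b2 : 0 ≤ B₂ := tsum_nonneg fun k => by positivity
  have b3 : 0 ≤ B₃ := tsum_nonneg fun k => by positivity
  refine ⟨C * (1 + B₀ + B₁ + B₂ + B₃), by positivity, fun τ n hτ hn hnT => ?_⟩
  have hder {u v : ℝ → ℝ} (huv : ∀ t, 0 < t → HasDerivAt u (v t) t) (c : ℝ) (x : ℝ) (hx : 0 < x) :
      HasDerivAt (fun x => c * u (τ * x)) (c * τ * v (τ * x)) x := by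
    have e1 : HasDerivAt (fun x => τ * x) τ x := by
      simpa using (hasDerivAt_id x).const_mul τ
    have := ((huv (τ * x) (by positivity)).comp x e1).const_mul c
    rw [show c * τ * v (τ * x) = c * (v (τ * x) * τ) by ring]
    exact this
  have hd0 : ∀ t, 0 < t → HasDerivAt (genSum a p) (genSum a₁ p₁ t) t :=
    fun t ht => (h (t + 1)).hasDerivAt hp ht (by linarith)
  have hd1 : ∀ t, 0 < t → HasDerivAt (genSum a₁ p₁) (genSum a₂ p₂ t) t :=
    fun t ht => (g1 (t + 1)).hasDerivAt hp1 ht (by linarith)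
  have hd2 : ∀ t, 0 < t → HasDerivAt (genSum a₂ p₂) (genSum a₃ p₃ t) t :=
    fun t ht => (g2 (t + 1)).hasDerivAt hp2 ht (by linarith)
  -- Each chain-rule factor `τ` compensates the drop of the exponent by one, so all derivatives
  -- carry the same `τ^P`.
  have hbd {u : ℝ → ℝ} {b e c : ℝ} (hb : 0 ≤ b) (hb' : b ≤ 1 + B₀ + B₁ + B₂ + B₃)
      (hc : 0 < c) (hce : c * τ ^ e = τ ^ P)
      (hu : ∀ t, 0 < t → t ≤ T → |u t| ≤ b * t ^ e) :
      ∀ x ∈ Ioc (0 : ℝ) n, |c * u (τ * x)| ≤ (1 + B₀ + B₁ + B₂ + B₃) * τ ^ P * x ^ e := by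
    intro x hx
    have hx0 := hx.1
    have := hu (τ * x) (by positivity) (by
      refine le_trans ?_ hnT
      rw [mul_comm]; gcongr; exact hx.2)
    rw [abs_mul, abs_of_pos hc]
    calc c * |u (τ * x)| ≤ c * (b * (τ * x) ^ e) := by gcongr
      _ = b * (c * τ ^ e) * x ^ e := by rw [Real.mul_rpow hτ.le hx0.le]; ring
      _ ≤ _ := by rw [hce]; gcongr
  have key := hB (fun x => 1 * genSum a p (τ * x)) (fun x => 1 * τ * genSum a₁ p₁ (τ * x))
    (fun x => 1 * τ * τ * genSum a₂ p₂ (τ * x)) (fun x => 1 * τ * τ * τ * genSum a₃ p₃ (τ * x))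
    ((1 + B₀ + B₁ + B₂ + B₃) * τ ^ P) n (by positivity) hn
    (by rw [mul_zero, genSum_zero fun k => hP.trans_le (hp k), mul_zero])
    (hder hd0 1) (hder hd1 _) (hder hd2 _)
    (by
      refine continuousOn_const.mul (ContinuousOn.comp (g := genSum a₃ p₃) (f := fun x => τ * x)
        (t := Ioi 0) (fun t ht => ?_)
        (by fun_prop) fun x hx => mul_pos hτ hx)
      exact ((g3 (t + 1)).hasDerivAt hp3 ht (by linarith)).continuousAt.continuousWithinAt)
    (hbd b0 (by linarith) one_pos (one_mul _)
      fun t ht htT => (h (T + 1)).abs_genSum_le hp ht htT hTS)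
    (hbd b1 (by linarith) (by positivity) (by
        rw [Real.rpow_sub_one hτ.ne']; field_simp)
      fun t ht htT => (g1 (T + 1)).abs_genSum_le hp1 ht htT hTS)
    (hbd b2 (by linarith) (by positivity) (by
        rw [show P - 2 = P - 1 - 1 by ring, Real.rpow_sub_one hτ.ne', Real.rpow_sub_one hτ.ne']
        field_simp)
      fun t ht htT => (g2 (T + 1)).abs_genSum_le hp2 ht htT hTS)
    (hbd b3 (by linarith) (by positivity) (by
        rw [show P - 3 = P - 1 - 1 - 1 by ring, Real.rpow_sub_one hτ.ne',
          Real.rpow_sub_one hτ.ne', Real.rpow_sub_one hτ.ne']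
        field_simp)
      fun t ht htT => (g3 (T + 1)).abs_genSum_le hp3 ht htT hTS)
  simp only [one_mul] at key
  rw [caputoOf_comp_mul _ hτ n.cast_nonneg] at key
  have hτα : 0 < τ ^ α := by positivity
  have e1 : 1 / τ ^ α * wsglConv α (fun k => genSum a p (k * τ)) n
      - caputoOf α (genSum a₁ p₁) (n * τ)
      = 1 / τ ^ α * (wsglConv α (fun k => genSum a p (τ * k)) n
        - τ ^ α * caputoOf α (genSum a₁ p₁) (τ * n)) := by
    rw [mul_sub, ← mul_assoc, one_div_mul_cancel hτα.ne', one_mul, mul_comm (n : ℝ) τ]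
    simp only [mul_comm τ]
  rw [e1, abs_mul, abs_of_pos (by positivity : 0 < 1 / τ ^ α), Real.rpow_sub hτ]
  calc _ ≤ 1 / τ ^ α * (C * ((1 + B₀ + B₁ + B₂ + B₃) * τ ^ P)
        * ((n : ℝ) ^ (P - α - 2) + (n : ℝ) ^ (-(1 / 2) : ℝ))) := by gcongr
    _ = _ := by ring

/-- Up to sign, the right-hand side is the unit-step truncation error of the uncorrected formula on
`t^(σ_r)`. -/
theorem exists_abs_startingRhs_le {α s : ℝ} (h0 : 0 < α) (hα : α ≤ 1) {σ : ℕ → ℝ} {m : ℕ}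
    (hσ : ∀ r : Fin m, 0 < σ (r + 1)) (hs : ∀ r : Fin m, σ (r + 1) ≤ s) :
    ∃ C : ℝ, 0 < C ∧ ∀ n, 1 ≤ n → ∀ r, |startingRhs α σ m n r|
      ≤ C * ((n : ℝ) ^ (s - α - 2) + (n : ℝ) ^ (-(1 / 2) : ℝ)) := by
  have h1 (r : Fin m) : ∃ C : ℝ, 0 < C ∧ ∀ n, 1 ≤ n → |startingRhs α σ m n r|
      ≤ C * ((n : ℝ) ^ (s - α - 2) + (n : ℝ) ^ (-(1 / 2) : ℝ)) := by
    obtain ⟨C, hC, hB⟩ := exists_truncation_bound h0 hα (hσ r)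
    set q := σ (r + 1) with hq
    have hq0 : 0 < q := hσ r
    have hd (b e : ℝ) (x : ℝ) (hx : 0 < x) :
        HasDerivAt (fun x : ℝ => b * x ^ e) (b * e * x ^ (e - 1)) x := by
      have := (Real.hasDerivAt_rpow_const (p := e) (Or.inl hx.ne')).const_mul b
      rwa [← mul_assoc] at this
    set M := 1 + |1 * q| + |1 * q * (q - 1)| + |1 * q * (q - 1) * (q - 1 - 1)| with hM
    have hM0 : 0 < M := by positivity
    have hbd {b e e' : ℝ} (he : e = e') (hb : |b| ≤ M) (n : ℕ) :
        ∀ x ∈ Ioc (0 : ℝ) n, |b * x ^ e| ≤ M * x ^ e' := by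
      intro x hx
      have := Real.rpow_pos_of_pos hx.1 e'
      rw [he, abs_mul, abs_of_pos this]
      gcongr
    have n1 := abs_nonneg (1 * q)
    have n2 := abs_nonneg (1 * q * (q - 1))
    have n3 := abs_nonneg (1 * q * (q - 1) * (q - 1 - 1))
    refine ⟨C * M, by positivity, fun n hn => ?_⟩
    have hn1 : (1 : ℝ) ≤ n := by exact_mod_cast hn
    have key := hB (fun x => 1 * x ^ q) (fun x => 1 * q * x ^ (q - 1))
      (fun x => 1 * q * (q - 1) * x ^ (q - 1 - 1))
      (fun x => 1 * q * (q - 1) * (q - 1 - 1) * x ^ (q - 1 - 1 - 1)) M n hM0.le hn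
      (by rw [Real.zero_rpow hq0.ne', mul_zero]) (hd _ _) (hd _ _) (hd _ _)
      (fun x hx => (hd _ _ x hx).continuousAt.continuousWithinAt)
      (hbd rfl (by rw [abs_one]; linarith) n) (hbd rfl (by linarith) n)
      (hbd (by ring) (by linarith) n) (hbd (by ring) (by linarith) n)
    simp only [one_mul] at key
    rw [caputoOf_rpow hα hq0 (by linarith), abs_sub_comm] at key
    have e1 : startingRhs α σ m n r = Real.Gamma (q + 1) / Real.Gamma (q + 1 - α)
        * (n : ℝ) ^ (q - α) - wsglConv α (fun k => (k : ℝ) ^ q) n := rfl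
    rw [e1]
    refine key.trans ?_
    have : (n : ℝ) ^ (q - α - 2) ≤ (n : ℝ) ^ (s - α - 2) :=
      Real.rpow_le_rpow_of_exponent_le hn1 (by linarith [hs r])
    gcongr
  choose C hC hB using h1
  refine ⟨1 + ∑ r, C r, by have := Finset.sum_nonneg fun r (_ : r ∈ Finset.univ) => (hC r).le
                           linarith, fun n hn r => (hB r n hn).trans ?_⟩
  have := Finset.single_le_sum (fun r _ => (hC r).le) (Finset.mem_univ r)
  gcongr
  linarith

/-- The Vandermonde matrix does not depend on `n`, so the weights inherit the decay of the
right-hand side. -/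
theorem exists_abs_startingWeight_le {α s : ℝ} (h0 : 0 < α) (hα : α ≤ 1) {σ : ℕ → ℝ} {m : ℕ}
    (hσ : ∀ r : Fin m, 0 < σ (r + 1)) (hs : ∀ r : Fin m, σ (r + 1) ≤ s) :
    ∃ C : ℝ, 0 < C ∧ ∀ n, 1 ≤ n → ∀ k, |startingWeight α σ m n k|
      ≤ C * ((n : ℝ) ^ (s - α - 2) + (n : ℝ) ^ (-(1 / 2) : ℝ)) := by
  obtain ⟨C, hC, hB⟩ := exists_abs_startingRhs_le h0 hα hσ hs
  set V := (expVandermonde σ m)⁻¹ with hV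
  refine ⟨(1 + ∑ k, ∑ r, |V k r|) * C, by positivity, fun n hn k => ?_⟩
  set X := (n : ℝ) ^ (s - α - 2) + (n : ℝ) ^ (-(1 / 2) : ℝ) with hX
  have hX0 : 0 ≤ X := by positivity
  have h1 : ∑ r, |V k r| ≤ ∑ k, ∑ r, |V k r| :=
    Finset.single_le_sum (f := fun k => ∑ r, |V k r|) (fun k _ => by positivity)
      (Finset.mem_univ k)
  calc |startingWeight α σ m n k| = |∑ r, V k r * startingRhs α σ m n r| := rfl
    _ ≤ ∑ r, |V k r| * |startingRhs α σ m n r| := by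
      refine (Finset.abs_sum_le_sum_abs _ _).trans_eq ?_
      exact Finset.sum_congr rfl fun r _ => abs_mul _ _
    _ ≤ ∑ r, |V k r| * (C * X) := by gcongr with r; exact hB n hn r
    _ = (∑ r, |V k r|) * (C * X) := by rw [Finset.sum_mul]
    _ ≤ (1 + ∑ k, ∑ r, |V k r|) * (C * X) := by gcongr; linarith
    _ = _ := by ring

theorem wsglCorrected_eq (α : ℝ) (σ : ℕ → ℝ) (m : ℕ) (τ : ℝ) (u : ℕ → ℝ) (n : ℕ) :
    wsglCorrected α σ m τ u n = 1 / τ ^ α * wsglConv α u n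
      + 1 / τ ^ α * ∑ k : Fin m, startingWeight α σ m n k * u (k + 1) := rfl

theorem wsglCorrected_add (α : ℝ) (σ : ℕ → ℝ) (m : ℕ) (τ : ℝ) (u v : ℕ → ℝ) (n : ℕ) :
    wsglCorrected α σ m τ (fun k => u k + v k) n
      = wsglCorrected α σ m τ u n + wsglCorrected α σ m τ v n := by
  simp only [wsglCorrected, mul_add, Finset.sum_add_distrib]
  ring

theorem wsglCorrected_const_mul (α : ℝ) (σ : ℕ → ℝ) (m : ℕ) (τ b : ℝ) (u : ℕ → ℝ) (n : ℕ) :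
    wsglCorrected α σ m τ (fun k => b * u k) n = b * wsglCorrected α σ m τ u n := by
  simp only [wsglCorrected, mul_left_comm _ b, ← Finset.mul_sum]
  ring

theorem wsglCorrected_sum {ι : Type*} (I : Finset ι) (α : ℝ) (σ : ℕ → ℝ) (m : ℕ) (τ : ℝ)
    (u : ι → ℕ → ℝ) (n : ℕ) :
    wsglCorrected α σ m τ (fun k => ∑ i ∈ I, u i k) n
      = ∑ i ∈ I, wsglCorrected α σ m τ (u i) n := by
  classical
  induction I using Finset.induction_on with
  | empty => simp [wsglCorrected]
  | insert i I hi ih =>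
    simp only [Finset.sum_insert hi]
    rw [wsglCorrected_add, ih]

/-- The correction terms make the formula exact for the first `m` powers. -/
theorem wsglCorrected_rpow {σ : ℕ → ℝ} (hσ : StrictMonoOn σ (Ici 1)) (α : ℝ) {m n r : ℕ}
    (hr : r < m) (hn : 1 ≤ n) {τ : ℝ} (hτ : 0 < τ) :
    wsglCorrected α σ m τ (fun k => ((k : ℝ) * τ) ^ σ (r + 1)) n
      = Real.Gamma (σ (r + 1) + 1) / Real.Gamma (σ (r + 1) + 1 - α)
        * ((n : ℝ) * τ) ^ (σ (r + 1) - α) := by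
  have hw := (startingWeight_unique hσ α m n (startingWeight α σ m n)).2 rfl ⟨r, hr⟩
  have hn0 : (0 : ℝ) < n := by exact_mod_cast hn
  have e1 : (fun k : ℕ => ((k : ℝ) * τ) ^ σ (r + 1))
      = fun k : ℕ => τ ^ σ (r + 1) * (k : ℝ) ^ σ (r + 1) := by
    funext k
    rw [Real.mul_rpow k.cast_nonneg hτ.le, mul_comm]
  rw [e1, wsglCorrected_const_mul, wsglCorrected_eq, ← mul_add]
  have e2 : wsglConv α (fun k => (k : ℝ) ^ σ (r + 1)) n
      + ∑ k : Fin m, startingWeight α σ m n k * (((k : ℕ) + 1 : ℕ) : ℝ) ^ σ (r + 1)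
      = Real.Gamma (σ (r + 1) + 1) / Real.Gamma (σ (r + 1) + 1 - α)
        * (n : ℝ) ^ (σ (r + 1) - α) := by
    push_cast
    rw [hw, startingRhs, wsglConv]
    ring
  rw [e2, Real.mul_rpow hn0.le hτ.le, Real.rpow_sub hτ]
  ring

theorem GenSummable.nat_add {a p : ℕ → ℝ} {S : ℝ} (h : GenSummable a p S) (M : ℕ) :
    GenSummable (fun k => a (k + M)) (fun k => p (k + M)) S := fun R h0 h1 =>
  (summable_nat_add_iff (f := fun k => |a k| * R ^ p k) M).2 (h R h0 h1)

theorem genSum_eq_sum_add {a p : ℕ → ℝ} (hp : ∀ k, 0 < p k) (h : ∀ S, GenSummable a p S) (M : ℕ)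
    {t : ℝ} (ht : 0 ≤ t) :
    genSum a p t = ∑ k ∈ Finset.range M, a k * t ^ p k
      + genSum (fun k => a (k + M)) (fun k => p (k + M)) t := by
  rcases ht.eq_or_lt with rfl | h0
  · rw [genSum_zero hp, genSum_zero fun k => hp _]
    simp [Real.zero_rpow (hp _).ne']
  · exact (((h (t + 1)).summable h0 (by linarith)).sum_add_tsum_nat_add M).symm

theorem caputoOf_genSum_eq {a p : ℕ → ℝ} {P t α : ℝ} (hP : 0 < P) (hp : ∀ k, P ≤ p k)
    (h : ∀ S, GenSummable a p S) (M : ℕ) (ht : 0 < t) (hα : α ≤ 1) :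
    caputoOf α (genSum (fun k => a k * p k) fun k => p k - 1) t
      = ∑ k ∈ Finset.range M,
          a k * (Real.Gamma (p k + 1) / Real.Gamma (p k + 1 - α) * t ^ (p k - α))
        + caputoOf α (genSum (fun k => a (k + M) * p (k + M)) fun k => p (k + M) - 1) t := by
  have h1 := (h (t + 1)).hasSum_caputoOf hP hp ht (by linarith) hα
  have h2 := ((h (t + 1)).nat_add M).hasSum_caputoOf hP (fun k => hp _) ht (by linarith) hα
  rw [← h1.tsum_eq, ← h2.tsum_eq, h1.summable.sum_add_tsum_nat_add M]

/-- Truncation error of the corrected formula. -/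
theorem exists_consistency_bound {α T : ℝ} (h0 : 0 < α) (hα : α ≤ 1) (hT : 0 < T) {σ c : ℕ → ℝ}
    (hσ_pos : 0 < σ 1) (hσ : StrictMonoOn σ (Ici 1))
    (h : ∀ S, GenSummable (fun k => c (k + 1)) (fun k => σ (k + 1)) S) (M : ℕ) :
    ∃ C : ℝ, 0 < C ∧ ∀ (τ : ℝ) (n : ℕ), 0 < τ → 1 ≤ n → M ≤ n → n * τ ≤ T →
      |wsglCorrected α σ M τ
            (fun k => genSum (fun k => c (k + 1)) (fun k => σ (k + 1)) (k * τ)) n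
          - caputoOf α (genSum (fun k => c (k + 1) * σ (k + 1)) fun k => σ (k + 1) - 1) (n * τ)|
        ≤ C * τ ^ (σ (M + 1) - α)
          * ((n : ℝ) ^ (σ (M + 1) - α - 2) + (n : ℝ) ^ (-(1 / 2) : ℝ)) := by
  have hmono {i j : ℕ} (hij : i ≤ j) : σ (i + 1) ≤ σ (j + 1) :=
    hσ.monotoneOn (by simp) (by simp) (by omega)
  have hpos (k : ℕ) : 0 < σ (k + 1) := hσ_pos.trans_le (hmono k.zero_le)
  set P := σ (M + 1) with hP
  have hP0 : 0 < P := hpos M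
  set b := fun k => c (k + M + 1) with hb
  set q := fun k => σ (k + M + 1) with hq
  have hqP (k : ℕ) : P ≤ q k := hmono (Nat.le_add_left _ _)
  have hg (S : ℝ) : GenSummable b q S := (h S).nat_add M
  obtain ⟨C₁, hC₁, hB₁⟩ := exists_genSum_truncation_bound h0 hα hP0 hT hqP hg
  obtain ⟨C₂, hC₂, hB₂⟩ := exists_abs_startingWeight_le (s := P) (m := M) (σ := σ) h0 hα
    (fun r => hpos r) (fun r => hmono r.2.le)
  set B := ∑' k, |b k| * T ^ (q k - P) with hB
  have hB0 : 0 ≤ B := tsum_nonneg fun k => by positivity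
  refine ⟨C₁ + M * (C₂ * (B * (M : ℝ) ^ P)), by positivity, fun τ n hτ hn hMn hnT => ?_⟩
  have hn0 : (0 : ℝ) < n := by exact_mod_cast hn
  set X := (n : ℝ) ^ (P - α - 2) + (n : ℝ) ^ (-(1 / 2) : ℝ) with hX
  have hX0 : 0 ≤ X := by positivity
  have e1 : (fun k : ℕ => genSum (fun k => c (k + 1)) (fun k => σ (k + 1)) (k * τ))
      = fun k : ℕ => ∑ i ∈ Finset.range M, c (i + 1) * (k * τ) ^ σ (i + 1)
        + genSum b q (k * τ) := by
    funext k
    exact genSum_eq_sum_add hpos h M (by positivity)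
  have e2 : wsglCorrected α σ M τ (fun k : ℕ => ∑ i ∈ Finset.range M,
        c (i + 1) * (k * τ) ^ σ (i + 1)) n
      = ∑ i ∈ Finset.range M, c (i + 1) * (Real.Gamma (σ (i + 1) + 1)
        / Real.Gamma (σ (i + 1) + 1 - α) * (n * τ) ^ (σ (i + 1) - α)) := by
    rw [wsglCorrected_sum]
    refine Finset.sum_congr rfl fun i hi => ?_
    rw [wsglCorrected_const_mul, wsglCorrected_rpow hσ α (Finset.mem_range.1 hi) hn hτ]
  have e3 := caputoOf_genSum_eq (a := fun k => c (k + 1)) (p := fun k => σ (k + 1))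
    hσ_pos (fun k => hmono k.zero_le) h M (t := n * τ) (by positivity) hα
  -- The first `M` powers cancel exactly, which leaves the tail with exponents at least `P`.
  rw [e1, wsglCorrected_add, e2, e3, add_sub_add_left_eq_sub, wsglCorrected_eq]
  have t1 := hB₁ τ n hτ hn hnT
  -- The correction terms act on the tail at the first `M` nodes, where it is `O(τ^P)`; `M ≤ n`
  -- keeps these nodes inside `[0, T]`.
  have t2 : |1 / τ ^ α * ∑ k : Fin M, startingWeight α σ M n k
      * genSum b q (((k : ℕ) + 1 : ℕ) * τ)| ≤ M * (C₂ * (B * (M : ℝ) ^ P)) * τ ^ (P - α) * X := by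
    have h1 (k : Fin M) : |startingWeight α σ M n k * genSum b q (((k : ℕ) + 1 : ℕ) * τ)|
        ≤ C₂ * X * (B * (M : ℝ) ^ P * τ ^ P) := by
      have hk : (((k : ℕ) + 1 : ℕ) : ℝ) ≤ M := by exact_mod_cast k.2
      have hkn : (((k : ℕ) + 1 : ℕ) : ℝ) ≤ n := hk.trans (by exact_mod_cast hMn)
      have h2 := (hg (T + 1)).abs_genSum_le hqP (t := ((k : ℕ) + 1 : ℕ) * τ) (by positivity)
        (le_trans (by gcongr) hnT) (lt_add_one T)
      rw [abs_mul]
      refine mul_le_mul (hB₂ n hn k) (h2.trans ?_) (abs_nonneg _) (by positivity)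
      rw [Real.mul_rpow (by positivity) hτ.le, mul_assoc]
      gcongr
    have hτα : 0 < τ ^ α := by positivity
    rw [abs_mul, abs_of_pos (by positivity : 0 < 1 / τ ^ α), Real.rpow_sub hτ]
    calc 1 / τ ^ α * |∑ k : Fin M, startingWeight α σ M n k
          * genSum b q (((k : ℕ) + 1 : ℕ) * τ)|
        ≤ 1 / τ ^ α * ∑ _k : Fin M, C₂ * X * (B * (M : ℝ) ^ P * τ ^ P) := by
          gcongr
          exact (Finset.abs_sum_le_sum_abs _ _).trans (Finset.sum_le_sum fun k _ => h1 k)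
      _ = _ := by
          rw [Finset.sum_const, Finset.card_univ, Fintype.card_fin, nsmul_eq_mul]
          ring
  rw [add_sub_right_comm]
  refine (abs_add_le _ _).trans ((add_le_add t1 t2).trans_eq ?_)
  ring

theorem rpow_le_const_mul_rpow {τ T a b : ℝ} (hτ : 0 < τ) (hτT : τ ≤ T) (hab : a ≤ b) :
    τ ^ b ≤ T ^ (b - a) * τ ^ a := by
  have h : τ ^ b = τ ^ (b - a) * τ ^ a := by rw [← Real.rpow_add hτ]; congr 1; ring
  rw [h]
  gcongr

/-- Conversion of the truncation error into a weighted bound of order at most `3/2`. -/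
theorem exists_weighted_bound {β γ T : ℝ} (hT : 0 < T) (hγ : γ ≤ β) :
    ∃ C : ℝ, 0 < C ∧ ∀ (τ : ℝ) (n : ℕ), 0 < τ → 1 ≤ n → n * τ ≤ T →
      τ ^ β * ((n : ℝ) ^ (β - 2) + (n : ℝ) ^ (-(1 / 2) : ℝ))
        ≤ C * τ ^ min (3 / 2) γ * (n : ℝ) ^ (-(1 / 2) : ℝ) := by
  refine ⟨2 * T ^ (β - min (3 / 2) γ) , by positivity, fun τ n hτ hn hnT => ?_⟩
  have hn1 : (1 : ℝ) ≤ n := by exact_mod_cast hn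
  have hn0 : (0 : ℝ) < n := by linarith
  have hτT : τ ≤ T := (le_mul_of_one_le_left hτ.le hn1).trans hnT
  -- The cap `3/2` is what `n^(μ-2) ≤ n^(-1/2)` requires. The excess `β - μ` is spent on `(nτ)^(β-μ)
  -- ≤ T^(β-μ)`.
  set μ := min (3 / 2) γ with hμ
  have hμβ : μ ≤ β := (min_le_right _ _).trans hγ
  have h1 := rpow_le_const_mul_rpow hτ hτT hμβ
  have h2 : τ ^ β * (n : ℝ) ^ (β - 2)
      ≤ T ^ (β - μ) * τ ^ μ * (n : ℝ) ^ (-(1 / 2) : ℝ) := by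
    have e1 : τ ^ β * (n : ℝ) ^ (β - 2) = (n * τ) ^ (β - μ) * τ ^ μ * (n : ℝ) ^ (μ - 2) := by
      rw [Real.mul_rpow hn0.le hτ.le, show β - 2 = (β - μ) + (μ - 2) by ring, Real.rpow_add hn0]
      have : τ ^ β = τ ^ (β - μ) * τ ^ μ := by rw [← Real.rpow_add hτ]; congr 1; ring
      rw [this]; ring
    have e2 : (n : ℝ) ^ (μ - 2) ≤ (n : ℝ) ^ (-(1 / 2) : ℝ) :=
      Real.rpow_le_rpow_of_exponent_le hn1 (by linarith [min_le_left (3 / 2) γ])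
    have e3 : (n * τ) ^ (β - μ) ≤ T ^ (β - μ) :=
      Real.rpow_le_rpow (by positivity) hnT (by linarith)
    rw [e1]
    gcongr
  have h3 : τ ^ β * (n : ℝ) ^ (-(1 / 2) : ℝ)
      ≤ T ^ (β - μ) * τ ^ μ * (n : ℝ) ^ (-(1 / 2) : ℝ) := by gcongr
  rw [mul_add]
  refine (add_le_add h2 h3).trans_eq ?_
  ring

/-! ### The average error estimate -/

theorem wsglCorrected_congr {α : ℝ} {σ : ℕ → ℝ} {m n : ℕ} {τ : ℝ} {u v : ℕ → ℝ} (hm : m ≤ n)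
    (huv : ∀ k ≤ n, u k = v k) : wsglCorrected α σ m τ u n = wsglCorrected α σ m τ v n := by
  rw [wsglCorrected, wsglCorrected]
  congr 2
  · exact Finset.sum_congr rfl fun k hk => by
      rw [huv k (Nat.lt_succ_iff.1 (Finset.mem_range.1 hk))]
  · exact Finset.sum_congr rfl fun k _ => by rw [huv (k + 1) (k.2.trans_le hm)]

/-- The influence of the starting values on the corrected formula. -/
theorem exists_start_bound {α s : ℝ} (h0 : 0 < α) (hα : α ≤ 1) {σ : ℕ → ℝ} {m : ℕ} (M : ℕ)
    (hσ : ∀ r : Fin m, 0 < σ (r + 1)) (hs : ∀ r : Fin m, σ (r + 1) ≤ s) :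
    ∃ C : ℝ, 0 < C ∧ ∀ (τ : ℝ) (n K : ℕ) (u : ℕ → ℝ) (δ : ℝ), 0 < τ → M < n → n ≤ K →
      (∀ k, |u k| ≤ δ) → (∀ k, M < k → u k = 0) →
      |wsglCorrected α σ m τ u n|
        ≤ C * δ * (τ ^ (-α) * (K : ℝ) ^ max 0 (s - α - 3 / 2)) * (n : ℝ) ^ (-(1 / 2) : ℝ) := by
  obtain ⟨C, hC, hB⟩ := exists_abs_startingWeight_le h0 hα hσ hs
  refine ⟨(M + 1) * (4 * ((M : ℝ) + 1) ^ (1 / 2 : ℝ)) + m * (2 * C), by positivity, ?_⟩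
  intro τ n K u δ hτ hMn hnK hu huM
  have hδ : 0 ≤ δ := (abs_nonneg _).trans (hu 0)
  have hn : 1 ≤ n := by omega
  have hn1 : (1 : ℝ) ≤ n := by exact_mod_cast hn
  have hnK' : (n : ℝ) ≤ K := by exact_mod_cast hnK
  have hn0 : (0 : ℝ) < n := by linarith
  set E := max 0 (s - α - 3 / 2) with hE
  set X := (n : ℝ) ^ (-(1 / 2) : ℝ) with hX
  have hX0 : 0 < X := by positivity
  have hK1 : 1 ≤ (K : ℝ) ^ E := Real.one_le_rpow (by linarith) (le_max_left _ _)
  -- Growth of the starting weights beyond `n^(-1/2)` is charged to `K`; this is the origin of the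
  -- power of `K` in the estimate.
  have hKE : (n : ℝ) ^ (s - α - 2) ≤ (K : ℝ) ^ E * X := by
    calc (n : ℝ) ^ (s - α - 2) ≤ (n : ℝ) ^ (E + -(1 / 2)) :=
          Real.rpow_le_rpow_of_exponent_le hn1 (by linarith [le_max_right 0 (s - α - 3 / 2)])
      _ = (n : ℝ) ^ E * X := Real.rpow_add hn0 _ _
      _ ≤ _ := by
        gcongr
  have hXK : X ≤ (K : ℝ) ^ E * X := le_mul_of_one_le_left hX0.le hK1
  have t1 : |∑ k ∈ Finset.range (n + 1), wsglWeight α (n - k) * u k|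
      ≤ (M + 1) * (4 * ((M : ℝ) + 1) ^ (1 / 2 : ℝ)) * (δ * ((K : ℝ) ^ E * X)) := by
    have e1 : ∑ k ∈ Finset.range (n + 1), wsglWeight α (n - k) * u k
        = ∑ k ∈ Finset.range (M + 1), wsglWeight α (n - k) * u k := by
      refine (Finset.sum_subset (Finset.range_mono (by omega)) fun k _ hk => ?_).symm
      rw [huM k (by simpa using hk), mul_zero]
    have e2 : ∀ k ∈ Finset.range (M + 1), |wsglWeight α (n - k) * u k|
        ≤ 4 * ((M : ℝ) + 1) ^ (1 / 2 : ℝ) * (δ * ((K : ℝ) ^ E * X)) := by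
      intro k hk
      have hkM : k ≤ M := Nat.lt_succ_iff.1 (Finset.mem_range.1 hk)
      have hnk : 1 ≤ n - k := by omega
      -- Starting indices satisfy `k ≤ M < n`, so `n - k` is comparable with `n`.
      have h1 : (n : ℝ) / (M + 1) ≤ ((n - k : ℕ) : ℝ) := by
        rw [div_le_iff₀ (by positivity)]
        have : n ≤ (n - k) * (M + 1) := by
          obtain ⟨d, hd⟩ : ∃ d, n = k + d := ⟨n - k, by omega⟩
          have hd1 : n - k = d := by omega
          rw [hd1] at hnk ⊢
          nlinarith
        exact_mod_cast this
      have h2 : ((n - k : ℕ) : ℝ) ^ (-(1 / 2) : ℝ) ≤ ((M : ℝ) + 1) ^ (1 / 2 : ℝ) * X := by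
        refine (Real.rpow_le_rpow_of_nonpos (by positivity) h1 (by norm_num)).trans_eq ?_
        rw [Real.div_rpow hn0.le (by positivity), Real.rpow_neg (by positivity : (0 : ℝ) ≤ M + 1),
          div_inv_eq_mul, mul_comm]
      rw [abs_mul]
      calc |wsglWeight α (n - k)| * |u k|
          ≤ 4 * (((M : ℝ) + 1) ^ (1 / 2 : ℝ) * ((K : ℝ) ^ E * X)) * δ := by
            refine mul_le_mul ((abs_wsglWeight_le h0 hα hnk).trans ?_) (hu k) (abs_nonneg _)
              (by positivity)
            refine mul_le_mul_of_nonneg_left (h2.trans ?_) (by norm_num)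
            gcongr
        _ = _ := by ring
    rw [e1]
    refine (Finset.abs_sum_le_sum_abs _ _).trans ((Finset.sum_le_sum e2).trans_eq ?_)
    rw [Finset.sum_const, Finset.card_range, nsmul_eq_mul]
    push_cast
    ring
  have t2 : |∑ k : Fin m, startingWeight α σ m n k * u (k + 1)|
      ≤ m * (2 * C) * (δ * ((K : ℝ) ^ E * X)) := by
    have e2 : ∀ k ∈ (Finset.univ : Finset (Fin m)), |startingWeight α σ m n k * u (k + 1)|
        ≤ 2 * C * (δ * ((K : ℝ) ^ E * X)) := by
      intro k _
      rw [abs_mul]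
      calc |startingWeight α σ m n k| * |u (k + 1)|
          ≤ (C * ((K : ℝ) ^ E * X + (K : ℝ) ^ E * X)) * δ := by
            refine mul_le_mul ((hB n hn k).trans ?_) (hu _) (abs_nonneg _) (by positivity)
            gcongr
        _ = _ := by ring
    refine (Finset.abs_sum_le_sum_abs _ _).trans ((Finset.sum_le_sum e2).trans_eq ?_)
    rw [Finset.sum_const, Finset.card_univ, Fintype.card_fin, nsmul_eq_mul]
    ring
  have hτα : 0 < τ ^ α := by positivity
  rw [wsglCorrected, ← mul_add, abs_mul, abs_of_pos (by positivity : 0 < 1 / τ ^ α),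
    Real.rpow_neg hτ.le]
  calc 1 / τ ^ α * |∑ k ∈ Finset.range (n + 1), wsglWeight α (n - k) * u k
        + ∑ k : Fin m, startingWeight α σ m n k * u (k + 1)|
      ≤ 1 / τ ^ α * ((M + 1) * (4 * ((M : ℝ) + 1) ^ (1 / 2 : ℝ)) * (δ * ((K : ℝ) ^ E * X))
        + m * (2 * C) * (δ * ((K : ℝ) ^ E * X))) := by
        gcongr
        exact (abs_add_le _ _).trans (add_le_add t1 t2)
    _ = _ := by ring

theorem le_numStart {Q : ℕ} (m : Fin Q → ℕ) (j : Fin Q) : m j ≤ numStart m :=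
  Finset.le_sup (f := m) (Finset.mem_univ j)

/-- Consistency of the scheme for the exact solution. -/
theorem IsSolution.exists_residual_bound {Q : ℕ} [NeZero Q] {ν α : Fin Q → ℝ}
    (hν₁ : 0 < ν 0) (hν : ∀ j, 0 ≤ ν j) (hα_pos : ∀ j, 0 < α j) (hα_anti : Antitone α)
    (hα_one : α 0 ≤ 1) {T : ℝ} (hT : 0 < T) {Y₀ : ℝ} {Y : ℝ → ℝ}
    (hY : IsSolution ν α (fun _ y => -y) T Y₀ Y)
    {σ c : ℕ → ℝ} (hσ_pos : 0 < σ 1) (hσ_mono : StrictMonoOn σ (Ici 1))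
    (hexp : ∀ t ∈ Icc 0 T, HasSum (fun k : ℕ => c (k + 1) * t ^ σ (k + 1)) (Y t - Y 0))
    (m : Fin Q → ℕ) :
    ∃ C : ℝ, 0 < C ∧ ∀ (τ : ℝ) (n : ℕ), 0 < τ → 1 ≤ n → numStart m ≤ n → n * τ ≤ T →
      |∑ j, ν j * wsglCorrected (α j) σ (m j) τ (fun k => Y (k * τ) - Y₀) n + Y (n * τ)|
        ≤ C * τ ^ min (3 / 2) (⨅ j, (σ (m j + 1) - α j)) * (n : ℝ) ^ (-(1 / 2) : ℝ) := by
  have hα1 (j : Fin Q) : α j ≤ 1 := (hα_anti (Fin.zero_le j)).trans hα_one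
  have hp : StrictMono fun k => σ (k + 1) := fun i j hij =>
    hσ_mono (by simp) (by simp) (by omega)
  have hgen := hY.genSummable hν₁ hν hα_pos hα_anti hα_one hT hp hσ_pos hexp
  have hpP (k : ℕ) : σ 1 ≤ σ (k + 1) := hp.monotone k.zero_le
  have hval : ∀ t ∈ Icc 0 T, Y t = Y₀ + genSum (fun k => c (k + 1)) (fun k => σ (k + 1)) t := by
    intro t ht
    have := (hexp t ht).tsum_eq
    rw [hY.initial] at this
    rw [genSum, this]; ring
  have h1 (j : Fin Q) : ∃ C : ℝ, 0 < C ∧ ∀ (τ : ℝ) (n : ℕ), 0 < τ → 1 ≤ n → numStart m ≤ n →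
      n * τ ≤ T → |wsglCorrected (α j) σ (m j) τ (fun k => Y (k * τ) - Y₀) n
        - caputoDeriv (α j) Y (n * τ)|
        ≤ C * (τ ^ min (3 / 2) (⨅ j, (σ (m j + 1) - α j)) * (n : ℝ) ^ (-(1 / 2) : ℝ)) := by
    obtain ⟨C₁, hC₁, hB₁⟩ := exists_consistency_bound (hα_pos j) (hα1 j) hT hσ_pos hσ_mono hgen
      (m j)
    obtain ⟨C₂, hC₂, hB₂⟩ := exists_weighted_bound hT
      (ciInf_le (Finite.bddBelow_range fun j => σ (m j + 1) - α j) j)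
    refine ⟨C₁ * C₂, by positivity, fun τ n hτ hn hmn hnT => ?_⟩
    have hn0 : (0 : ℝ) < n := by exact_mod_cast hn
    have hmj : m j ≤ n := (le_numStart m j).trans hmn
    rw [(hgen (n * τ + 1)).caputoDeriv_eq hpP (by positivity) (lt_add_one _) (hα_pos j) (hα1 j)
      fun s hs => hval s ⟨hs.1, hs.2.trans hnT⟩]
    rw [wsglCorrected_congr hmj (v := fun k : ℕ =>
      genSum (fun k => c (k + 1)) (fun k => σ (k + 1)) (k * τ)) fun k hk => by
        have hk' : (k : ℝ) ≤ n := by exact_mod_cast hk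
        rw [hval (k * τ) ⟨by positivity, le_trans (by gcongr) hnT⟩]; ring]
    refine (hB₁ τ n hτ hn hmj hnT).trans ?_
    rw [mul_assoc, mul_assoc C₁]
    refine mul_le_mul_of_nonneg_left ?_ hC₁.le
    rw [← mul_assoc]
    exact hB₂ τ n hτ hn hnT
  choose C hC hB using h1
  refine ⟨1 + ∑ j, ν j * C j, by
    have := Finset.sum_nonneg fun j (_ : j ∈ Finset.univ) => mul_nonneg (hν j) (hC j).le
    linarith, fun τ n hτ hn hmn hnT => ?_⟩
  have hn0 : (0 : ℝ) < n := by exact_mod_cast hn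
  set X := τ ^ min (3 / 2) (⨅ j, (σ (m j + 1) - α j)) * (n : ℝ) ^ (-(1 / 2) : ℝ) with hX
  have hX0 : 0 ≤ X := by positivity
  have e1 : Y (n * τ) = -∑ j, ν j * caputoDeriv (α j) Y (n * τ) := by
    rw [hY.eqn (n * τ) ⟨by positivity, hnT⟩, neg_neg]
  rw [e1, ← sub_eq_add_neg, ← Finset.sum_sub_distrib]
  calc _ ≤ ∑ j, ν j * (C j * X) := by
        refine (Finset.abs_sum_le_sum_abs _ _).trans (Finset.sum_le_sum fun j _ => ?_)
        rw [← mul_sub, abs_mul, abs_of_nonneg (hν j)]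
        exact mul_le_mul_of_nonneg_left (hB j τ n hτ hn hmn hnT) (hν j)
    _ = (∑ j, ν j * C j) * X := by
        rw [Finset.sum_mul]
        exact Finset.sum_congr rfl fun j _ => by ring
    _ ≤ (1 + ∑ j, ν j * C j) * X := by gcongr; linarith
    _ = _ := by rw [hX]; ring

theorem abs_nodalError_le_maxStartError (Y : ℝ → ℝ) (τ : ℝ) (y : ℕ → ℝ) {M k : ℕ} (hk : 1 ≤ k)
    (hkM : k ≤ M) : |nodalError Y τ y k| ≤ maxStartError Y τ y M := by
  have h := le_ciSup (Finite.bddAbove_range fun r : Fin M => |nodalError Y τ y (r + 1)|)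
    ⟨k - 1, by omega⟩
  simp only [Nat.sub_add_cancel hk] at h
  exact h

theorem maxStartError_nonneg (Y : ℝ → ℝ) (τ : ℝ) (y : ℕ → ℝ) (M : ℕ) :
    0 ≤ maxStartError Y τ y M :=
  Real.iSup_nonneg fun _ => abs_nonneg _

theorem IsDiscreteSolution.error_eq {Q : ℕ} {ν α : Fin Q → ℝ} {σ : ℕ → ℝ} {m : Fin Q → ℕ}
    {T Y₀ : ℝ} {N : ℕ} {y : ℕ → ℝ}
    (hy : IsDiscreteSolution ν α σ m (fun _ y => -y) T Y₀ N y) (Y : ℝ → ℝ) {n : ℕ}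
    (hn : numStart m < n) (hnN : n ≤ N) :
    ∑ j, ν j * wsglCorrected (α j) σ (m j) (T / N) (nodalError Y (T / N) y) n
        + nodalError Y (T / N) y n
      = ∑ j, ν j * wsglCorrected (α j) σ (m j) (T / N) (fun k => Y (k * (T / N)) - Y₀) n
        + Y (n * (T / N)) := by
  have e1 : nodalError Y (T / N) y
      = fun k : ℕ => (Y (k * (T / N)) - Y₀) + (-1) * (y k - y 0) := by
    funext k
    rw [nodalError, hy.initial]; ring
  have e2 (j : Fin Q) : wsglCorrected (α j) σ (m j) (T / N) (nodalError Y (T / N) y) n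
      = wsglCorrected (α j) σ (m j) (T / N) (fun k => Y (k * (T / N)) - Y₀) n
        - wsglCorrected (α j) σ (m j) (T / N) (fun k => y k - y 0) n := by
    rw [e1, wsglCorrected_add, wsglCorrected_const_mul]; ring
  have e3 := hy.scheme n hn hnN
  simp only [e2, mul_sub, Finset.sum_sub_distrib, e3]
  rw [nodalError]
  ring

/-- The error is split into its starting part `u` and the rest `v`. Then `v` solves an uncorrected
scheme with vanishing starting values, to which `stability` applies, while `u` enters the residual.
-/
theorem exists_averageError_le {Q : ℕ} [NeZero Q] {ν α : Fin Q → ℝ}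
    (hν₁ : 0 < ν 0) (hν : ∀ j, 0 ≤ ν j) (hα_pos : ∀ j, 0 < α j) (hα_anti : Antitone α)
    (hα_one : α 0 ≤ 1) {T : ℝ} (hT : 0 < T) {Y₀ : ℝ} {Y : ℝ → ℝ}
    (hY : IsSolution ν α (fun _ y => -y) T Y₀ Y)
    {σ c : ℕ → ℝ} (hσ_pos : 0 < σ 1) (hσ_mono : StrictMonoOn σ (Ici 1))
    (hexp : ∀ t ∈ Icc 0 T, HasSum (fun k : ℕ => c (k + 1) * t ^ σ (k + 1)) (Y t - Y 0))
    (m : Fin Q → ℕ) :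
    ∃ C : ℝ, 0 < C ∧ ∀ (N : ℕ) (y : ℕ → ℝ), 0 < N →
      IsDiscreteSolution ν α σ m (fun _ y => -y) T Y₀ N y → ∀ K : ℕ, 1 ≤ K → K ≤ N →
        averageError Y (T / N) y K
          ≤ C * (T / N) ^ min 2 ((⨅ j, (σ (m j + 1) - α j)) + 1 / 2)
            + C * maxStartError Y (T / N) y (numStart m)
              * ∑ j, (T / N) ^ (1 / 2 - α j)
                  * (K : ℝ) ^ max 0 (σ (numStart m) - α j - 3 / 2) := by
  have hα1 (j : Fin Q) : α j ≤ 1 := (hα_anti (Fin.zero_le j)).trans hα_one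
  have hmono {i j : ℕ} (hi : 1 ≤ i) (hij : i ≤ j) : σ i ≤ σ j :=
    hσ_mono.monotoneOn hi (hi.trans hij) hij
  obtain ⟨C₁, hC₁, hR⟩ := hY.exists_residual_bound hν₁ hν hα_pos hα_anti hα_one hT hσ_pos
    hσ_mono hexp m
  have hst (j : Fin Q) := exists_start_bound (s := σ (numStart m)) (hα_pos j) (hα1 j) (σ := σ)
    (m := m j) (numStart m) (fun r => hσ_pos.trans_le (hmono le_rfl (by omega)))
    (fun r => hmono (by omega) (r.2.trans_le (le_numStart m j)))
  choose C₂ hC₂ hst using hst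
  obtain ⟨C₃, hC₃, hS⟩ := stability hν ⟨0, hν₁⟩ hα_pos hα1 hT
  set M := numStart m with hM
  set q := ⨅ j, (σ (m j + 1) - α j) with hq
  set D := 1 + ∑ j, ν j * C₂ j with hD
  have hνC (j : Fin Q) : 0 ≤ ν j * C₂ j := mul_nonneg (hν j) (hC₂ j).le
  have hDj (j : Fin Q) : ν j * C₂ j ≤ D := by
    have := Finset.single_le_sum (fun j _ => hνC j) (Finset.mem_univ j)
    linarith
  have hD0 : 0 < D := by
    have := Finset.sum_nonneg fun j (_ : j ∈ Finset.univ) => hνC j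
    linarith
  refine ⟨√C₃ * C₁ + √C₃ * D + √M * T ^ α 0, by positivity, fun N y hN hy K hK hKN => ?_⟩
  set τ := T / N with hτd
  have hN0 : (0 : ℝ) < N := by exact_mod_cast hN
  have hτ : 0 < τ := by positivity
  have hnT {n : ℕ} (hn : n ≤ N) : n * τ ≤ T := by
    have h1 : (n : ℝ) ≤ N := by exact_mod_cast hn
    calc n * τ ≤ N * τ := by gcongr
      _ = T := by rw [hτd]; field_simp
  have hτT : τ ≤ T := by simpa using hnT (n := 1) hN
  set e := nodalError Y τ y with he
  set δ := maxStartError Y τ y M with hδ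
  have hδ0 : 0 ≤ δ := maxStartError_nonneg _ _ _ _
  have he0 : e 0 = 0 := by
    rw [he, nodalError, hy.initial, Nat.cast_zero, zero_mul, hY.initial, sub_self]
  let u : ℕ → ℝ := fun k => if k ≤ M then e k else 0
  let v : ℕ → ℝ := fun k => if k ≤ M then 0 else e k
  have hvu (k : ℕ) : e k = v k + u k := by
    simp only [u, v]
    split_ifs <;> simp
  have hu : ∀ k, |u k| ≤ δ := by
    intro k
    simp only [u]
    split_ifs with hk
    · rcases Nat.eq_zero_or_pos k with rfl | h
      · rw [he0, abs_zero]; exact hδ0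
      · exact abs_nodalError_le_maxStartError _ _ _ h hk
    · rw [abs_zero]; exact hδ0
  have huM : ∀ k, M < k → u k = 0 := fun k hk => if_neg (by omega)
  have hvM : ∀ k, k ≤ M → v k = 0 := fun k hk => if_pos hk
  set W : Fin Q → ℝ := fun j => (K : ℝ) ^ max 0 (σ M - α j - 3 / 2) with hW
  have hW1 (j : Fin Q) : 1 ≤ W j :=
    Real.one_le_rpow (by exact_mod_cast hK) (le_max_left _ _)
  set Z := ∑ j, τ ^ (-α j) * W j with hZ
  have hZ0 : 0 ≤ Z := Finset.sum_nonneg fun j _ => mul_nonneg (by positivity)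
    (zero_le_one.trans (hW1 j))
  set B := C₁ * τ ^ min (3 / 2) q + D * δ * Z with hB
  have hB0 : 0 ≤ B := add_nonneg (by positivity) (mul_nonneg (mul_nonneg hD0.le hδ0) hZ0)
  -- For `n ≤ M` this residual is zero although the scheme does not hold there, since `v` vanishes
  -- up to `M`.
  let r : ℕ → ℝ := fun n => ∑ j, ν j * (1 / τ ^ α j * wsglConv (α j) v n) + v n
  have hr : ∀ n, 1 ≤ n → n ≤ K → |r n| ≤ B * (n : ℝ) ^ (-(1 / 2) : ℝ) := by
    intro n hn hnK
    have hX : 0 < (n : ℝ) ^ (-(1 / 2) : ℝ) := by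
      have : (0 : ℝ) < n := by exact_mod_cast hn
      positivity
    rcases le_or_gt n M with hnM | hnM
    · have h1 (j : Fin Q) : wsglConv (α j) v n = 0 := by
        refine Finset.sum_eq_zero fun k hk => ?_
        rw [hvM k (by have := Finset.mem_range.1 hk; omega), mul_zero]
      simp only [r, h1, hvM n hnM, mul_zero, Finset.sum_const_zero, add_zero, abs_zero]
      exact mul_nonneg hB0 hX.le
    -- All nodes used by the correction terms are at most `M`, so they see `u` only.
    have h1 (j : Fin Q) : 1 / τ ^ α j * wsglConv (α j) v n
        = wsglCorrected (α j) σ (m j) τ e n - wsglCorrected (α j) σ (m j) τ u n := by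
      rw [funext hvu, wsglCorrected_add, add_sub_cancel_right, wsglCorrected_eq,
        Finset.sum_eq_zero fun k _ => by
          rw [hvM _ (k.2.trans_le (le_numStart m j)), mul_zero], mul_zero, add_zero]
    have h2 : v n = e n := if_neg (by omega)
    have h3 := hy.error_eq Y hnM (hnK.trans hKN)
    rw [← hτd, ← he] at h3
    have h4 : r n = (∑ j, ν j * wsglCorrected (α j) σ (m j) τ (fun k => Y (k * τ) - Y₀) n
        + Y (n * τ)) - ∑ j, ν j * wsglCorrected (α j) σ (m j) τ u n := by
      rw [← h3]
      simp only [r, h1, h2, mul_sub, Finset.sum_sub_distrib]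
      ring
    have h5 : |∑ j, ν j * wsglCorrected (α j) σ (m j) τ u n|
        ≤ D * δ * Z * (n : ℝ) ^ (-(1 / 2) : ℝ) := by
      calc _ ≤ ∑ j, D * δ * (τ ^ (-α j) * W j) * (n : ℝ) ^ (-(1 / 2) : ℝ) := by
            refine (Finset.abs_sum_le_sum_abs _ _).trans (Finset.sum_le_sum fun j _ => ?_)
            rw [abs_mul, abs_of_nonneg (hν j)]
            have hWj := zero_le_one.trans (hW1 j)
            calc _ ≤ ν j * (C₂ j * δ * (τ ^ (-α j) * W j) * (n : ℝ) ^ (-(1 / 2) : ℝ)) :=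
                  mul_le_mul_of_nonneg_left (hst j τ n K u δ hτ hnM hnK hu huM) (hν j)
              _ = ν j * C₂ j * (δ * (τ ^ (-α j) * W j) * (n : ℝ) ^ (-(1 / 2) : ℝ)) := by ring
              _ ≤ D * (δ * (τ ^ (-α j) * W j) * (n : ℝ) ^ (-(1 / 2) : ℝ)) :=
                  mul_le_mul_of_nonneg_right (hDj j) (by positivity)
              _ = _ := by ring
        _ = _ := by rw [hZ, ← Finset.sum_mul, Finset.mul_sum]
    rw [h4, hB, add_mul]
    exact (abs_sub _ _).trans (add_le_add (hR τ n hτ hn hnM.le (hnT (hnK.trans hKN))) h5)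
  have hsv := hS τ K v r B hτ (hnT hKN) (hvM 0 M.zero_le) (fun n _ _ => rfl) hr
  have hsum : ∑ n ∈ Finset.Icc 1 K, |e n| ^ 2 ≤ C₃ * B ^ 2 + M * δ ^ 2 := by
    have h1 : ∑ n ∈ Finset.Icc 1 K, |e n| ^ 2
        = ∑ n ∈ Finset.Icc 1 K, v n ^ 2 + ∑ n ∈ Finset.Icc 1 K, u n ^ 2 := by
      rw [← Finset.sum_add_distrib]
      refine Finset.sum_congr rfl fun n _ => ?_
      simp only [u, v, sq_abs]
      split_ifs <;> simp
    have h2 : ∑ n ∈ Finset.Icc 1 K, v n ^ 2 ≤ ∑ n ∈ Finset.range (K + 1), v n ^ 2 :=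
      Finset.sum_le_sum_of_subset_of_nonneg (fun n hn => by
        have := Finset.mem_Icc.1 hn
        exact Finset.mem_range.2 (by omega)) fun n _ _ => sq_nonneg _
    have h3 : ∑ n ∈ Finset.Icc 1 K, u n ^ 2 ≤ M * δ ^ 2 := by
      calc _ ≤ ∑ n ∈ Finset.Icc 1 K ∪ Finset.Icc 1 M, u n ^ 2 :=
            Finset.sum_le_sum_of_subset_of_nonneg Finset.subset_union_left
              fun n _ _ => sq_nonneg _
        _ = ∑ n ∈ Finset.Icc 1 M, u n ^ 2 := by
            refine (Finset.sum_subset Finset.subset_union_right fun n hn hn' => ?_).symm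
            have h4 : M < n := by
              rw [Finset.mem_union, Finset.mem_Icc] at hn
              rw [Finset.mem_Icc] at hn hn'
              omega
            rw [huM n h4]; simp
        _ ≤ ∑ _n ∈ Finset.Icc 1 M, δ ^ 2 := by
            refine Finset.sum_le_sum fun n _ => ?_
            rw [← sq_abs]
            exact pow_le_pow_left₀ (abs_nonneg _) (hu n) 2
        _ = _ := by simp
    rw [h1]
    exact add_le_add (h2.trans hsv) h3
  have hhalf : (τ ^ (1 / 2 : ℝ)) ^ 2 = τ := by
    rw [← Real.rpow_natCast, ← Real.rpow_mul hτ.le]; norm_num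
  have hτ2 : 0 < τ ^ (1 / 2 : ℝ) := by positivity
  have havg : averageError Y τ y K ≤ τ ^ (1 / 2 : ℝ) * (√C₃ * B + √M * δ) := by
    rw [averageError, ← Real.sqrt_eq_rpow, Real.sqrt_le_iff]
    have hCB : 0 ≤ √C₃ * B := mul_nonneg (Real.sqrt_nonneg _) hB0
    have hMδ : 0 ≤ √M * δ := mul_nonneg (Real.sqrt_nonneg _) hδ0
    refine ⟨mul_nonneg hτ2.le (add_nonneg hCB hMδ), ?_⟩
    rw [mul_pow, hhalf]
    refine mul_le_mul_of_nonneg_left (hsum.trans ?_) hτ.le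
    have h1 : (√C₃ * B + √M * δ) ^ 2
        = (√C₃) ^ 2 * B ^ 2 + (√M) ^ 2 * δ ^ 2 + 2 * ((√C₃ * B) * (√M * δ)) := by ring
    rw [h1, Real.sq_sqrt hC₃.le, Real.sq_sqrt M.cast_nonneg]
    linarith [mul_nonneg hCB hMδ]
  -- The half order gained by averaging.
  have hmin : τ ^ (1 / 2 : ℝ) * τ ^ min (3 / 2) q = τ ^ min 2 (q + 1 / 2) := by
    rw [← Real.rpow_add hτ, add_comm, ← min_add_add_right]
    norm_num
  have hZ' : τ ^ (1 / 2 : ℝ) * Z = ∑ j, τ ^ (1 / 2 - α j) * W j := by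
    rw [hZ, Finset.mul_sum]
    refine Finset.sum_congr rfl fun j _ => ?_
    rw [← mul_assoc, ← Real.rpow_add hτ, sub_eq_add_neg]
  set S := ∑ j, τ ^ (1 / 2 - α j) * W j with hSd
  have hS0 : 0 ≤ S := by rw [← hZ']; exact mul_nonneg hτ2.le hZ0
  -- The direct contribution of the starting errors to the average, `√M δ τ^(1/2)`, is absorbed into
  -- the second term of the estimate.
  have hτS : τ ^ (1 / 2 : ℝ) ≤ T ^ α 0 * S := by
    have h1 := rpow_le_const_mul_rpow hτ hτT
      (show 1 / 2 - α 0 ≤ 1 / 2 by linarith [hα_pos 0])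
    rw [sub_sub_cancel] at h1
    refine h1.trans (mul_le_mul_of_nonneg_left ?_ (by positivity))
    have h2 : τ ^ (1 / 2 - α 0) * W 0 ≤ S :=
      Finset.single_le_sum (f := fun j => τ ^ (1 / 2 - α j) * W j)
        (fun j _ => mul_nonneg (by positivity) (zero_le_one.trans (hW1 j))) (Finset.mem_univ 0)
    exact (le_mul_of_one_le_right (by positivity) (hW1 0)).trans h2
  set A := τ ^ min 2 (q + 1 / 2) with hA
  have hA0 : 0 < A := by positivity
  refine havg.trans ?_
  calc τ ^ (1 / 2 : ℝ) * (√C₃ * B + √M * δ)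
      = √C₃ * C₁ * (τ ^ (1 / 2 : ℝ) * τ ^ min (3 / 2) q)
        + √C₃ * D * δ * (τ ^ (1 / 2 : ℝ) * Z) + √M * δ * τ ^ (1 / 2 : ℝ) := by
        rw [hB]; ring
    _ ≤ √C₃ * C₁ * A + √C₃ * D * δ * S + √M * δ * (T ^ α 0 * S) := by
        rw [hmin, hZ']
        gcongr
    _ = √C₃ * C₁ * A + (√C₃ * D + √M * T ^ α 0) * (δ * S) := by ring
    _ ≤ (√C₃ * C₁ + √C₃ * D + √M * T ^ α 0) * A
        + (√C₃ * C₁ + √C₃ * D + √M * T ^ α 0) * (δ * S) := by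
        have p1 : 0 ≤ √C₃ * D := by positivity
        have p2 : 0 ≤ √M * T ^ α 0 := by positivity
        have p3 : 0 ≤ √C₃ * C₁ := by positivity
        exact add_le_add (mul_le_mul_of_nonneg_right (by linarith) hA0.le)
          (mul_le_mul_of_nonneg_right (by linarith) (mul_nonneg hδ0 hS0))
    _ = _ := by ring

theorem iInf_order_sub {Q : ℕ} [NeZero Q] {α : Fin Q → ℝ} (hα : Antitone α) (x : ℝ) :
    ⨅ j, (x - α j) = x - α 0 :=
  le_antisymm (ciInf_le (Finite.bddBelow_range fun j => x - α j) 0)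
    (le_ciInf fun j => sub_le_sub_left (hα (Fin.zero_le j)) x)

/-- With `K ≤ T/τ`, the second term of the estimate becomes a pure power of `τ`, to be compared with
the first. -/
theorem exists_averageError_le_of_start {Q : ℕ} [NeZero Q] {ν α : Fin Q → ℝ}
    (hν₁ : 0 < ν 0) (hν : ∀ j, 0 ≤ ν j) (hα_pos : ∀ j, 0 < α j) (hα_anti : Antitone α)
    (hα_one : α 0 ≤ 1) {T : ℝ} (hT : 0 < T) {Y₀ : ℝ} {Y : ℝ → ℝ}
    (hY : IsSolution ν α (fun _ y => -y) T Y₀ Y)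
    {σ c : ℕ → ℝ} (hσ_pos : 0 < σ 1) (hσ_mono : StrictMonoOn σ (Ici 1))
    (hexp : ∀ t ∈ Icc 0 T, HasSum (fun k : ℕ => c (k + 1) * t ^ σ (k + 1)) (Y t - Y 0))
    {m : Fin Q → ℕ} {M : ℕ} (hm : ∀ j, m j = M) {C₀ : ℝ} (hC₀ : 0 < C₀) :
    ∃ C : ℝ, 0 < C ∧ ∀ (N : ℕ) (y : ℕ → ℝ), 0 < N →
      IsDiscreteSolution ν α σ m (fun _ y => -y) T Y₀ N y →
      maxStartError Y (T / N) y M ≤ C₀ * (T / N) ^ σ (M + 1) → ∀ K : ℕ, 1 ≤ K → K ≤ N →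
        averageError Y (T / N) y K ≤ C * (T / N) ^ min 2 (σ (M + 1) - α 0 + 1 / 2) := by
  obtain ⟨C₁, hC₁, hB⟩ := exists_averageError_le hν₁ hν hα_pos hα_anti hα_one hT hY hσ_pos
    hσ_mono hexp m
  have hnum : numStart m = M := by
    rw [numStart, show m = fun _ => M from funext hm]
    exact Finset.sup_const Finset.univ_nonempty M
  simp only [hm, hnum, iInf_order_sub hα_anti] at hB
  set μ := min 2 (σ (M + 1) - α 0 + 1 / 2) with hμ
  let E : Fin Q → ℝ := fun j => max 0 (σ M - α j - 3 / 2)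
  let ε : Fin Q → ℝ := fun j => σ (M + 1) + (1 / 2 - α j) - E j
  refine ⟨C₁ + C₁ * ∑ j, C₀ * T ^ E j * T ^ (ε j - μ), by positivity, ?_⟩
  intro N y hN hy hstart K hK hKN
  refine (hB N y hN hy K hK hKN).trans ?_
  set τ := T / N with hτd
  have hN0 : (0 : ℝ) < N := by exact_mod_cast hN
  have hτ : 0 < τ := by positivity
  have hτT : τ ≤ T := div_le_self hT.le (by exact_mod_cast hN)
  set δ := maxStartError Y τ y M with hδ
  have hδ0 : 0 ≤ δ := maxStartError_nonneg _ _ _ _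
  have key (j : Fin Q) : δ * (τ ^ (1 / 2 - α j) * (K : ℝ) ^ E j)
      ≤ C₀ * T ^ E j * T ^ (ε j - μ) * τ ^ μ := by
    -- Without starting values the maximum is an empty supremum, equal to `0`; this case is separate
    -- because nothing is known about `σ 0`.
    rcases Nat.eq_zero_or_pos M with hM | hM
    · have : δ = 0 := by
        rw [hδ, hM]
        exact Real.iSup_of_isEmpty _
      rw [this, zero_mul]
      positivity
    have hE0 : 0 ≤ E j := le_max_left _ _
    -- If the power of `K` is trivial, then `ε j = σ_{M+1} - α_j + 1/2`; otherwise `ε j = 2 +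
    -- σ_{M+1} - σ_M`, which exceeds `2`.
    have hεμ : μ ≤ ε j := by
      have h1 : σ M < σ (M + 1) := hσ_mono hM (Nat.le_add_left 1 M) (Nat.lt_succ_self M)
      have h2 : α j ≤ α 0 := hα_anti (Fin.zero_le j)
      rcases max_cases 0 (σ M - α j - 3 / 2) with h | h
      · refine (min_le_right _ _).trans ?_
        simp only [ε, E, h.1]
        linarith
      · refine (min_le_left _ _).trans ?_
        simp only [ε, E, h.1]
        linarith
    have hKτ : (K : ℝ) ≤ T * τ⁻¹ := by
      have h1 : (K : ℝ) ≤ N := by exact_mod_cast hKN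
      refine h1.trans_eq ?_
      rw [hτd]; field_simp
    have hKE : (K : ℝ) ^ E j ≤ T ^ E j * τ ^ (-E j) := by
      rw [Real.rpow_neg hτ.le, ← Real.inv_rpow hτ.le, ← Real.mul_rpow hT.le (by positivity)]
      exact Real.rpow_le_rpow (by positivity) hKτ hE0
    calc δ * (τ ^ (1 / 2 - α j) * (K : ℝ) ^ E j)
        ≤ C₀ * τ ^ σ (M + 1) * (τ ^ (1 / 2 - α j) * (T ^ E j * τ ^ (-E j))) := by gcongr
      _ = C₀ * T ^ E j * τ ^ ε j := by
          simp only [ε]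
          rw [sub_eq_add_neg _ (E j), Real.rpow_add hτ, Real.rpow_add hτ]
          ring
      _ ≤ C₀ * T ^ E j * (T ^ (ε j - μ) * τ ^ μ) := by
          gcongr
          exact rpow_le_const_mul_rpow hτ hτT hεμ
      _ = _ := by ring
  rw [add_mul, mul_assoc C₁ δ, mul_assoc C₁ (∑ j, _), Finset.mul_sum]
  refine add_le_add le_rfl (mul_le_mul_of_nonneg_left ?_ hC₁.le)
  rw [Finset.sum_mul]
  exact Finset.sum_le_sum fun j _ => key j

end MultiTermFODE
end

open MultiTermFODE in
theorem mainTheorem5 {Q : ℕ} [NeZero Q] (ν α : Fin Q → ℝ)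
    (hν₁ : 0 < ν 0) (hν : ∀ j, 0 ≤ ν j)
    (hα_pos : ∀ j, 0 < α j) (hα_anti : Antitone α) (hα_one : α 0 ≤ 1)
    (T : ℝ) (hT : 0 < T) (Y₀ : ℝ) (Y : ℝ → ℝ)
    (hY : IsSolution ν α (fun _ y => -y) T Y₀ Y)
    (σ c : ℕ → ℝ) (hσ_pos : 0 < σ 1) (hσ_mono : StrictMonoOn σ (Set.Ici 1))
    (hexp : ∀ t ∈ Set.Icc 0 T, HasSum (fun k : ℕ => c (k + 1) * t ^ σ (k + 1)) (Y t - Y 0))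
    (m : Fin Q → ℕ) (hm : ∀ j, 1 ≤ m j → σ (m j) ≤ 2) :
    (∃ C : ℝ, 0 < C ∧ ∀ (N : ℕ) (y : ℕ → ℝ), 0 < N → numStart m ≤ N →
      IsDiscreteSolution ν α σ m (fun _ y => -y) T Y₀ N y → ∀ K : ℕ, 1 ≤ K → K ≤ N →
        averageError Y (T / N) y K
          ≤ C * (T / N) ^ min 2 ((⨅ j, (σ (m j + 1) - α j)) + 1 / 2)
            + C * maxStartError Y (T / N) y (numStart m)
              * ∑ j, (T / N) ^ (1 / 2 - α j)
                  * (K : ℝ) ^ max 0 (σ (numStart m) - α j - 3 / 2)) ∧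
    ((∀ j, m j = 0) →
      ∃ C : ℝ, 0 < C ∧ ∀ (N : ℕ) (y : ℕ → ℝ), 0 < N →
        IsDiscreteSolution ν α σ m (fun _ y => -y) T Y₀ N y → ∀ K : ℕ, 1 ≤ K → K ≤ N →
          averageError Y (T / N) y K ≤ C * (T / N) ^ min 2 (σ 1 - α 0 + 1 / 2)) ∧
    (∀ M : ℕ, (∀ j, m j = M) → ∀ C₀ : ℝ, 0 < C₀ →
      ∃ C : ℝ, 0 < C ∧ ∀ (N : ℕ) (y : ℕ → ℝ), 0 < N → M ≤ N →
        IsDiscreteSolution ν α σ m (fun _ y => -y) T Y₀ N y →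
        maxStartError Y (T / N) y M ≤ C₀ * (T / N) ^ σ (M + 1) → ∀ K : ℕ, 1 ≤ K → K ≤ N →
          averageError Y (T / N) y K ≤ C * (T / N) ^ min 2 (σ (M + 1) - α 0 + 1 / 2)) := by
  have hi : ∀ M : ℕ, (∀ j, m j = M) → ∀ C₀ : ℝ, 0 < C₀ →
      ∃ C : ℝ, 0 < C ∧ ∀ (N : ℕ) (y : ℕ → ℝ), 0 < N →
        IsDiscreteSolution ν α σ m (fun _ y => -y) T Y₀ N y →
        maxStartError Y (T / N) y M ≤ C₀ * (T / N) ^ σ (M + 1) → ∀ K : ℕ, 1 ≤ K → K ≤ N →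
          averageError Y (T / N) y K ≤ C * (T / N) ^ min 2 (σ (M + 1) - α 0 + 1 / 2) :=
    fun M hM C₀ hC₀ => exists_averageError_le_of_start hν₁ hν hα_pos hα_anti hα_one hT hY hσ_pos
      hσ_mono hexp hM hC₀
  refine ⟨?_, fun h0 => ?_, fun M hM C₀ hC₀ => ?_⟩
  · obtain ⟨C, hC, h⟩ := exists_averageError_le hν₁ hν hα_pos hα_anti hα_one hT hY hσ_pos
      hσ_mono hexp m
    exact ⟨C, hC, fun N y hN _ => h N y hN⟩
  -- Part (i) is the case `M = 0` of part (ii), where the condition on the starting errors is void.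
  · obtain ⟨C, hC, h⟩ := hi 0 h0 1 one_pos
    refine ⟨C, hC, fun N y hN hy => h N y hN hy ?_⟩
    have : maxStartError Y (T / N) y 0 = 0 := Real.iSup_of_isEmpty _
    rw [this]
    positivity
  · obtain ⟨C, hC, h⟩ := hi M hM C₀ hC₀
    exact ⟨C, hC, fun N y hN _ => h N y hN⟩
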